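/- Conventions. $\kappa$ is the security parameter. A QPT procedure is a uniform family of quantum circuits over a fixed finite universal gate set, i.e. a polynomial time Turing machine outputs the description of the $\kappa$-th circuit on input $1^\kappa$. A QPT adversary $(\mathcal P,\mathcal F_1,\mathcal F_2,\dots)$ is a uniform family of tuples of circuits in the same sense. A function $\nu(\kappa)$ is negligible if it decays faster than $\kappa^{-c}$ for every $c$, and $f\le g+\mathrm{negl}$ means $f\le g+\nu$ for some negligible $\nu$. A balanced binary function $\mathsf{BBF}$ consists of QPT procedures $\mathsf{Sample}$, $\mathsf{Eval}$ and a polynomial $\ell$ such that every description $f$ output by $\mathsf{Sample}(1^\kappa)$ determines, via $\mathsf{Eval}$, a deterministic function $f:\{0,1\}^{\ell(\kappa)}\to\{0,1\}$, and $|\Pr[f(x)=0]-\Pr[f(x)=1]|$ is negligible for $f\leftarrow\mathsf{Sample}(1^\kappa)$ and uniform $x$. A copy protection scheme $\mathsf{QCP}$ for $\mathsf{BBF}$ consists of QPT procedures $\mathcal{P}rotect$ (from descriptions to quantum states) and $\mathcal{E}val$ such that $\mathcal{E}val(\mathcal{P}rotect(f),x)=f(x)$ with probability $1$ for all sampled $f$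 and all $x$. For $n=n(\kappa)$, $k=k(\kappa)$, the game $\mathsf{WEAK\text{-}QCP}^{n,k}$ is: sample $f\leftarrow\mathsf{Sample}(1^\kappa)$ and uniform $x\in\{0,1\}^{\ell(\kappa)}$; run $\mathcal{P}rotect(f)$ $n$ times; the pirate $\mathcal P$ turns the $n$ programs into an $(n+k)$-partite state $\sigma_1,\dots,\sigma_{n+k}$; $\mathcal F_i(\sigma_i,x)$ outputs $y_i$; the output is the number of $i$ with $y_i=f(x)$. $\mathsf{QCP}$ is $\mathsf{WEAK\text{-}QCP}^{n,k}$ secure if for every QPT adversary the expected output is at most $n+k/2+\mathrm{negl}$. The scheme $\mathsf{1UD}^{\mathsf{cpa}}$ built from $\mathsf{QCP}$ is: the key is $f\leftarrow\mathsf{Sample}(1^\kappa)$; decryptors are generated by $\mathcal{P}rotect(f)$; $\mathsf{Enc}_f(b)=(r,b\oplus f(r))$ with uniform $r\in\{0,1\}^{\ell(\kappa)}$; $\mathsf{Dec}_f(r,c)=c\oplus f(r)$; and a decryptor $\rho$ decrypts $(r,c)$ to $c\oplus\mathcal{E}val(\rho,r)$. For a bit encryption scheme with decryptors, the game $\mathsf{UD1\text{-}qCPA}^{n,k}$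 is: generate a key and $n$ decryptors, and sample uniform bits $b_1,\dots,b_{n+k}$; the pirate turns the decryptors into an $(n+k)$-partite state $\sigma_1,\dots,\sigma_{n+k}$; the distinguisher $\mathcal D_i$ gets $\sigma_i$ and $c_i\leftarrow\mathsf{Enc}(b_i)$ and outputs $\beta_i$; the output is the number of $i$ with $\beta_i=b_i$. The pirate and all distinguishers have quantum access to $\mathsf{Enc}$, i.e. to $|m,z\rangle\mapsto|m,z\oplus\mathsf{Enc}(m;r)\rangle$ with fresh uniform coins $r$ for every query. The scheme is $\mathsf{UD1\text{-}qCPA}^{n,k}$ secure if for every QPT adversary the expected output is at most $n+k/2+\mathrm{negl}$. Proposition. Let $\mathsf{QCP}$ be a copy protection scheme for a balanced binary function, and let $n,k:\mathbb N\to\mathbb N$ be polynomially bounded with $n(\kappa)\ge 1$ for all $\kappa$. If $\mathsf{QCP}$ is $\mathsf{WEAK\text{-}QCP}^{n,k}$ secure, then $\mathsf{1UD}^{\mathsf{cpa}}$ is $\mathsf{UD1\text{-}qCPA}^{n,k}$ secure. -/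

import Mathlib

open scoped BigOperators

noncomputable section

namespace CopyProt

/-! ## Quantum circuits

Qubits are named by *wires*. The computational basis states of a register with wire set `W` are the
finite sets `s : Finset W`: the wires in `s` hold `1`, all others hold `0`. The wire set may be
infinite, but only finitely many wires are ever touched, and all others stay `0`. Circuits are
unitary; measurements are deferred to the end, and discarding a qubit means never using its wire
again. -/

/-- Kinds of registers of a procedure: inputs, outputs, workspace, and the two registers through
which an oracle is queried. All registers other than the inputs start in the state `0`. -/
inductive Kind
  | inp | out | work | ask | ans
  deriving DecidableEq

/-- Qubit number `pos` of the register number `reg` of the given kind. -/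
structure Wire where
  kind : Kind
  reg : ℕ
  pos : ℕ
  deriving DecidableEq

/-- A fixed finite universal gate set: Pauli `X`, Hadamard, `T = diag(1, exp(iπ/4))`, its inverse,
controlled not (control first) and the Toffoli gate (target last). -/
inductive Gate (W : Type)
  | x (w : W)
  | h (w : W)
  | t (w : W)
  | tdg (w : W)
  | cx (c w : W)
  | ccx (c₁ c₂ w : W)

/-- Renaming of wires. -/
def Gate.map {V W : Type} (f : V → W) : Gate V → Gate W
  | .x w => .x (f w)
  | .h w => .h (f w)
  | .t w => .t (f w)
  | .tdg w => .tdg (f w)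
  | .cx c w => .cx (f c) (f w)
  | .ccx c₁ c₂ w => .ccx (f c₁) (f c₂) (f w)

/-- (Pure, finitely supported) states on the wires `W`, as vectors of amplitudes. -/
abbrev State (W : Type) := Finset W →₀ ℂ

/-- The basis state `|s⟩`. -/
def ket {W : Type} (s : Finset W) : State W := Finsupp.single s 1

/-- The image of the basis state `|s⟩` under a gate. A controlled gate whose target is also one of
its controls is ignored. -/
def Gate.onKet {W : Type} [DecidableEq W] (s : Finset W) : Gate W → State W
  | .x w => ket (symmDiff s {w})
  | .h w => ((1 / Real.sqrt 2 : ℝ) : ℂ) •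
      (ket (s.erase w) + (if w ∈ s then (-1 : ℂ) else 1) • ket (insert w s))
  | .t w => (if w ∈ s then Complex.exp (Complex.I * (Real.pi / 4)) else 1) • ket s
  | .tdg w => (if w ∈ s then Complex.exp (-(Complex.I * (Real.pi / 4))) else 1) • ket s
  | .cx c w => ket (if c ≠ w ∧ c ∈ s then symmDiff s {w} else s)
  | .ccx c₁ c₂ w =>
      ket (if c₁ ≠ w ∧ c₂ ≠ w ∧ c₁ ∈ s ∧ c₂ ∈ s then symmDiff s {w} else s)

/-- Linear extension of `Gate.onKet`. -/
def Gate.apply {W : Type} [DecidableEq W] (g : Gate W) (ψ : State W) : State W :=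
  ψ.sum fun s a => a • g.onKet s

/-- A circuit is a list of gates; its first element is applied first. -/
abbrev Circuit := List (Gate Wire)

/-- Run a list of gates on a state. -/
def run {W : Type} [DecidableEq W] (c : List (Gate W)) (ψ : State W) : State W :=
  c.foldl (fun φ g => g.apply φ) ψ

/-- Measure all wires of `ψ` in the computational basis: the expectation of the quantity `v` of the
outcome. -/
def expect {W : Type} (ψ : State W) (v : Finset W → ℝ) : ℝ :=
  ψ.sum fun s a => ‖a‖ ^ 2 * v s

/-- The probability that measuring all wires of `ψ` gives an outcome in `E`. -/
def prob {W : Type} (ψ : State W) (E : Set (Finset W)) : ℝ :=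
  expect ψ (E.indicator 1)

/-! ## Classical strings -/

/-- The classical content of a register: the set of positions that hold a `1`. (A finite string of
variable length is written in a register for instance by appending a `1` as an end marker.) -/
abbrev Content := Finset ℕ

/-- The content of a register that holds the fixed length string `x`. -/
def bits {l : ℕ} (x : Fin l → Bool) : Content :=
  (Finset.univ.filter fun j => x j = true).image fun j : Fin l => (j : ℕ)

/-- The basis state in which the given register, named by the wires `w 0, w 1, …`, has content
`u`. -/
def load {W : Type} [DecidableEq W] (w : ℕ → W) (u : Content) : Finset W := u.image w

/-- The wire that carries the single bit output of a procedure. -/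
def outBit : Wire := ⟨.out, 0, 0⟩

/-- The content of the output register `0` in the measurement outcome `s`. -/
def outContent (s : Finset Wire) : Content :=
  (s.filter fun w => w.kind = .out ∧ w.reg = 0).image Wire.pos

/-- The final state of a circuit without input. -/
def sampleState (c : Circuit) : State Wire := run c (ket ∅)

/-- The expectation of `v u`, where `u` is the measured output of the sampling circuit `c`. -/
def sampleExpect (c : Circuit) (v : Content → ℝ) : ℝ :=
  expect (sampleState c) fun s => v (outContent s)

/-- The possible outputs of the sampling circuit `c`. -/
def sampleSupport (c : Circuit) : Set Content :=
  {u | ∃ s ∈ (sampleState c).support, outContent s = u}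

/-! ## Oracle circuits -/

/-- A gate of a circuit with oracle access. `query` submits the wire `(ask, 0, 0)` as a one bit
message and receives the answer in the register `(ans, 0)`. -/
inductive OGate
  | gate (g : Gate Wire)
  | query

/-- A step of an experiment on the wires `W`: a gate, or an oracle query with the given message wire
and the given answer register. -/
inductive Step (W : Type)
  | gate (g : Gate W)
  | query (m : W) (a : ℕ → W)

/-- Renaming of the wires of a gate with oracle access. -/
def OGate.toStep {W : Type} (f : Wire → W) : OGate → Step W
  | .gate g => .gate (g.map f)
  | .query => .query (f ⟨.ask, 0, 0⟩) fun j => f ⟨.ans, 0, j⟩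

/-- The unitary `|m, a⟩ ↦ |m, a ⊕ resp m⟩` on message wire `m` and answer register `a`. -/
def queryApply {W : Type} [DecidableEq W] (resp : Bool → Content) (m : W) (a : ℕ → W)
    (ψ : State W) : State W :=
  ψ.mapDomain fun s => symmDiff s (load a (resp (decide (m ∈ s))))

/-- Run the steps on the state `ψ` and measure at the end: the expectation of the quantity `v` of the
outcome. `resp · r` is the randomized oracle with random coins `r`; every query uses fresh uniform
coins. -/
def expRun {W R : Type} [DecidableEq W] [Fintype R] (resp : Bool → R → Content)
    (v : Finset W → ℝ) : List (Step W) → State W → ℝ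
  | [], ψ => expect ψ v
  | .gate g :: l, ψ => expRun resp v l (g.apply ψ)
  | .query m a :: l, ψ => 𝔼 r : R, expRun resp v l (queryApply (fun b => resp b r) m a ψ)

/-! ## Uniformity -/

/-- Alphabet for descriptions of circuits. -/
inductive Sym
  | tick | sep | fin
  | inp | out | work | ask | ans
  | x | h | t | tdg | cx | ccx | query
  deriving DecidableEq

def Kind.code : Kind → Sym
  | .inp => .inp
  | .out => .out
  | .work => .work
  | .ask => .ask
  | .ans => .ans

def unary (n : ℕ) : List Sym := List.replicate n .tick ++ [.sep]

def Wire.code (w : Wire) : List Sym := w.kind.code :: (unary w.reg ++ unary w.pos)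

def Gate.code : Gate Wire → List Sym
  | .x w => .x :: w.code
  | .h w => .h :: w.code
  | .t w => .t :: w.code
  | .tdg w => .tdg :: w.code
  | .cx c w => .cx :: (c.code ++ w.code)
  | .ccx c₁ c₂ w => .ccx :: (c₁.code ++ c₂.code ++ w.code)

def OGate.code : OGate → List Sym
  | .gate g => g.code
  | .query => [.query]

/-- The description of a list, from descriptions of its elements. -/
def listCode {α : Type} (code : α → List Sym) (l : List α) : List Sym :=
  l.flatMap code ++ [.fin]

/-- A family `C` of objects with descriptions `code` is uniform: a polynomial time Turing machine
outputs, on the input `1^κ`, the description of `C κ`. -/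
def Uniform {α : Type} (code : α → List Sym) (C : ℕ → α) : Prop :=
  Nonempty (Turing.TM2ComputableInPolyTime Computability.unaryEncodeNat code C)

/-- Quantum polynomial time procedures: uniform families of circuits (of polynomial size). -/
def QPT (C : ℕ → Circuit) : Prop := Uniform (listCode Gate.code) C

/-- `ν` is negligible. -/
def Negl (ν : ℕ → ℝ) : Prop :=
  Asymptotics.SuperpolynomialDecay Filter.atTop (fun κ : ℕ => (κ : ℝ)) ν

/-- `f = poly`. -/
def PolyBounded (f : ℕ → ℕ) : Prop := ∃ p : Polynomial ℕ, ∀ κ, f κ ≤ p.eval κ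

/-! ## Balanced binary functions and copy protection -/

/-- A balanced binary function. The argument `κ` is the security parameter.
`sample κ` outputs the description of a function; `eval κ` takes a description in the input register
`0` and an argument in the input register `1`. -/
structure BBF where
  /-- the polynomial that gives the input length -/
  len : Polynomial ℕ
  sample : ℕ → Circuit
  sample_qpt : QPT sample
  eval : ℕ → Circuit
  eval_qpt : QPT eval
  /-- `fn κ f` is the function that `eval` computes from the description `f` -/
  fn : (κ : ℕ) → Content → (Fin (len.eval κ) → Bool) → Bool
  eval_fn : ∀ κ, ∀ f ∈ sampleSupport (sample κ), ∀ x,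
    prob (run (eval κ)
        (ket (load (Wire.mk .inp 0) f ∪ load (Wire.mk .inp 1) (bits x))))
      {s | decide (outBit ∈ s) = fn κ f x} = 1
  /-- `|Pr[f(x) = 0] - Pr[f(x) = 1]|` is negligible for a sampled `f` and a uniform `x` -/
  balanced : Negl fun κ =>
    |(sampleExpect (sample κ) fun f =>
        𝔼 x : Fin (len.eval κ) → Bool, if fn κ f x = false then (1 : ℝ) else 0) -
      (sampleExpect (sample κ) fun f =>
        𝔼 x : Fin (len.eval κ) → Bool, if fn κ f x = true then (1 : ℝ) else 0)|

/-- The wiring of an evaluation circuit (right) whose input register `0` is the output register `0`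
of a preceding circuit (left). -/
def evalWire (w : Wire) : Wire ⊕ Wire :=
  if w.kind = .inp ∧ w.reg = 0 then .inl ⟨.out, 0, w.pos⟩ else .inr w

/-- The final state of the following: `prep` is run on the classical input `f`, and `ev` is run on
the resulting quantum state (input register `0`) and the classical string `u` (input register
`1`). -/
def prepEval (prep ev : Circuit) (f u : Content) : State (Wire ⊕ Wire) :=
  run (prep.map (Gate.map Sum.inl) ++ ev.map (Gate.map evalWire))
    (ket (load (fun j => Sum.inl ⟨.inp, 0, j⟩) f ∪ load (fun j => Sum.inr ⟨.inp, 1, j⟩) u))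

/-- A copy protection scheme for a balanced binary function: `protect` takes a description of a
function to a quantum program, and `eval` takes a quantum program (input register `0`) and an
argument (input register `1`) to the value of the function. -/
structure QCP (B : BBF) where
  protect : ℕ → Circuit
  protect_qpt : QPT protect
  eval : ℕ → Circuit
  eval_qpt : QPT eval
  correct : ∀ κ, ∀ f ∈ sampleSupport (B.sample κ), ∀ x,
    prob (prepEval (protect κ) (eval κ) f (bits x))
      {s | decide (Sum.inr outBit ∈ s) = B.fn κ f x} = 1

/-! ## The two games -/

/-- A pirate and a list of freeloaders (or distinguishers), given by circuits with gates in `G`.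
The pirate gets the `i`-th program in its input register `i` and leaves the state for the `i`-th
freeloader in its output register `i`. A freeloader gets its state in the input register `0` and a
classical challenge in the input register `1`. Freeloaders that are missing in the list do nothing,
so their answer is `0`; superfluous ones are not invoked. -/
structure Adversary (G : Type) where
  pirate : List G
  free : List (List G)

def Adversary.code {G : Type} (code : G → List Sym) (A : Adversary G) : List Sym :=
  listCode code A.pirate ++ listCode (listCode code) A.free

/-- An adversary without oracle access, as one with oracle access that makes no queries. -/
def Adversary.lift (A : Adversary (Gate Wire)) : Adversary OGate :=
  ⟨A.pirate.map .gate, A.free.map (List.map .gate)⟩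

/-- The circuits that take part in a game: the runs of the circuit which generates the programs, the
pirate, and the freeloaders. Each has wires of its own. -/
inductive Party
  | source (i : ℕ)
  | pirate
  | free (i : ℕ)
  deriving DecidableEq

abbrev GWire := Party × Wire

/-- The first `n` input registers of the pirate are the outputs of the runs of the source. -/
def pirateWire (n : ℕ) (w : Wire) : GWire :=
  if w.kind = .inp ∧ w.reg < n then (.source w.reg, ⟨.out, 0, w.pos⟩) else (.pirate, w)

/-- The input register `0` of the `i`-th freeloader is the output register `i` of the pirate. -/
def freeWire (i : ℕ) (w : Wire) : GWire :=
  if w.kind = .inp ∧ w.reg = 0 then (.pirate, ⟨.out, i, w.pos⟩) else (.free i, w)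

/-- `n` runs of `prog`, then the pirate, then `m` freeloaders (on disjoint sets of wires). -/
def gameSteps (prog : Circuit) (n m : ℕ) (A : Adversary OGate) : List (Step GWire) :=
  ((List.range n).flatMap fun i => prog.map fun g => .gate (g.map fun w => (.source i, w))) ++
    A.pirate.map (OGate.toStep (pirateWire n)) ++
    (List.range m).flatMap fun i => (A.free.getD i []).map (OGate.toStep (freeWire i))

/-- Initially, every run of the source holds the key, the `i`-th freeloader holds the challenge
`chal i`, and all else is `0`. -/
def gameInit (n m : ℕ) (key : Content) (chal : Fin m → Content) : Finset GWire :=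
  ((Finset.range n).biUnion fun i => load (fun j => (.source i, ⟨.inp, 0, j⟩)) key) ∪
    (Finset.univ.biUnion fun i : Fin m => load (fun j => (.free i, ⟨.inp, 1, j⟩)) (chal i))

/-- The number of freeloaders `i` whose answer is `target i`. -/
def score {m : ℕ} (target : Fin m → Bool) (s : Finset GWire) : ℝ :=
  ((Finset.univ.filter fun i : Fin m =>
    decide (((Party.free i, outBit) : GWire) ∈ s) = target i).card : ℝ)

/-- The expected number of correct answers when the programs are generated by `prog` from `key`, the
challenges and the correct answers are given, and all queries are answered by `resp` with fresh
coins. -/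
def playGame {R : Type} [Fintype R] (prog : Circuit) (key : Content) (n m : ℕ)
    (resp : Bool → R → Content) (chal : Fin m → Content) (target : Fin m → Bool)
    (A : Adversary OGate) : ℝ :=
  expRun resp (score target) (gameSteps prog n m A) (ket (gameInit n m key chal))

/-- The expected output of the weak copy protection game with `n` programs and `n + k` freeloaders,
for a sampled function and a uniform argument. There is no oracle. -/
def QCP.weakGame {B : BBF} (Q : QCP B) (n k κ : ℕ) (A : Adversary (Gate Wire)) : ℝ :=
  sampleExpect (B.sample κ) fun f => 𝔼 x : Fin (B.len.eval κ) → Bool,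
    playGame (Q.protect κ) f n (n + k) (fun (_ : Bool) (_ : Unit) => ∅)
      (fun _ => bits x) (fun _ => B.fn κ f x) A.lift

/-- Weak copy protection security, for `n κ` programs and `k κ` additional copies. -/
def QCP.WeakSecure {B : BBF} (Q : QCP B) (n k : ℕ → ℕ) : Prop :=
  ∀ A : ℕ → Adversary (Gate Wire), Uniform (Adversary.code Gate.code) A →
    ∃ ν, Negl ν ∧ ∀ κ, Q.weakGame (n κ) (k κ) κ (A κ) ≤ n κ + (k κ : ℝ) / 2 + ν κ

/-- The five procedures of an uncloneable decryptors scheme for messages of one bit. The classical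
procedures `enc` (with explicit coins) and `dec` are given as functions. `decGen` takes a key to a
decryptor, and `qdec` takes a decryptor (input register `0`) and a ciphertext (input register `1`) to
a message. -/
structure BitUD where
  keyGen : ℕ → Circuit
  decGen : ℕ → Circuit
  /-- number of coins of `enc` -/
  coins : ℕ → ℕ
  /-- length of the ciphertexts -/
  clen : ℕ → ℕ
  enc : (κ : ℕ) → (key : Content) → (b : Bool) → (r : Fin (coins κ) → Bool) → Fin (clen κ) → Bool
  dec : (κ : ℕ) → (key : Content) → (c : Fin (clen κ) → Bool) → Bool
  qdec : ℕ → Circuit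

/-- The expected output of the game for one bit messages under quantum chosen plaintext attacks,
with `n` decryptors and `n + k` distinguishers: the `i`-th distinguisher gets an encryption of `b i`
and has to find `b i`; the pirate and the distinguishers have quantum access to `enc` under the
secret key. -/
def BitUD.qcpaGame (S : BitUD) (n k κ : ℕ) (A : Adversary OGate) : ℝ :=
  sampleExpect (S.keyGen κ) fun key =>
    𝔼 b : Fin (n + k) → Bool, 𝔼 r : Fin (n + k) → Fin (S.coins κ) → Bool,
      playGame (S.decGen κ) key n (n + k) (fun m r' => bits (S.enc κ key m r'))
        (fun i => bits (S.enc κ key (b i) (r i))) b A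

/-- One bit uncloneable decryptor security under quantum chosen plaintext attacks, for `n κ`
decryptors and `k κ` additional copies. -/
def BitUD.QCPASecure (S : BitUD) (n k : ℕ → ℕ) : Prop :=
  ∀ A : ℕ → Adversary OGate, Uniform (Adversary.code OGate.code) A →
    ∃ ν, Negl ν ∧ ∀ κ, S.qcpaGame (n κ) (k κ) κ (A κ) ≤ n κ + (k κ : ℝ) / 2 + ν κ

/-! ## The construction -/

/-- The wiring of the evaluation of a program on the first `l` bits of a ciphertext: the remaining
ciphertext bits are kept apart from the wires of the evaluation circuit. -/
def qdecWire (l : ℕ) (w : Wire) : Wire :=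
  if w.kind = .inp ∧ (2 ≤ w.reg ∨ (w.reg = 1 ∧ l ≤ w.pos)) then ⟨.inp, w.reg + 1, w.pos⟩ else w

/-- Uncloneable bit decryptors from copy protection of a balanced binary function: the key is a
sampled function `f`, the decryptors are copy protected programs for `f`, the encryption of `b` is
`(r, b ⊕ f(r))` for a uniform `r`, and the decryption of `(r, c)` is `c ⊕ f(r)`, where `f(r)` is
computed from the key or from the program. -/
def oneUDcpa {B : BBF} (Q : QCP B) : BitUD where
  keyGen := B.sample
  decGen := Q.protect
  coins κ := B.len.eval κ
  clen κ := B.len.eval κ + 1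
  enc κ f b r := Fin.snoc (α := fun _ => Bool) r (xor b (B.fn κ f r))
  dec κ f c := xor (c (Fin.last _)) (B.fn κ f fun j => c j.castSucc)
  qdec κ := (Q.eval κ).map (Gate.map (qdecWire (B.len.eval κ))) ++
    [.cx ⟨.inp, 1, B.len.eval κ⟩ outBit]

end CopyProt

end

open scoped BigOperators

noncomputable section

namespace CopyProt

/-! ## Stack machines with one elementary operation per step -/

/-! Let `A` attack the encryption scheme. Its oracle can be imitated by anyone who holds one program
for `f`: an answer to a query is `(r, m ⊕ f(r))` with fresh uniform `r`, so a pair `(r, f(r))` that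
is prepared in advance suffices. Evaluation is correct with probability one, so after evaluating at
`r` the output wire holds a definite bit. That bit can be copied, the evaluation can be undone, and
the program is returned exactly as it was (`run_fetchOn`). The pirate of the reduction prepares one
pair for every query in all circuits of `A`, hands the pairs of the distinguishers over together
with their states, and then runs the pirate of `A` on prepared answers (`tavg_sim`,
`expect_simulation`). The freeloader that gets `x` tosses a coin `c`, presents `(x, c)` as the
ciphertext and adds `c` to the answer. Since `(x, c)` encrypts `c ⊕ f(x)`, the sum is `f(x)` exactly
when the distinguisher is right.

The challenges are independent in one game and built from one common `x` in the other. This does not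
matter: the output is a sum of indicators, one for each freeloader, and the distribution of one
answer does not depend on what happens on the wires of the others (`expRun_run`,
`expRun_drop_left`). So both expectations are sums of values of `solo`, in which only one freeloader
occurs, and `solo_reduction` is an exact equality for every key. The one discrepancy is due to
freeloaders that are missing from the list: their answer `0` is right with probability `1/2` in the
encryption game and with probability `Pr[f(x) = 0]` in the other (`real_eq_sim`). There are at most
`n + k` of them, so `qcpaGame_le` bounds the loss by `n + k` times the imbalance of `f`, which is
negligible.

It remains to see that the reduction is a uniform family (`reduction_uniform`). The reduction is a
function on descriptions of circuits, made of scans that copy, drop or replace symbols, and of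
arithmetic in unary. The class `PT` of string functions computed in polynomial time by stack
machines is closed under bounded recursion on strings (`PT.recOn`), which yields all these
operations. `PT.ofUniform` and `PT.uniform` translate from and to Turing machines. Queries are
numbered by the length of the description that follows them: this is available to a scan, and it
makes the numbers distinct. -/

/-- Elementary stack operations that end in a value of `N`. -/
inductive Op (Γ N : Type)
  | push (k : ℕ) (a : Γ) (s : N)
  | pop (k : ℕ) (f : Option Γ → N)
  | peek (k : ℕ) (f : Option Γ → N)
  | jump (s : N)

/-- Post-composition of the continuation of an operation. -/
def Op.map {Γ N N' : Type} (φ : N → N') : Op Γ N → Op Γ N'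
  | .push k a s => .push k a (φ s)
  | .pop k f => .pop k fun o => φ (f o)
  | .peek k f => .peek k fun o => φ (f o)
  | .jump s => .jump (φ s)

/-- Renaming of the stacks of an operation. -/
def Op.rename {Γ N : Type} (ρ : ℕ → ℕ) : Op Γ N → Op Γ N
  | .push k a s => .push (ρ k) a s
  | .pop k f => .pop (ρ k) f
  | .peek k f => .peek (ρ k) f
  | .jump s => .jump s

/-- The effect of an operation. -/
def Op.exec {Γ N : Type} : Op Γ N → (ℕ → List Γ) → N × (ℕ → List Γ)
  | .push k a s, T => (s, Function.update T k (a :: T k))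
  | .pop k f, T => (f (T k).head?, Function.update T k (T k).tail)
  | .peek k f, T => (f (T k).head?, T)
  | .jump s, T => (s, T)

/-- A machine with finitely many states that acts on stacks; the state `none` is the exit. -/
structure Mach (Γ : Type) where
  S : Type
  fin : Fintype S
  start : Option S
  op : S → Op Γ (Option S)

namespace Mach

variable {Γ : Type}

/-- The machine reaches the second configuration from the first one in the given time. -/
inductive Reach (M : Mach Γ) :
    Option M.S → (ℕ → List Γ) → Option M.S → (ℕ → List Γ) → ℕ → Prop
  | refl (s T) : Reach M s T s T 0
  | step (s T s' T' t) (h : Reach M ((M.op s).exec T).1 ((M.op s).exec T).2 s' T' t) :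
      Reach M (some s) T s' T' (t + 1)

theorem Reach.trans {M : Mach Γ} {s₁ s₂ s₃ : Option M.S} {T₁ T₂ T₃ : ℕ → List Γ} {t u : ℕ}
    (h : M.Reach s₁ T₁ s₂ T₂ t) (h' : M.Reach s₂ T₂ s₃ T₃ u) :
    M.Reach s₁ T₁ s₃ T₃ (t + u) := by
  induction h with
  | refl s T => simpa using h'
  | step s T s' T' t _ ih =>
    rw [Nat.add_right_comm]
    exact .step _ _ _ _ _ (ih h')

/-- Only proper states are required to map to proper states: `φ` may send the exit to the entry of
another machine or back to the head of a loop. This is how compositions and loops inherit runs. -/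
theorem Reach.map {M M' : Mach Γ} (φ : Option M.S → Option M'.S)
    (hφ : ∀ s, ∃ s', φ (some s) = some s' ∧ M'.op s' = (M.op s).map φ)
    {s₁ s₂ : Option M.S} {T₁ T₂ : ℕ → List Γ} {t : ℕ} (h : M.Reach s₁ T₁ s₂ T₂ t) :
    M'.Reach (φ s₁) T₁ (φ s₂) T₂ t := by
  induction h with
  | refl s T => exact .refl _ _
  | step s T s' T' t _ ih =>
    obtain ⟨u, hu, hop⟩ := hφ s
    rw [hu]
    refine .step _ _ _ _ _ ?_
    rw [hop]
    cases h : M.op s <;> simpa [h, Op.map, Op.exec] using ih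

/-- An operation pushes at most one symbol. Hence a polynomial running time entails polynomial
lengths. -/
theorem Reach.length_le {M : Mach Γ} {s₁ s₂ : Option M.S} {T₁ T₂ : ℕ → List Γ} {t : ℕ}
    (h : M.Reach s₁ T₁ s₂ T₂ t) (k : ℕ) : (T₂ k).length ≤ (T₁ k).length + t := by
  induction h with
  | refl s T => simp
  | step s T s' T' t _ ih =>
    refine ih.trans ?_
    cases h : M.op s with
    | push j a s =>
      by_cases hj : k = j
      · subst hj; simp [Op.exec]; omega
      · simp [Op.exec, hj]
    | pop j f =>
      by_cases hj : k = j
      · subst hj; simp [Op.exec]; omega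
      · simp [Op.exec, hj]
    | peek j f => simp [Op.exec]
    | jump s => simp [Op.exec]

/-- Started on the first stacks, the machine exits with the second stacks within the given time. -/
def Runs (M : Mach Γ) (T T' : ℕ → List Γ) (t : ℕ) : Prop :=
  ∃ u ≤ t, M.Reach M.start T none T' u

theorem Runs.mono {M : Mach Γ} {T T' : ℕ → List Γ} {t u : ℕ} (h : M.Runs T T' t) (htu : t ≤ u) :
    M.Runs T T' u :=
  let ⟨v, hv, h⟩ := h
  ⟨v, hv.trans htu, h⟩

theorem Runs.length_le {M : Mach Γ} {T T' : ℕ → List Γ} {t : ℕ} (h : M.Runs T T' t) (k : ℕ) :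
    (T' k).length ≤ (T k).length + t :=
  let ⟨_, hv, h⟩ := h
  (h.length_le k).trans (by omega)

/-- The machine that does nothing. -/
def skip : Mach Γ := ⟨Empty, inferInstance, none, fun s => s.elim⟩

theorem runs_skip (T : ℕ → List Γ) : skip.Runs T T 0 := ⟨0, le_rfl, .refl _ _⟩

/-- The machine that pushes a symbol. -/
def push (k : ℕ) (a : Γ) : Mach Γ := ⟨Unit, inferInstance, some (), fun _ => .push k a none⟩

theorem runs_push (k : ℕ) (a : Γ) (T : ℕ → List Γ) :
    (push k a).Runs T (Function.update T k (a :: T k)) 1 :=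
  ⟨1, le_rfl, .step _ _ _ _ _ (.refl _ _)⟩

/-- Sequential composition. -/
def seq (M M' : Mach Γ) : Mach Γ where
  S := M.S ⊕ M'.S
  fin := by
    have := M.fin
    have := M'.fin
    exact inferInstance
  -- If `M` exits at once, control goes directly to the start of `M'`.
  start := (M.start.map Sum.inl).or (M'.start.map Sum.inr)
  op := Sum.elim
    (fun s => (M.op s).map fun o => (o.map Sum.inl).or (M'.start.map Sum.inr))
    (fun s => (M'.op s).map (Option.map Sum.inr))

theorem Runs.seq {M M' : Mach Γ} {T T' T'' : ℕ → List Γ} {t u : ℕ} (h : M.Runs T T' t)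
    (h' : M'.Runs T' T'' u) : (M.seq M').Runs T T'' (t + u) := by
  obtain ⟨v, hv, h⟩ := h
  obtain ⟨w, hw, h'⟩ := h'
  refine ⟨v + w, by omega, ?_⟩
  have h₁ := h.map (M' := M.seq M') (fun o => (o.map Sum.inl).or (M'.start.map Sum.inr))
    (fun s => ⟨.inl s, rfl, rfl⟩)
  have h₂ := h'.map (M' := M.seq M') (Option.map Sum.inr) (fun s => ⟨.inr s, rfl, rfl⟩)
  exact h₁.trans h₂

/-- Pop from stack `k` until it is empty, and after each step run a body that depends on the class
of the symbol. -/
def loop {C : Type} [Fintype C] (k : ℕ) (cls : Γ → C) (body : C → Mach Γ) : Mach Γ where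
  -- `none` is the head of the loop. The body may depend only on a class in the finite type `C`, so
  -- the machine stays finite even over an infinite alphabet.
  S := Option (Σ c, (body c).S)
  fin := by
    have := fun c => (body c).fin
    exact inferInstance
  start := some none
  op
    | none => .pop k fun o => o.elim none fun a =>
        some ((body (cls a)).start.map (Sigma.mk (cls a)))
    | some ⟨c, s⟩ => ((body c).op s).map fun o => some (o.map (Sigma.mk c))

theorem runs_loop_nil {C : Type} [Fintype C] {k : ℕ} {cls : Γ → C} {body : C → Mach Γ}
    {T : ℕ → List Γ} (h : T k = []) : (loop k cls body).Runs T T 1 := by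
  refine ⟨1, le_rfl, .step _ _ _ _ _ ?_⟩
  have : Function.update T k [] = T := by rw [← h, Function.update_eq_self]
  simp only [loop, Op.exec, h, List.head?_nil, List.tail_nil, Option.elim, this]
  exact .refl _ _

theorem runs_loop_cons {C : Type} [Fintype C] {k : ℕ} {cls : Γ → C} {body : C → Mach Γ}
    {T T' T'' : ℕ → List Γ} {a : Γ} {l : List Γ} {t u : ℕ} (h : T k = a :: l)
    (hb : (body (cls a)).Runs (Function.update T k l) T' t)
    (hl : (loop k cls body).Runs T' T'' u) : (loop k cls body).Runs T T'' (t + 1 + u) := by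
  obtain ⟨v, hv, hb⟩ := hb
  obtain ⟨w, hw, hl⟩ := hl
  refine ⟨v + 1 + w, by omega, ?_⟩
  have h₁ := hb.map (M' := loop k cls body) (fun o => some (o.map (Sigma.mk (cls a))))
    (fun s => ⟨some ⟨_, s⟩, rfl, rfl⟩)
  have h₂ : (loop k cls body).Reach (some none) T (some none) T' (v + 1) := by
    refine .step _ _ _ _ _ ?_
    simpa [loop, Op.exec, h] using h₁
  exact h₂.trans hl

/-- Renaming of the stacks. -/
def rename (ρ : ℕ → ℕ) (M : Mach Γ) : Mach Γ := ⟨M.S, M.fin, M.start, fun s => (M.op s).rename ρ⟩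

/-- Injectivity of `ρ` keeps the images of distinct stacks apart, and stacks outside its range stay
untouched. So a machine can run beside data that it does not know. -/
theorem Reach.rename {M : Mach Γ} {ρ : ℕ → ℕ} (hρ : ρ.Injective) {s₁ s₂ : Option M.S}
    {T₁ T₂ : ℕ → List Γ} {t : ℕ} (h : M.Reach s₁ T₁ s₂ T₂ t) (T : ℕ → List Γ)
    (hT : ∀ j, T (ρ j) = T₁ j) :
    ∃ T', (∀ j, T' (ρ j) = T₂ j) ∧ (∀ j, j ∉ Set.range ρ → T' j = T j) ∧
      (M.rename ρ).Reach s₁ T s₂ T' t := by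
  induction h generalizing T with
  | refl s T₀ => exact ⟨T, hT, fun _ _ => rfl, .refl _ _⟩
  | step s T₀ s' T' t _ ih =>
    have key : ∃ T₃, ((M.op s).rename ρ).exec T = (((M.op s).exec T₀).1, T₃) ∧
        (∀ j, T₃ (ρ j) = ((M.op s).exec T₀).2 j) ∧ ∀ j, j ∉ Set.range ρ → T₃ j = T j := by
      have off : ∀ (k : ℕ) (u : List Γ) (j : ℕ), j ∉ Set.range ρ →
          Function.update T (ρ k) u j = T j := fun k u j hj =>
        Function.update_of_ne (fun h => hj ⟨k, h.symm⟩) _ _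
      have on : ∀ (k : ℕ) (u : List Γ) (j : ℕ),
          Function.update T (ρ k) u (ρ j) = Function.update T₀ k u j := fun k u j => by
        by_cases h : j = k
        · subst h; simp
        · rw [Function.update_of_ne (fun e => h (hρ e)), Function.update_of_ne h, hT]
      cases M.op s with
      | push k a u => exact ⟨_, rfl, by simpa [Op.exec, hT] using on k _, off k _⟩
      | pop k f =>
        exact ⟨_, by simp only [Op.rename, Op.exec, hT]; rfl, by simpa [Op.exec] using on k _,
          off k _⟩
      | peek k f => exact ⟨T, by simp only [Op.rename, Op.exec, hT], hT, fun _ _ => rfl⟩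
      | jump u => exact ⟨T, rfl, hT, fun _ _ => rfl⟩
    obtain ⟨T₃, he, h₁, h₂⟩ := key
    obtain ⟨T₄, h₃, h₄, h₅⟩ := ih T₃ h₁
    refine ⟨T₄, h₃, fun j hj => (h₄ j hj).trans (h₂ j hj), .step _ _ _ _ _ ?_⟩
    have : ((M.rename ρ).op s).exec T = (((M.op s).exec T₀).1, T₃) := he
    rw [this]
    exact h₅

theorem Runs.rename {M : Mach Γ} {ρ : ℕ → ℕ} (hρ : ρ.Injective) {T₁ T₂ T T' : ℕ → List Γ} {t : ℕ}
    (h : M.Runs T₁ T₂ t) (hT : ∀ j, T (ρ j) = T₁ j) (hT' : ∀ j, T' (ρ j) = T₂ j)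
    (hoff : ∀ j, j ∉ Set.range ρ → T' j = T j) : (M.rename ρ).Runs T T' t := by
  obtain ⟨u, hu, h⟩ := h
  obtain ⟨T'', h₁, h₂, h₃⟩ := h.rename hρ T hT
  have : T'' = T' := by
    funext j
    by_cases hj : j ∈ Set.range ρ
    · obtain ⟨i, rfl⟩ := hj
      rw [h₁, hT']
    · rw [h₂ j hj, hoff j hj]
  exact ⟨u, hu, this ▸ h₃⟩

end Mach

/-! ## Polynomial bounds -/

/-- `t` is bounded by a polynomial in `sz`. -/
def PB {α : Type} (sz t : α → ℕ) : Prop := ∃ P : Polynomial ℕ, ∀ a, t a ≤ P.eval (sz a)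

theorem eval_mono (P : Polynomial ℕ) {x y : ℕ} (h : x ≤ y) : P.eval x ≤ P.eval y := by
  induction P using Polynomial.induction_on' with
  | add p q hp hq => simpa using Nat.add_le_add hp hq
  | monomial n c => simpa using Nat.mul_le_mul_left c (Nat.pow_le_pow_left h n)

namespace PB

variable {α : Type} {sz t u : α → ℕ}

theorem const (c : ℕ) : PB sz fun _ => c := ⟨.C c, fun _ => by simp⟩

theorem self : PB sz sz := ⟨.X, fun _ => by simp⟩

theorem mono (h : PB sz u) (htu : ∀ a, t a ≤ u a) : PB sz t :=
  let ⟨P, hP⟩ := h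
  ⟨P, fun a => (htu a).trans (hP a)⟩

theorem add (h : PB sz t) (h' : PB sz u) : PB sz fun a => t a + u a :=
  let ⟨P, hP⟩ := h
  let ⟨Q, hQ⟩ := h'
  ⟨P + Q, fun a => by simpa using Nat.add_le_add (hP a) (hQ a)⟩

theorem mul (h : PB sz t) (h' : PB sz u) : PB sz fun a => t a * u a :=
  let ⟨P, hP⟩ := h
  let ⟨Q, hQ⟩ := h'
  ⟨P * Q, fun a => by simpa using Nat.mul_le_mul (hP a) (hQ a)⟩

theorem eval (h : PB sz t) (Q : Polynomial ℕ) : PB sz fun a => Q.eval (t a) :=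
  let ⟨P, hP⟩ := h
  ⟨Q.comp P, fun a => by simpa using eval_mono Q (hP a)⟩

theorem trans {v : α → ℕ} (h : PB t u) (h' : PB sz t) (hv : ∀ a, v a ≤ u a) : PB sz v :=
  let ⟨P, hP⟩ := h
  (h'.eval P).mono fun a => (hv a).trans (hP a)

end PB

/-! ## Functions computed in polynomial time -/

instance : Fintype Sym :=
  ⟨{.tick, .sep, .fin, .inp, .out, .work, .ask, .ans, .x, .h, .t, .tdg, .cx, .ccx, .query},
    fun s => by cases s <;> decide⟩

/-- An assignment of finitely many strings to the elements of `α`. -/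
structure Env (α : Type) where
  m : ℕ
  val : α → ℕ → List Sym
  fresh : ∀ a j, m ≤ j → val a j = []

/-- The total length of the strings. -/
def Env.size {α : Type} (E : Env α) (a : α) : ℕ := ∑ j ∈ Finset.range E.m, (E.val a j).length

/-- Extension by one more string. -/
def Env.snoc {α : Type} (E : Env α) (f : α → List Sym) : Env α where
  m := E.m + 1
  val a := Function.update (E.val a) E.m (f a)
  fresh a j hj := by
    rw [Function.update_of_ne (by omega), E.fresh _ _ (by omega)]

/-- Precomposition. -/
def Env.comap {α β : Type} (E : Env α) (φ : β → α) : Env β :=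
  ⟨E.m, fun b => E.val (φ b), fun b => E.fresh (φ b)⟩

theorem Env.size_snoc {α : Type} (E : Env α) (f : α → List Sym) (a : α) :
    (E.snoc f).size a = E.size a + (f a).length := by
  unfold Env.size
  rw [show (E.snoc f).m = E.m + 1 from rfl, Finset.sum_range_succ]
  congr 1
  · refine Finset.sum_congr rfl fun j hj => ?_
    simp only [Env.snoc]
    rw [Function.update_of_ne (by have := Finset.mem_range.1 hj; omega)]
  · simp [Env.snoc]

variable {X : Type}

/-- Strings as stack contents. -/
def st (v : ℕ → List Sym) : ℕ → List (Sym ⊕ X) := fun j => (v j).map Sum.inl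

/-- The machine turns strings into strings within the given time. -/
def Mach.RunsS (M : Mach (Sym ⊕ X)) (v w : ℕ → List Sym) (t : ℕ) : Prop := M.Runs (st v) (st w) t

theorem update_st (v : ℕ → List Sym) (k : ℕ) (l : List Sym) :
    Function.update (st v : ℕ → List (Sym ⊕ X)) k (l.map Sum.inl) = st (Function.update v k l) := by
  funext j
  by_cases h : j = k
  · subst h; simp [st]
  · simp [st, h]

namespace Mach

theorem RunsS.cast {M : Mach (Sym ⊕ X)} {v w w' : ℕ → List Sym} {t u : ℕ} (h : M.RunsS v w t)
    (hw : w = w') (htu : t ≤ u) : M.RunsS v w' u := hw ▸ Runs.mono h htu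

theorem RunsS.seq {M M' : Mach (Sym ⊕ X)} {v w z : ℕ → List Sym} {t u : ℕ} (h : M.RunsS v w t)
    (h' : M'.RunsS w z u) : (M.seq M').RunsS v z (t + u) := Runs.seq h h'

theorem runsS_push (k : ℕ) (a : Sym) (v : ℕ → List Sym) :
    (push k (.inl a) : Mach (Sym ⊕ X)).RunsS v (Function.update v k (a :: v k)) 1 := by
  unfold RunsS
  rw [← update_st]
  exact runs_push k (.inl a) (st v)

/-- A loop whose body depends on the popped symbol. -/
def symLoop (k : ℕ) (body : Sym → Mach (Sym ⊕ X)) : Mach (Sym ⊕ X) :=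
  loop k (Sum.elim id fun _ => Sym.tick) body

theorem runsS_symLoop_nil {k : ℕ} {body : Sym → Mach (Sym ⊕ X)} {v : ℕ → List Sym}
    (h : v k = []) : (symLoop k body).RunsS v v 1 :=
  runs_loop_nil (by simp [st, h])

theorem runsS_symLoop_cons {k : ℕ} {body : Sym → Mach (Sym ⊕ X)} {v w z : ℕ → List Sym} {a : Sym}
    {l : List Sym} {t u : ℕ} (h : v k = a :: l) (hb : (body a).RunsS (Function.update v k l) w t)
    (hl : (symLoop k body).RunsS w z u) : (symLoop k body).RunsS v z (t + 1 + u) := by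
  refine runs_loop_cons (a := .inl a) (l := l.map .inl) (by simp [st, h]) ?_ hl
  rw [update_st]
  exact hb

/-- Empty a stack. -/
def clear (k : ℕ) : Mach (Sym ⊕ X) := symLoop k fun _ => skip

theorem runsS_clear (k : ℕ) (l : List Sym) (v : ℕ → List Sym) (h : v k = l) :
    (clear k : Mach (Sym ⊕ X)).RunsS v (Function.update v k []) (l.length + 1) := by
  induction l generalizing v with
  | nil => exact (runsS_symLoop_nil h).cast (by rw [← h, Function.update_eq_self]) (by simp)
  | cons a l ih =>
    have h₀ : (skip : Mach (Sym ⊕ X)).RunsS (Function.update v k l) (Function.update v k l) 0 :=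
      runs_skip _
    exact (runsS_symLoop_cons h h₀ (ih _ (by simp))).cast (by simp) (by simp; omega)

/-- Pour stack `k` onto stack `j`. -/
def pour (k j : ℕ) : Mach (Sym ⊕ X) := symLoop k fun a => push j (.inl a)

theorem runsS_pour {k j : ℕ} (hkj : k ≠ j) (l : List Sym) (v : ℕ → List Sym) (h : v k = l) :
    (pour k j : Mach (Sym ⊕ X)).RunsS v
      (Function.update (Function.update v k []) j (l.reverse ++ v j)) (2 * l.length + 1) := by
  induction l generalizing v with
  | nil =>
    refine (runsS_symLoop_nil h).cast ?_ (by simp)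
    rw [← h, Function.update_eq_self, h]
    simp
  | cons a l ih =>
    have h₁ := runsS_push (X := X) j a (Function.update v k l)
    have h₂ := ih _ (show (Function.update (Function.update v k l) j
      (a :: Function.update v k l j)) k = l by simp [hkj])
    refine (runsS_symLoop_cons h h₁ h₂).cast ?_ (by simp; omega)
    rw [Function.update_comm hkj.symm, Function.update_idem, Function.update_idem]
    simp [hkj.symm]

end Mach

/-! ### Closure properties of polynomial time string functions -/

/-- The string `f a` can be computed in polynomial time from the strings assigned to `a`. -/
def PT (X : Type) {α : Type} (E : Env α) (f : α → List Sym) : Prop :=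
  ∃ (M : Mach (Sym ⊕ X)) (t : α → ℕ), PB E.size t ∧
    ∀ a, M.RunsS (E.val a) ((E.snoc f).val a) (t a)

namespace PT

variable {α β : Type} {E : Env α}

/-- Stack `E.m` is empty before the run and holds `f a` after it, so the running time bounds the
length. -/
theorem length_bound {f : α → List Sym} (h : PT X E f) : PB E.size fun a => (f a).length := by
  obtain ⟨M, t, ht, h⟩ := h
  refine ht.mono fun a => ?_
  have := Mach.Runs.length_le (h a) E.m
  simpa [st, Env.snoc, E.fresh] using this

theorem congr {f g : α → List Sym} (h : PT X E f) (hfg : ∀ a, g a = f a) : PT X E g := by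
  rwa [funext hfg]

theorem nil : PT X E fun _ => [] := by
  refine ⟨.skip, fun _ => 0, PB.const 0, fun a => ?_⟩
  have : (E.snoc fun _ => []).val a = E.val a := by
    simp only [Env.snoc, Function.update_eq_self_iff]
    exact (E.fresh a E.m le_rfl).symm
  rw [this]
  exact Mach.runs_skip _

theorem cons {f : α → List Sym} (s : Sym) (h : PT X E f) : PT X E fun a => s :: f a := by
  obtain ⟨M, t, ht, h⟩ := h
  refine ⟨M.seq (.push E.m (.inl s)), _, ht.add (PB.const 1), fun a => (h a).seq ?_⟩
  have := Mach.runsS_push (X := X) E.m s ((E.snoc f).val a)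
  simpa [Env.snoc] using this

theorem const (l : List Sym) : PT X E fun _ => l := by
  induction l with
  | nil => exact nil
  | cons s l ih => exact ih.cons s

/-- By `length_bound` the intermediate value has polynomial length, so time polynomial in the size
of the extended environment is polynomial in the original size. -/
theorem let_ {f g : α → List Sym} (hf : PT X E f) (hg : PT X (E.snoc f) g) : PT X E g := by
  have hfl := hf.length_bound
  have hs : PB E.size (E.snoc f).size := (PB.self.add hfl).mono fun a => (E.size_snoc f a).le
  have hgl : PB E.size fun a => (g a).length := hg.length_bound.trans hs fun _ => le_rfl
  obtain ⟨M, t, ht, hM⟩ := hf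
  obtain ⟨M', t', ht', hM'⟩ := hg
  -- The value of `f` on stack `E.m` is erased and that of `g` is moved down from `E.m + 1`. Pouring
  -- reverses, hence the detour through `E.m + 2`.
  refine ⟨M.seq (M'.seq ((Mach.clear E.m).seq ((Mach.pour (E.m + 1) (E.m + 2)).seq
    (Mach.pour (E.m + 2) E.m)))), _, ht.add ((ht'.trans hs fun _ => le_rfl).add
    ((hfl.add (PB.const 1)).add ((((PB.const 2).mul hgl).add (PB.const 1)).add
      (((PB.const 2).mul hgl).add (PB.const 1))))), fun a => ?_⟩
  have h₁ := Mach.runsS_clear (X := X) E.m (f a) (((E.snoc f).snoc g).val a) (by simp [Env.snoc])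
  have h₂ := Mach.runsS_pour (X := X) (k := E.m + 1) (j := E.m + 2) (by omega) (g a)
    (Function.update (((E.snoc f).snoc g).val a) E.m []) (by simp [Env.snoc])
  have h₃ := Mach.runsS_pour (X := X) (k := E.m + 2) (j := E.m) (by omega) (g a).reverse
  refine (hM a).seq ((hM' a).seq (h₁.seq (h₂.seq
    ((h₃ _ (by simp [Env.snoc, E.fresh])).cast ?_ (by simp)))))
  funext j
  have := E.fresh a
  simp only [Env.snoc, Function.update_apply]
  split_ifs <;> first | omega | simp_all
  
theorem weaken {E' : Env β} {f : α → List Sym} (φ : β → α) (hm : E.m ≤ E'.m)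
    (hE : ∀ b, ∀ j < E.m, E'.val b j = E.val (φ b) j) (h : PT X E f) :
    PT X E' fun b => f (φ b) := by
  obtain ⟨M, t, ⟨P, hP⟩, h⟩ := h
  have hsz : ∀ b, E.size (φ b) ≤ E'.size b := fun b => by
    unfold Env.size
    rw [Finset.sum_congr rfl fun j hj => by rw [← hE b j (Finset.mem_range.1 hj)]]
    exact Finset.sum_le_sum_of_subset (Finset.range_mono hm)
  -- The stacks of the parameters stay in place. The output stack and the working stacks move past
  -- the additional strings of `E'`, and the output lands on `E'.m`.
  let ρ : ℕ → ℕ := fun j => if j < E.m then j else j + (E'.m - E.m)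
  have hρ : ρ.Injective := fun i j hij => by
    simp only [ρ] at hij; split_ifs at hij <;> omega
  have hv : ∀ b j, E'.val b (ρ j) = E.val (φ b) j := fun b j => by
    by_cases hj : j < E.m
    · simp only [ρ, hj, if_true, hE]
    · simp only [ρ, hj, if_false]
      rw [E.fresh _ _ (by omega), E'.fresh _ _ (by omega)]
  have hρm : ρ E.m = E'.m := by simp [ρ]; omega
  refine ⟨M.rename ρ, fun b => t (φ b), ⟨P, fun b => (hP _).trans (eval_mono P (hsz b))⟩,
    fun b => Mach.Runs.rename hρ (h (φ b)) (fun j => ?_) (fun j => ?_) (fun j hj => ?_)⟩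
  · simp only [st, hv]
  · simp only [st, Env.snoc]
    congr 1
    by_cases hj : j = E.m
    · subst hj; rw [hρm]; simp
    · rw [Function.update_of_ne hj, Function.update_of_ne (fun e => hj (hρ (e.trans hρm.symm))), hv]
  · simp only [st, Env.snoc]
    rw [Function.update_of_ne]
    rintro rfl
    exact hj ⟨E.m, hρm⟩

theorem snoc {f g : α → List Sym} (h : PT X E f) : PT X (E.snoc g) f :=
  h.weaken id (Nat.le_succ _) fun b j hj => by simp [Env.snoc, hj.ne]

/-- Reading a stack destroys it. The string is therefore poured onto an auxiliary stack, and from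
there onto its old place and the output stack simultaneously. -/
theorem var (i : ℕ) (hi : i < E.m) : PT X E fun a => E.val a i := by
  have hl : PB E.size fun a => (E.val a i).length := PB.self.mono fun a =>
    Finset.single_le_sum (f := fun j => (E.val a j).length) (fun _ _ => Nat.zero_le _)
      (Finset.mem_range.2 hi)
  have key : ∀ (l : List Sym) (v : ℕ → List Sym), v (E.m + 1) = l →
      (Mach.symLoop (E.m + 1) fun a => (Mach.push i (.inl a)).seq (Mach.push E.m (.inl a)) :
        Mach (Sym ⊕ X)).RunsS v (Function.update (Function.update (Function.update v (E.m + 1) [])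
          i (l.reverse ++ v i)) E.m (l.reverse ++ v E.m)) (3 * l.length + 1) := by
    intro l
    induction l with
    | nil =>
      intro v h
      refine (Mach.runsS_symLoop_nil h).cast ?_ (by simp)
      funext j
      simp only [Function.update_apply]
      split_ifs <;> first | omega | simp_all
    | cons a l ih =>
      intro v h
      have h₁ := (Mach.runsS_push (X := X) i a (Function.update v (E.m + 1) l)).seq
        (Mach.runsS_push (X := X) E.m a _)
      have e₁ : E.m + 1 ≠ i := by omega
      refine (Mach.runsS_symLoop_cons h h₁ (ih _ (by simp [e₁]))).cast ?_ (by simp; omega)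
      have e₂ : E.m ≠ i := by omega
      funext j
      simp only [Function.update_apply]
      split_ifs <;> first | omega | simp_all
  refine ⟨(Mach.pour i (E.m + 1)).seq (Mach.symLoop (E.m + 1) fun a =>
    (Mach.push i (.inl a)).seq (Mach.push E.m (.inl a))), _,
    (((PB.const 2).mul hl).add (PB.const 1)).add (((PB.const 3).mul hl).add (PB.const 1)),
    fun a => ?_⟩
  have h₁ := Mach.runsS_pour (X := X) (k := i) (j := E.m + 1) (by omega) (E.val a i) _ rfl
  refine h₁.seq ((key (E.val a i).reverse _ (by simp [E.fresh])).cast ?_ (by simp))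
  funext j
  simp only [Function.update_apply, Env.snoc]
  split_ifs <;> first | omega | simp_all [E.fresh]

/-- The environment of the step of a recursion on strings: the parameters, the rest of the string
and the value of the function on the rest. -/
def _root_.CopyProt.Env.recEnv {α : Type} (E : Env α) : Env (α × List Sym × List Sym) :=
  ((E.comap Prod.fst).snoc fun p => p.2.1).snoc fun p => p.2.2

theorem ctx {f : α → List Sym} (h : PT X E f) : PT X E.recEnv fun p => f p.1 :=
  h.weaken Prod.fst (by simp [Env.recEnv, Env.snoc, Env.comap]; omega) fun b j hj => by
    simp only [Env.recEnv, Env.snoc, Env.comap]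
    rw [Function.update_of_ne (by omega), Function.update_of_ne (by omega)]

theorem tl : PT X E.recEnv fun p => p.2.1 :=
  (var (E := E.recEnv) E.m (by simp [Env.recEnv, Env.snoc, Env.comap])).congr fun p => by
    simp [Env.recEnv, Env.snoc, Env.comap]

theorem val : PT X E.recEnv fun p => p.2.2 :=
  (var (E := E.recEnv) (E.m + 1) (by simp [Env.recEnv, Env.snoc, Env.comap])).congr fun p => by
    simp [Env.recEnv, Env.snoc, Env.comap]

/-- The stacks during a recursion: the parameters, the rest of the string, the value of the function
on the rest, and the part of the string that is still to be processed. -/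
def _root_.CopyProt.Env.recStacks (E : Env α) (a : α) (t v l : List Sym) (j : ℕ) : List Sym :=
  if j = E.m then t else if j = E.m + 1 then v else if j = E.m + 3 then l else E.val a j

/-- One step of a recursion, where `M` computes the new value. -/
def recBody (m : ℕ) (s : Sym) (M : Mach (Sym ⊕ X)) : Mach (Sym ⊕ X) :=
  -- The new value appears on stack `m + 2`. Stack `m + 3` holds the unprocessed symbols and `m + 4`
  -- serves for pouring, so the working stacks of `M` skip both.
  (M.rename fun j => if j < m + 3 then j else j + 2).seq ((Mach.clear (m + 1)).seq
    ((Mach.pour (m + 2) (m + 4)).seq ((Mach.pour (m + 4) (m + 1)).seq (Mach.push m (.inl s)))))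

theorem runsS_recBody {M : Mach (Sym ⊕ X)} {g : α × List Sym × List Sym → List Sym} {s : Sym}
    {a : α} {t v : List Sym} {τ : ℕ}
    (hM : M.RunsS (E.recEnv.val (a, t, v)) ((E.recEnv.snoc g).val (a, t, v)) τ) (l : List Sym) :
    (recBody E.m s M).RunsS (E.recStacks a t v l) (E.recStacks a (s :: t) (g (a, t, v)) l)
      (τ + ((v.length + 1) + ((2 * (g (a, t, v)).length + 1) +
        ((2 * (g (a, t, v)).length + 1) + 1)))) := by
  have hfr := E.fresh a
  have hρ : (fun j => if j < E.m + 3 then j else j + 2).Injective := fun i j hij => by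
    simp only at hij; split_ifs at hij <;> omega
  have h₁ : (M.rename fun j => if j < E.m + 3 then j else j + 2).RunsS (E.recStacks a t v l)
      (Function.update (E.recStacks a t v l) (E.m + 2) (g (a, t, v))) τ := by
    have aux : ∀ j, E.recStacks a t v l (if j < E.m + 3 then j else j + 2) =
        E.recEnv.val (a, t, v) j := fun j => by
      simp only [Env.recEnv, Env.snoc, Env.comap, Env.recStacks, Function.update_apply]
      by_cases hj : j < E.m + 3
      · simp only [hj, if_true]
        split_ifs <;> first | omega | rfl
      · simp only [hj, if_false]
        rw [hfr j (by omega), hfr (j + 2) (by omega)]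
        split_ifs <;> first | omega | rfl
    refine Mach.Runs.rename hρ hM (fun j => ?_) (fun j => ?_) fun j hj => ?_
    · simp only [st, aux]
    · simp only [st]
      congr 1
      by_cases hj : j = E.m + 2
      · subst hj
        simp [Env.snoc, Env.recEnv, Env.comap]
      · rw [Function.update_of_ne (by split_ifs <;> omega), aux]
        exact (Function.update_of_ne hj _ _).symm
    · simp only [st]
      rw [Function.update_of_ne]
      rintro rfl
      exact hj ⟨E.m + 2, by simp⟩
  have h₂ := Mach.runsS_clear (X := X) (E.m + 1) v
  have h₃ := Mach.runsS_pour (X := X) (k := E.m + 2) (j := E.m + 4) (by omega) (g (a, t, v))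
  have h₄ := Mach.runsS_pour (X := X) (k := E.m + 4) (j := E.m + 1) (by omega)
    (g (a, t, v)).reverse
  refine (h₁.seq ((h₂ _ ?_).seq ((h₃ _ ?_).seq ((h₄ _ ?_).seq (Mach.runsS_push E.m s _))))).cast
    ?_ (by simp)
  · simp [Env.recStacks]
  · simp
  · simp [Env.recStacks, hfr]
  · have h₂ := hfr (E.m + 2) (by omega)
    have h₄ := hfr (E.m + 4) (by omega)
    funext j
    simp only [Function.update_apply, Env.recStacks]
    by_cases e₀ : j = E.m
    · subst e₀; simp
    by_cases e₁ : j = E.m + 1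
    · subst e₁; simp
    by_cases e₂ : j = E.m + 2
    · subst e₂; simp [h₂]
    by_cases e₄ : j = E.m + 4
    · subst e₄; simp [h₄]
    simp [e₀, e₁, e₂, e₄]

/-- The recursion is evaluated from the end of the string. The stack `l` holds the unprocessed
prefix of `y` in reverse, so that its top is the symbol just in front of the suffix `t` already
treated. -/
theorem runsS_recLoop {M : Sym → Mach (Sym ⊕ X)} {g : Sym → α × List Sym × List Sym → List Sym}
    (h : α → List Sym → List Sym) {a : α} {y : List Sym} {u w : ℕ}
    (h_cons : ∀ s t, h a (s :: t) = g s (a, t, h a t))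
    (h_le : ∀ t, t <:+ y → (h a t).length ≤ u)
    (hM : ∀ s t, (s :: t) <:+ y → (M s).RunsS (E.recEnv.val (a, t, h a t))
      ((E.recEnv.snoc (g s)).val (a, t, h a t)) w) (l t : List Sym) (ht : y = l.reverse ++ t) :
    (Mach.symLoop (E.m + 3) fun s => recBody E.m s (M s)).RunsS (E.recStacks a t (h a t) l)
      (E.recStacks a y (h a y) []) (l.length * (w + 5 * u + 5) + 1) := by
  induction l generalizing t with
  | nil =>
    obtain rfl : y = t := ht
    exact (Mach.runsS_symLoop_nil (by simp [Env.recStacks])).cast rfl (by simp)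
  | cons s l ih =>
    have ht' : y = l.reverse ++ (s :: t) := by rw [ht]; simp
    have hs : (s :: t) <:+ y := ⟨l.reverse, ht'.symm⟩
    -- Besides the time `w` of `M`, one clearing costs at most `u + 1`, two pourings at most `2 * u
    -- + 1` each, and a push costs `1`. The loop adds one pop.
    have hb := (runsS_recBody (s := s) (hM s t hs) l).cast (u := w + 5 * u + 4)
      (by rw [← h_cons]) (by
        have := h_le t ((List.suffix_cons s t).trans hs)
        have := h_le _ hs
        rw [← h_cons]
        omega)
    refine (Mach.runsS_symLoop_cons (a := s) (l := l) (by simp [Env.recStacks]) ?_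
      (ih _ ht')).cast rfl (t := w + 5 * u + 4 + 1 + (l.length * (w + 5 * u + 5) + 1))
      (by simp only [List.length_cons]; nlinarith)
    have : Function.update (E.recStacks a t (h a t) (s :: l)) (E.m + 3) l =
        E.recStacks a t (h a t) l := by
      funext j
      simp only [Function.update_apply, Env.recStacks]
      split_ifs <;> first | omega | rfl
    rw [this]
    exact hb

/-- Bounded recursion on strings. -/
theorem recOn {y base : α → List Sym} {g : Sym → α × List Sym × List Sym → List Sym} {u : α → ℕ}
    (h : α → List Sym → List Sym) (hy : PT X E y) (hb : PT X E base)
    (hg : ∀ s, PT X E.recEnv (g s)) (h_nil : ∀ a, h a [] = base a)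
    (h_cons : ∀ a s t, h a (s :: t) = g s (a, t, h a t)) (hu : PB E.size u)
    (h_le : ∀ a t, t <:+ y a → (h a t).length ≤ u a) : PT X E fun a => h a (y a) := by
  have hyl := hy.length_bound
  refine let_ hy ?_
  obtain ⟨Mb, tb, htb, hMb⟩ := hb.snoc (g := y)
  choose M tm htm hM using hg
  choose P hP using htm
  -- One bound for the time of all steps: the sum over the symbols, at a size that dominates every
  -- environment met, since suffixes are no longer than `y a` and values no longer than `u a`.
  let w : α → ℕ := fun a => ∑ s, (P s).eval (E.size a + (y a).length + u a)
  have hw : PB E.size w := by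
    obtain ⟨Q, hQ⟩ := (PB.self.add hyl).add hu
    exact ⟨(∑ s, P s).comp Q, fun a => by
      simp only [Polynomial.eval_comp, Polynomial.eval_finsetSum, w]
      exact Finset.sum_le_sum fun s _ => eval_mono _ (hQ a)⟩
  have htw : ∀ s a t, (s :: t) <:+ y a → tm s (a, t, h a t) ≤ w a := fun s a t hs => by
    have ht := (List.suffix_cons s t).trans hs
    refine (hP s _).trans ((eval_mono _ ?_).trans (Finset.single_le_sum
      (f := fun s => (P s).eval (E.size a + (y a).length + u a)) (fun _ _ => Nat.zero_le _)
      (Finset.mem_univ s)))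
    have : E.recEnv.size (a, t, h a t) = E.size a + t.length + (h a t).length := by
      rw [Env.recEnv, Env.size_snoc, Env.size_snoc]; rfl
    have := h_le a t ht
    have := ht.length_le
    omega
  have lift : ∀ {f : α → ℕ}, PB E.size f → PB (E.snoc y).size f := fun ⟨Q, hQ⟩ =>
    ⟨Q, fun a => (hQ a).trans (eval_mono Q (by rw [E.size_snoc]; omega))⟩
  refine ⟨Mb.seq ((Mach.pour E.m (E.m + 3)).seq (Mach.symLoop (E.m + 3)
    fun s => recBody E.m s (M s))), _, htb.add (lift ((((PB.const 2).mul hyl).add (.const 1)).add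
      ((hyl.mul ((hw.add ((PB.const 5).mul hu)).add (.const 5))).add (.const 1)))),
    fun a => (hMb a).seq ?_⟩
  have hfr := E.fresh a
  have h₁ := Mach.runsS_pour (X := X) (k := E.m) (j := E.m + 3) (by omega) (y a)
    (((E.snoc y).snoc base).val a) (by simp [Env.snoc])
  refine (h₁.cast (w' := E.recStacks a [] (h a []) (y a).reverse) ?_ le_rfl).seq
    ((runsS_recLoop h (h_cons a) (h_le a) (fun s t hs => (hM s _).cast rfl (htw s a t hs))
      (y a).reverse [] (by simp)).cast ?_ (by simp))
  · funext j
    simp only [Function.update_apply, Env.recStacks, Env.snoc, h_nil]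
    split_ifs <;> first | omega | simp [hfr]
  · funext j
    simp only [Function.update_apply, Env.recStacks, Env.snoc]
    split_ifs with e₁ e₂ e₃ <;> first | omega | rfl | (rw [hfr _ (by omega)])

end PT

/-! ### Scans of strings and arithmetic in unary -/

/-- The concatenation of strings that depend on the symbols and the suffixes of a string. -/
def scan (g : Sym → List Sym → List Sym) : List Sym → List Sym
  | [] => []
  | s :: t => g s t ++ scan g t

/-- The string of `n` ticks. -/
def tk (n : ℕ) : List Sym := List.replicate n .tick

@[simp] theorem length_tk (n : ℕ) : (tk n).length = n := List.length_replicate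

theorem tk_add (m n : ℕ) : tk (m + n) = tk m ++ tk n := List.replicate_add _ _ _

theorem scan_tk (g : Sym → List Sym → List Sym) (n : ℕ) :
    scan g (tk (n + 1)) = g .tick (tk n) ++ scan g (tk n) := rfl

namespace PT
variable {α : Type} {E : Env α}

theorem append {f g : α → List Sym} (hf : PT X E f) (hg : PT X E g) :
    PT X E fun a => f a ++ g a :=
  recOn (fun a t => t ++ g a) hf hg (g := fun s p => s :: p.2.2) (fun s => val.cons s)
    (fun _ => rfl) (fun _ _ _ => rfl) (hf.length_bound.add hg.length_bound) fun a t ht => by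
      have := ht.length_le
      simp
      omega

/-- The pieces do not depend on the values computed before, so the length grows additively: at most
`(y a).length` pieces, each of polynomial length. This supplies the a priori bound that `recOn`
needs. -/
theorem scan {y : α → List Sym} {g : Sym → α → List Sym → List Sym} (hy : PT X E y)
    (hg : ∀ s, PT X E.recEnv fun p => g s p.1 p.2.1) :
    PT X E fun a => CopyProt.scan (fun s t => g s a t) (y a) := by
  have hgl := fun s => (hg s).length_bound
  choose P hP using hgl
  have hyl := hy.length_bound
  have hsz : ∀ a t v, E.recEnv.size (a, t, v) = E.size a + t.length + v.length := fun a t v => by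
    rw [Env.recEnv, Env.size_snoc, Env.size_snoc]; rfl
  let w : α → ℕ := fun a => ∑ s, (P s).eval (E.size a + (y a).length)
  have hw : PB E.size w := by
    obtain ⟨Q, hQ⟩ := PB.self.add hyl
    exact ⟨(∑ s, P s).comp Q, fun a => by
      simp only [Polynomial.eval_comp, Polynomial.eval_finsetSum, w]
      exact Finset.sum_le_sum fun s _ => eval_mono _ (hQ a)⟩
  have key : ∀ a t, t <:+ y a → (CopyProt.scan (fun s t => g s a t) t).length ≤ t.length * w a := by
    intro a t
    induction t with
    | nil => intro _; simp [CopyProt.scan]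
    | cons s t ih =>
      intro ht
      have ht' := (List.suffix_cons s t).trans ht
      have h₁ := ih ht'
      have h₂ : (g s a t).length ≤ w a := by
        refine (hP s (a, t, [])).trans ((eval_mono _ ?_).trans (Finset.single_le_sum
          (f := fun s => (P s).eval (E.size a + (y a).length)) (fun _ _ => Nat.zero_le _)
          (Finset.mem_univ s)))
        have := ht'.length_le
        rw [hsz]
        simp
        omega
      simp only [CopyProt.scan, List.length_append, List.length_cons]
      nlinarith
  exact recOn (fun a t => CopyProt.scan (fun s t => g s a t) t) hy nil
    (g := fun s p => g s p.1 p.2.1 ++ p.2.2) (fun s => (hg s).append val) (fun _ => rfl)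
    (fun _ _ _ => rfl) (hyl.mul hw) fun a t ht =>
      (key a t ht).trans (Nat.mul_le_mul_right _ ht.length_le)

/-- The length of a string, in unary. -/
theorem len {f : α → List Sym} (hf : PT X E f) : PT X E fun a => tk (f a).length :=
  (hf.scan (g := fun _ _ _ => [.tick]) fun _ => const _).congr fun a => by
    induction f a with
    | nil => rfl
    | cons s t ih =>
      rw [List.length_cons, tk, List.replicate_succ, CopyProt.scan, ← ih]
      rfl

theorem add {f g : α → ℕ} (hf : PT X E fun a => tk (f a)) (hg : PT X E fun a => tk (g a)) :
    PT X E fun a => tk (f a + g a) :=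
  (hf.append hg).congr fun _ => tk_add _ _

theorem mul {f g : α → ℕ} (hf : PT X E fun a => tk (f a)) (hg : PT X E fun a => tk (g a)) :
    PT X E fun a => tk (f a * g a) :=
  (hf.scan (g := fun _ a _ => tk (g a)) fun _ => hg.ctx).congr fun a => by
    generalize f a = n
    induction n with
    | zero => simp [tk, CopyProt.scan]
    | succ n ih => rw [scan_tk, ← ih, add_comm n, Nat.add_mul, one_mul, tk_add]

theorem eval (P : Polynomial ℕ) {f : α → ℕ} (hf : PT X E fun a => tk (f a)) :
    PT X E fun a => tk (P.eval (f a)) := by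
  induction P using Polynomial.induction_on with
  | C c => exact (const (tk c)).congr fun a => by simp
  | add p q hp hq => exact (hp.add hq).congr fun a => by simp
  | monomial n c h => exact (h.mul hf).congr fun a => by simp [pow_succ, mul_assoc]

/-- Truncated subtraction, in unary. -/
theorem sub {f g : α → ℕ} (hf : PT X E fun a => tk (f a)) (hg : PT X E fun a => tk (g a)) :
    PT X E fun a => tk (f a - g a) := by
  have htail : ∀ {β : Type} {F : Env β} {y : β → List Sym}, PT X F y →
      PT X F fun b => (y b).tail := fun hy =>
    recOn (fun _ t => t.tail) hy nil (g := fun _ p => p.2.1) (fun _ => tl) (fun _ => rfl)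
      (fun _ _ _ => rfl) hy.length_bound fun a t ht => by
        have := ht.length_le
        simp
        omega
  have h₁ : ∀ n (t : List Sym), tk (n - (t.length + 1)) = (tk (n - t.length)).tail := by
    intro n t
    rw [← Nat.sub_sub]
    simp [tk]
  -- Each symbol of the subtrahend removes one tick; the tail of the empty string is empty, which
  -- gives truncation.
  exact (recOn (fun a t => tk (f a - t.length)) hg hf (g := fun _ p => p.2.2.tail)
    (fun _ => htail val) (fun _ => rfl) (fun a s t => h₁ _ _) hf.length_bound
      fun a t _ => by simp).congr fun a => by simp

/-- Selection by the emptiness of a string. -/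
theorem ite_nil {y f g : α → List Sym} (hy : PT X E y) (hf : PT X E f) (hg : PT X E g) :
    PT X E fun a => if y a = [] then f a else g a :=
  recOn (fun a t => if t = [] then f a else g a) hy hf (g := fun _ p => g p.1) (fun _ => hg.ctx)
    (fun _ => rfl) (fun _ _ _ => rfl) (hf.length_bound.add hg.length_bound) fun a t _ => by
      split_ifs <;> omega

/-- The longest prefix whose symbols satisfy `q`. -/
theorem takeWhile {y : α → List Sym} (q : Sym → Bool) (hy : PT X E y) :
    PT X E fun a => (y a).takeWhile q :=
  recOn (fun _ t => t.takeWhile q) hy nil (g := fun s p => if q s then s :: p.2.2 else [])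
    (fun s => by
      by_cases h : q s
      · simpa [h] using val.cons s
      · simpa [h] using nil)
    (fun _ => rfl) (fun _ s t => by by_cases h : q s <;> simp [h])
    hy.length_bound fun a t ht => ((List.takeWhile_prefix q).length_le).trans ht.length_le

/-- The rest of the string after the first `fin`. -/
def _root_.CopyProt.afterFin : List Sym → List Sym
  | [] => []
  | .fin :: t => t
  | _ :: t => afterFin t

theorem afterFin {y : α → List Sym} (hy : PT X E y) : PT X E fun a => afterFin (y a) := by
  have hs : ∀ t, (CopyProt.afterFin t).length ≤ t.length := fun t => by
    induction t with
    | nil => simp [CopyProt.afterFin]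
    | cons s t ih =>
      cases s <;> simp only [CopyProt.afterFin, List.length_cons] <;> omega
  exact recOn (fun _ t => CopyProt.afterFin t) hy nil
    (g := fun s p => if s = .fin then p.2.1 else p.2.2)
    (fun s => by
      by_cases h : s = .fin
      · simpa [h] using tl
      · simpa [h] using val)
    (fun _ => rfl) (fun _ s t => by cases s <;> rfl) hy.length_bound
    fun a t ht => (hs t).trans ht.length_le

end PT

/-! ### From Turing machines to stack machines with elementary steps -/

section Flatten

open Turing

variable {K : Type} {Γ : K → Type} {Λ σ : Type} [Fintype Λ] [Fintype σ]

/-- The symbol of stack `k` that is represented by a symbol of the common alphabet. -/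
def decSym (ι : (Σ k, Γ k) ↪ X) (k : K) : Option (Sym ⊕ X) → Option (Γ k)
  | some (.inr x) => open Classical in
    if h : ∃ a, ι ⟨k, a⟩ = x then some h.choose else none
  | _ => none

theorem decSym_map (ι : (Σ k, Γ k) ↪ X) (k : K) (o : Option (Γ k)) :
    decSym ι k (o.map fun a => .inr (ι ⟨k, a⟩)) = o := by
  cases o with
  | none => rfl
  | some a =>
    have h : ∃ b, ι ⟨k, b⟩ = ι ⟨k, a⟩ := ⟨a, rfl⟩
    simp [decSym]

variable [Fintype K]

/-- The contents of the stacks of a Turing machine, on numbered stacks with a common alphabet. -/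
def encStk (ι : (Σ k, Γ k) ↪ X) (S : ∀ k, List (Γ k)) (j : ℕ) : List (Sym ⊕ X) :=
  if h : j < Fintype.card K then
    (S ((Fintype.equivFin K).symm ⟨j, h⟩)).map fun a => .inr (ι ⟨_, a⟩)
  else []

/-- The number of a stack. -/
def stkNo (k : K) : ℕ := Fintype.equivFin K k

theorem encStk_stkNo (ι : (Σ k, Γ k) ↪ X) (S : ∀ k, List (Γ k)) (k : K) :
    encStk ι S (stkNo k) = (S k).map fun a => .inr (ι ⟨k, a⟩) := by
  have h : (Fintype.equivFin K).symm ⟨stkNo k, (Fintype.equivFin K k).2⟩ = k := by simp [stkNo]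
  unfold encStk
  rw [dif_pos (show stkNo k < Fintype.card K from (Fintype.equivFin K k).2), h]

variable [DecidableEq K]

theorem encStk_update (ι : (Σ k, Γ k) ↪ X) (S : ∀ k, List (Γ k)) (k : K) (l : List (Γ k)) :
    encStk ι (Function.update S k l) =
      Function.update (encStk ι S) (stkNo k) (l.map fun a => .inr (ι ⟨k, a⟩)) := by
  funext j
  by_cases h : j < Fintype.card K
  · obtain ⟨k', rfl⟩ : ∃ k' : K, stkNo k' = j :=
      ⟨(Fintype.equivFin K).symm ⟨j, h⟩, by simp [stkNo]⟩
    rw [encStk_stkNo]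
    by_cases hk : k' = k
    · subst hk; simp
    · rw [Function.update_of_ne hk, Function.update_of_ne, encStk_stkNo]
      exact fun e => hk ((Fintype.equivFin K).injective (Fin.ext e))
  · rw [Function.update_of_ne]
    · simp [encStk, h]
    · rintro rfl
      exact h (Fintype.equivFin K k).2

variable (m : Λ → TM2.Stmt Γ Λ σ)

/-- All statements of a Turing machine. -/
def allStmts : Finset (TM2.Stmt Γ Λ σ) := open Classical in
  Finset.univ.biUnion fun l => TM2.stmts₁ (m l)

/-- The state in which a statement is to be executed. -/
def atStmt (q : TM2.Stmt Γ Λ σ) (v : σ) : Option ({q // q ∈ allStmts m} × σ) := open Classical in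
  if h : q ∈ allStmts m then some (⟨q, h⟩, v) else none

/-- The state that corresponds to a label. -/
def atLabel (l : Option Λ) (v : σ) : Option ({q // q ∈ allStmts m} × σ) :=
  l.elim none fun l => atStmt m (m l) v

/-- A Turing machine as a machine with one elementary operation per step. -/
def flatten (ι : (Σ k, Γ k) ↪ X) (main : Λ) (v₀ : σ) : Mach (Sym ⊕ X) where
  S := {q // q ∈ allStmts m} × σ
  fin := inferInstance
  start := atStmt m (m main) v₀
  op p := match p.1.1, p.2 with
    | .push k f q, v => .push (stkNo k) (.inr (ι ⟨k, f v⟩)) (atStmt m q v)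
    | .peek k f q, v => .peek (stkNo k) fun o => atStmt m q (f v (decSym ι k o))
    | .pop k f q, v => .pop (stkNo k) fun o => atStmt m q (f v (decSym ι k o))
    | .load f q, v => .jump (atStmt m q (f v))
    | .branch f q₁ q₂, v => .jump (bif f v then atStmt m q₁ v else atStmt m q₂ v)
    | .goto l, v => .jump (atStmt m (m (l v)) v)
    | .halt, _ => .jump none

/-- The number of elementary operations in a statement. -/
def stmtDepth : TM2.Stmt Γ Λ σ → ℕ
  | .push _ _ q | .peek _ _ q | .pop _ _ q | .load _ q => stmtDepth q + 1
  | .branch _ q₁ q₂ => stmtDepth q₁ + stmtDepth q₂ + 1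
  | .goto _ | .halt => 1

/-- One step of the Turing machine executes a whole statement, which takes at most `stmtDepth`
elementary operations. The hypothesis `hq` ensures that `atStmt` never falls back to its default
`none`, which would be an exit. -/
theorem reach_stmt (ι : (Σ k, Γ k) ↪ X) (main : Λ) (v₀ : σ) (q : TM2.Stmt Γ Λ σ)
    (hq : TM2.stmts₁ q ⊆ allStmts m) (v : σ) (S : ∀ k, List (Γ k)) :
    ∃ t ≤ stmtDepth q, (flatten m ι main v₀).Reach (atStmt m q v) (encStk ι S)
      (atLabel m (TM2.stepAux q v S).l (TM2.stepAux q v S).var)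
      (encStk ι (TM2.stepAux q v S).stk) t := by
  classical
  have hmem := hq TM2.stmts₁_self
  have hat : ∀ v, atStmt m q v = some (⟨q, hmem⟩, v) := fun v => dif_pos hmem
  rw [hat]
  induction q generalizing v S with
  | push k f q ih =>
    have hq' := (Finset.subset_insert _ _).trans hq
    obtain ⟨t, ht, h⟩ := ih hq' v (Function.update S k (f v :: S k)) (hq' TM2.stmts₁_self)
      fun v => dif_pos _
    refine ⟨t + 1, by simpa [stmtDepth] using ht, .step _ _ _ _ _ ?_⟩
    rw [encStk_update] at h
    simpa [flatten, Op.exec, encStk_stkNo, atStmt, hq' TM2.stmts₁_self] using h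
  | peek k f q ih =>
    have hq' := (Finset.subset_insert _ _).trans hq
    obtain ⟨t, ht, h⟩ := ih hq' (f v (S k).head?) S (hq' TM2.stmts₁_self) fun v => dif_pos _
    refine ⟨t + 1, by simpa [stmtDepth] using ht, .step _ _ _ _ _ ?_⟩
    simpa [flatten, Op.exec, encStk_stkNo, decSym_map, atStmt, hq' TM2.stmts₁_self] using h
  | pop k f q ih =>
    have hq' := (Finset.subset_insert _ _).trans hq
    obtain ⟨t, ht, h⟩ := ih hq' (f v (S k).head?) (Function.update S k (S k).tail)
      (hq' TM2.stmts₁_self) fun v => dif_pos _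
    refine ⟨t + 1, by simpa [stmtDepth] using ht, .step _ _ _ _ _ ?_⟩
    rw [encStk_update] at h
    simpa [flatten, Op.exec, encStk_stkNo, decSym_map, List.map_tail, atStmt,
      hq' TM2.stmts₁_self] using h
  | load f q ih =>
    have hq' := (Finset.subset_insert _ _).trans hq
    obtain ⟨t, ht, h⟩ := ih hq' (f v) S (hq' TM2.stmts₁_self) fun v => dif_pos _
    refine ⟨t + 1, by simpa [stmtDepth] using ht, .step _ _ _ _ _ ?_⟩
    simpa [flatten, Op.exec, atStmt, hq' TM2.stmts₁_self] using h
  | branch f q₁ q₂ ih₁ ih₂ =>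
    have hq' := (Finset.subset_insert _ _).trans hq
    have hq₁ := Finset.subset_union_left.trans hq'
    have hq₂ := Finset.subset_union_right.trans hq'
    cases hf : f v with
    | true =>
      obtain ⟨t, ht, h⟩ := ih₁ hq₁ v S (hq₁ TM2.stmts₁_self) fun v => dif_pos _
      refine ⟨t + 1, by simp [stmtDepth]; omega, .step _ _ _ _ _ ?_⟩
      simpa [flatten, Op.exec, atStmt, hq₁ TM2.stmts₁_self, hf] using h
    | false =>
      obtain ⟨t, ht, h⟩ := ih₂ hq₂ v S (hq₂ TM2.stmts₁_self) fun v => dif_pos _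
      refine ⟨t + 1, by simp [stmtDepth]; omega, .step _ _ _ _ _ ?_⟩
      simpa [flatten, Op.exec, atStmt, hq₂ TM2.stmts₁_self, hf] using h
  | goto l => exact ⟨1, le_rfl, .step _ _ _ _ _ (.refl _ _)⟩
  | halt => exact ⟨1, le_rfl, .step _ _ _ _ _ (.refl _ _)⟩

theorem reach_iterate (ι : (Σ k, Γ k) ↪ X) (main : Λ) (v₀ : σ) (n : ℕ) (c c' : TM2.Cfg Γ Λ σ)
    (h : (flip bind (TM2.step m))^[n] (some c) = some c') :
    ∃ t ≤ n * ∑ l, stmtDepth (m l), (flatten m ι main v₀).Reach (atLabel m c.l c.var)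
      (encStk ι c.stk) (atLabel m c'.l c'.var) (encStk ι c'.stk) t := by
  induction n generalizing c with
  | zero =>
    obtain rfl : c = c' := by simpa using h
    exact ⟨0, by simp, .refl _ _⟩
  | succ n ih =>
    obtain ⟨l, v, S⟩ := c
    rw [Function.iterate_succ_apply] at h
    cases l with
    | none =>
      -- A halted configuration has no successor, so no configuration can be reached from it in a
      -- positive number of steps.
      have hn : ∀ n, (flip bind (TM2.step m))^[n] none = none := fun n => by
        induction n with
        | zero => rfl
        | succ n ih => rw [Function.iterate_succ_apply]; exact ih
      have : (flip bind (TM2.step m)) (some ⟨none, v, S⟩) = none := rfl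
      rw [this, hn] at h
      cases h
    | some l =>
      obtain ⟨t, ht, h₁⟩ := ih _ h
      obtain ⟨u, hu, h₂⟩ := reach_stmt m ι main v₀ (m l) (fun q hq => by
        classical
        exact Finset.mem_biUnion.2 ⟨l, Finset.mem_univ _, hq⟩) v S
      refine ⟨u + t, ?_, h₂.trans h₁⟩
      have := Finset.single_le_sum (f := fun l => stmtDepth (m l)) (fun _ _ => Nat.zero_le _)
        (Finset.mem_univ l)
      rw [Nat.add_mul]
      omega

end Flatten

/-! ### From uniform families to polynomial time string functions -/

/-- Natural numbers in unary. -/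
def natEnv : Env ℕ := ⟨1, fun κ j => if j = 0 then tk κ else [], fun _ j hj => if_neg (by omega)⟩

theorem natEnv_size (κ : ℕ) : natEnv.size κ = κ := by
  simp [Env.size, natEnv]

theorem PT.self : PT X natEnv tk := PT.var (E := natEnv) 0 Nat.one_pos

open Turing

theorem initList_stk (tm : FinTM2) (s : List (tm.Γ tm.k₀)) :
    (initList tm s).stk = Function.update (fun _ => []) tm.k₀ s := by
  funext k
  by_cases h : k = tm.k₀
  · subst h; simp [initList]
  · simp [initList, h]

theorem haltList_stk (tm : FinTM2) (s : List (tm.Γ tm.k₁)) :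
    (haltList tm s).stk = Function.update (fun _ => []) tm.k₁ s := by
  funext k
  by_cases h : k = tm.k₁
  · subst h; simp [haltList]
  · simp [haltList, h]

section
variable {K : Type} {Γ : K → Type} [Fintype K]

theorem encStk_nil (ι : (Σ k, Γ k) ↪ X) : encStk ι (fun _ => []) = fun _ => [] := by
  funext j
  simp [encStk]
end

/-- The machine, its input and output stacks and the slowdown `D` are chosen before the input, as a
polynomial bound over all inputs requires. -/
theorem exists_flat (tm : FinTM2) (ι : (Σ k, tm.Γ k) ↪ X) : ∃ (M : Mach (Sym ⊕ X)) (i o D : ℕ),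
    ∀ s s' T, Nonempty (TM2OutputsInTime tm s (some s') T) →
      M.Runs (Function.update (fun _ => []) i (s.map fun a => .inr (ι ⟨_, a⟩)))
        (Function.update (fun _ => []) o (s'.map fun a => .inr (ι ⟨_, a⟩))) (T * D) := by
  let _ := tm.kFin
  let _ := tm.ΛFin
  let _ := tm.σFin
  refine ⟨flatten tm.m ι tm.main tm.initialState, stkNo tm.k₀, stkNo tm.k₁,
    ∑ l, stmtDepth (tm.m l), ?_⟩
  rintro s s' T ⟨h⟩
  obtain ⟨t, ht, h'⟩ := reach_iterate tm.m ι tm.main tm.initialState h.steps _ _ h.evals_in_steps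
  refine ⟨t, ht.trans (Nat.mul_le_mul_right _ h.steps_le_m), ?_⟩
  have e₁ := congrArg (encStk ι) (initList_stk tm s)
  have e₂ := congrArg (encStk ι) (haltList_stk tm s')
  rw [encStk_update, encStk_nil] at e₁ e₂
  rw [← e₁, ← e₂]
  exact h'

theorem unaryEncodeNat_eq (κ : ℕ) : Computability.unaryEncodeNat κ = List.replicate κ true := by
  induction κ with
  | zero => rfl
  | succ n ih => rw [Computability.unaryEncodeNat, ih, List.replicate_succ]

/-- A uniform family of descriptions is computable in polynomial time. -/
theorem PT.ofUniform {α : Type} {code : α → List Sym} {C : ℕ → α}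
    (c : TM2ComputableInPolyTime Computability.unaryEncodeNat code C)
    (ι : (Σ k, c.tm.Γ k) ↪ X) : PT X natEnv fun κ => code (C κ) := by
  obtain ⟨M, i, o, D, hM⟩ := exists_flat c.tm ι
  let a₀ : Sym ⊕ X := .inr (ι ⟨_, c.inputAlphabet.symm true⟩)
  -- Reads a stack symbol as an output symbol; `.tick` is a dummy for symbols that are not in the
  -- image of the output alphabet.
  let cls : Sym ⊕ X → Sym := fun x =>
    ((decSym ι c.tm.k₁ (some x)).map c.outputAlphabet).getD .tick
  have hcls : ∀ s, cls (.inr (ι ⟨_, c.outputAlphabet.symm s⟩)) = s := fun s => by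
    have := decSym_map ι c.tm.k₁ (some (c.outputAlphabet.symm s))
    simp only [Option.map_some] at this
    simp [cls, this]
  -- Stacks `0`, `1` and `2` are reserved for the number, the result and an auxiliary string.
  let ρ : ℕ → ℕ := fun j => j + 3
  have hρ : ρ.Injective := fun i j h => by simpa [ρ] using h
  -- The parameter must survive the computation, so each tick on the auxiliary stack is put back on
  -- stack `0` while one input symbol is written for the Turing machine.
  have inp : ∀ κ n (T : ℕ → List (Sym ⊕ X)), T 2 = (tk n).map .inl →
      T 0 = (tk κ).map .inl → T (i + 3) = List.replicate κ a₀ →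
      (Mach.loop 2 (fun _ => ()) fun _ => (Mach.push 0 (.inl .tick)).seq (Mach.push (i + 3) a₀)).Runs
        T (Function.update (Function.update (Function.update T 2 []) 0 ((tk (κ + n)).map .inl))
          (i + 3) (List.replicate (κ + n) a₀)) (3 * n + 1) := by
    intro κ n
    induction n generalizing κ with
    | zero =>
      intro T h₂ h₀ hi
      have : Function.update (Function.update (Function.update T 2 []) 0
          ((tk (κ + 0)).map .inl)) (i + 3) (List.replicate (κ + 0) a₀) = T := by
        funext j
        simp only [Function.update_apply]
        split_ifs with e₁ e₂ e₃
        · rw [e₁, hi]; rfl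
        · rw [e₂, h₀]; rfl
        · rw [e₃, h₂]; rfl
        · rfl
      rw [this]
      exact Mach.runs_loop_nil h₂
    | succ n ih =>
      intro T h₂ h₀ hi
      have hb := (Mach.runs_push 0 (.inl .tick) (Function.update T 2 ((tk n).map .inl))).seq
        (Mach.runs_push (i + 3) a₀ _)
      have := Mach.runs_loop_cons (cls := fun _ => ()) (body := fun _ =>
        (Mach.push 0 (.inl .tick)).seq (Mach.push (i + 3) a₀)) h₂ hb
        (ih (κ + 1) _ (by simp) (by simp [h₀, tk, List.replicate_succ])
          (by simp [hi, List.replicate_succ]))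
      refine (Mach.Runs.mono (this |> cast ?_) (by omega : 1 + 1 + 1 + (3 * n + 1) ≤ _))
      congr 1
      rw [Nat.add_right_comm κ 1 n]
      funext j
      simp only [Function.update_apply]
      split_ifs <;> first | omega | rfl
  -- Decoding to stack `2` reverses the output; the pouring to stack `1` at the end restores the
  -- order.
  have out : ∀ (l : List Sym) (T : ℕ → List (Sym ⊕ X)),
      T (o + 3) = l.map (fun s => .inr (ι ⟨_, c.outputAlphabet.symm s⟩)) →
      (Mach.loop (o + 3) cls fun s => Mach.push 2 (.inl s)).Runs T
        (Function.update (Function.update T (o + 3) []) 2 (l.reverse.map .inl ++ T 2))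
        (2 * l.length + 1) := by
    intro l
    induction l with
    | nil =>
      intro T h
      have : Function.update (Function.update T (o + 3) []) 2
          (([] : List Sym).reverse.map .inl ++ T 2) = T := by
        funext j
        simp only [Function.update_apply]
        split_ifs with e₁ e₂
        · rw [e₁]; rfl
        · rw [e₂, h]; rfl
        · rfl
      rw [this]
      exact Mach.runs_loop_nil h
    | cons s l ih =>
      intro T h
      have hb := Mach.runs_push 2 (.inl s) (Function.update T (o + 3)
        (l.map (fun s => .inr (ι ⟨_, c.outputAlphabet.symm s⟩))))
      rw [List.map_cons] at h
      have := Mach.runs_loop_cons (cls := cls) (body := fun s => Mach.push 2 (.inl s)) h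
        (by rw [hcls]; exact hb) (ih _ (by simp))
      refine (Mach.Runs.mono (this |> cast ?_) (by simp; omega :
        1 + 1 + (2 * l.length + 1) ≤ 2 * (s :: l).length + 1))
      congr 1
      funext j
      simp only [Function.update_apply]
      split_ifs <;> first | omega | simp
  have hlen : PB natEnv.size fun κ => (code (C κ)).length := by
    refine ⟨.X + c.time * .C D, fun κ => ?_⟩
    have := (hM _ _ _ ⟨c.outputsFun κ⟩).length_le o
    simp only [Function.update_self, List.length_map, unaryEncodeNat_eq, List.length_replicate,
      Function.update_apply] at this
    rw [natEnv_size]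
    simp only [Polynomial.eval_add, Polynomial.eval_X, Polynomial.eval_mul, Polynomial.eval_C]
    refine this.trans ?_
    split_ifs <;> simp
  refine ⟨(Mach.pour 0 2).seq ((Mach.loop 2 (fun _ => ()) fun _ =>
    (Mach.push 0 (.inl .tick)).seq (Mach.push (i + 3) a₀)).seq ((M.rename ρ).seq
      ((Mach.loop (o + 3) cls fun s => Mach.push 2 (.inl s)).seq (Mach.pour 2 1)))), _,
    (((PB.const 2).mul PB.self).add (.const 1)).add ((((PB.const 3).mul PB.self).add
      (.const 1)).add (((PB.self.eval c.time).mul (.const D)).add ((((PB.const 2).mul hlen).add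
        (.const 1)).add (((PB.const 2).mul hlen).add (.const 1))))), fun κ => ?_⟩
  rw [natEnv_size]
  have h₁ := Mach.runsS_pour (X := X) (k := 0) (j := 2) (by omega) (tk κ) (natEnv.val κ)
    (by simp [natEnv])
  have hr : (tk κ).reverse = tk κ := by simp [tk]
  have h₂ := inp 0 κ (st (Function.update (Function.update (natEnv.val κ) 0 []) 2
      ((tk κ).reverse ++ natEnv.val κ 2))) (by simp [st, natEnv, hr]) (by simp [st, tk])
      (by simp [st, natEnv])
  have h₃ := (hM _ _ _ ⟨c.outputsFun κ⟩).rename hρ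
    (T := Function.update (st (natEnv.val κ)) (i + 3) (List.replicate κ a₀))
    (T' := Function.update (st (natEnv.val κ)) (o + 3) ((code (C κ)).map
      fun s => .inr (ι ⟨_, c.outputAlphabet.symm s⟩)))
    (fun j => by
      simp only [Function.update_apply, ρ, Nat.add_right_cancel_iff]
      split_ifs with h
      · simp [unaryEncodeNat_eq, a₀]
      · simp [st, natEnv])
    (fun j => by
      simp only [Function.update_apply, ρ, Nat.add_right_cancel_iff]
      split_ifs with h
      · simp
      · simp [st, natEnv])
    (fun j hj => by
      rw [Function.update_of_ne, Function.update_of_ne] <;>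
      · rintro rfl
        exact hj ⟨_, rfl⟩)
  have h₄ := out (code (C κ)) _ (Function.update_self _ _ _ :
    Function.update (st (natEnv.val κ)) (o + 3) _ (o + 3) = _)
  have h₅ := Mach.runsS_pour (X := X) (k := 2) (j := 1) (by omega) (code (C κ)).reverse
    (Function.update (natEnv.val κ) 2 (code (C κ)).reverse) (by simp)
  have e₂ : Function.update (Function.update (Function.update (st (Function.update (Function.update
      (natEnv.val κ) 0 []) 2 ((tk κ).reverse ++ natEnv.val κ 2))) 2 []) 0 ((tk (0 + κ)).map .inl))
      (i + 3) (List.replicate (0 + κ) a₀) =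
      Function.update (st (natEnv.val κ)) (i + 3) (List.replicate κ a₀) := by
    funext j
    simp only [Function.update_apply, st, natEnv, Nat.zero_add]
    split_ifs <;> first | omega | rfl
  have e₄ : Function.update (Function.update (Function.update (st (natEnv.val κ)) (o + 3)
      ((code (C κ)).map fun s => .inr (ι ⟨_, c.outputAlphabet.symm s⟩))) (o + 3) []) 2
      ((code (C κ)).reverse.map .inl ++ Function.update (st (natEnv.val κ)) (o + 3)
        ((code (C κ)).map fun s => .inr (ι ⟨_, c.outputAlphabet.symm s⟩)) 2) =
      (st (Function.update (natEnv.val κ) 2 (code (C κ)).reverse) : ℕ → List (Sym ⊕ X)) := by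
    funext j
    simp only [Function.update_apply, st, natEnv]
    split_ifs <;> first | contradiction | omega | simp
  have e₅ : Function.update (Function.update (Function.update (natEnv.val κ) 2
      (code (C κ)).reverse) 2 []) 1 ((code (C κ)).reverse.reverse ++
        Function.update (natEnv.val κ) 2 (code (C κ)).reverse 1) =
      (natEnv.snoc fun κ => code (C κ)).val κ := by
    funext j
    simp only [Function.update_apply, natEnv, Env.snoc]
    split_ifs <;> first | contradiction | omega | simp
  rw [e₂] at h₂
  rw [e₄] at h₄
  have h₃' := h₃.mono (u := c.time.eval κ * D) (by simp [unaryEncodeNat_eq])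
  exact Mach.Runs.seq (h₁.cast rfl (by simp)) (h₂.seq (h₃'.seq (h₄.seq (h₅.cast e₅ (by simp)))))

/-! ### From stack machines back to Turing machines -/

/-- The stack on which an operation acts. -/
def Op.stack {Γ N : Type} : Op Γ N → ℕ
  | .push k _ _ | .pop k _ | .peek k _ => k
  | .jump _ => 0

namespace Mach

/-- A bound on the numbers of the stacks of a machine. -/
def bd (N : Mach (Sym ⊕ X)) : ℕ :=
  let _ := N.fin
  -- The summand `2` provides for stacks `0` and `2`, through which input and output pass.
  ∑ s, ((N.op s).stack + 1) + 2

theorem stack_lt (N : Mach (Sym ⊕ X)) (s : N.S) : (N.op s).stack < N.bd + 1 := by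
  let _ := N.fin
  have := Finset.single_le_sum (f := fun s => (N.op s).stack + 1) (fun _ _ => Nat.zero_le _)
    (Finset.mem_univ s)
  simp only [bd] at *
  omega

/-- The stack alphabets of the Turing machine that runs a machine: input, output, and the stacks
of the machine. -/
abbrev tmΓ (N : Mach (Sym ⊕ X)) : Bool ⊕ Fin (N.bd + 1) → Type
  | .inl false => Bool
  | .inl true => Sym
  | .inr _ => Sym ⊕ X

/-- The internal states of the Turing machine that runs a machine. -/
abbrev tmσ (N : Mach (Sym ⊕ X)) : Type := Option Bool × Option N.S × Option Sym

/-- A symbol as an output symbol. -/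
def outSym : Sym ⊕ X → Sym := Sum.elim id fun _ => .tick

/-- The program of the Turing machine that runs a machine: move the input to stack `0`, run the
machine, and move stack `2` to the output. -/
def tmProg (N : Mach (Sym ⊕ X)) : Option (Option N.S) → TM2.Stmt N.tmΓ (Option (Option N.S)) N.tmσ
  | none => .pop (.inl false) (fun v o => (o, v.2)) <| .branch (fun v => v.1.isSome)
      (.push (.inr (.ofNat _ 0)) (fun _ => (.inl .tick : Sym ⊕ X)) <| .goto fun _ => none)
      (.goto fun _ => some N.start)
  | some (some s) => match N.op s with
    | .push k a u => .push (.inr (.ofNat _ k)) (fun _ => a) <| .goto fun _ => some u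
    | .pop k f => .pop (.inr (.ofNat _ k)) (fun v o => (v.1, f o, v.2.2)) <|
        .goto fun v => some v.2.1
    | .peek k f => .peek (.inr (.ofNat _ k)) (fun v o => (v.1, f o, v.2.2)) <|
        .goto fun v => some v.2.1
    | .jump u => .goto fun _ => some u
  | some none => .pop (.inr (.ofNat _ 2)) (fun v o => (v.1, v.2.1, o.map outSym)) <|
      .branch (fun v => v.2.2.isSome)
        (.push (.inl true) (fun v => (v.2.2.getD .tick : Sym)) <| .goto fun _ => some none)
        -- The halting configuration demanded by `haltList` has the initial internal state.
        (.load (fun _ => (none, none, none)) .halt)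

/-- The Turing machine that runs a machine. -/
def toTM (N : Mach (Sym ⊕ X)) : FinTM2 where
  K := Bool ⊕ Fin (N.bd + 1)
  k₀ := .inl false
  k₁ := .inl true
  Γ := N.tmΓ
  Λ := Option (Option N.S)
  main := none
  ΛFin := let _ := N.fin; inferInstance
  σ := N.tmσ
  initialState := (none, none, none)
  σFin := let _ := N.fin; inferInstance
  Γk₀Fin := inferInstanceAs (Fintype Bool)
  m := N.tmProg

/-- The stacks of the Turing machine that runs a machine. -/
def tmStk (N : Mach (Sym ⊕ X)) (a : List Bool) (b : List Sym) (T : ℕ → List (Sym ⊕ X)) :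
    ∀ k, List (N.tmΓ k)
  | .inl false => a
  | .inl true => b
  | .inr j => T j

variable (N : Mach (Sym ⊕ X))

theorem tmStk_update (a : List Bool) (b : List Sym) (T : ℕ → List (Sym ⊕ X)) (k : ℕ)
    (hk : k < N.bd + 1) (l : List (Sym ⊕ X)) :
    (Function.update (N.tmStk a b T) (.inr (.ofNat _ k)) l : ∀ k, List (N.tmΓ k)) =
      N.tmStk a b (Function.update T k l) := by
  funext j
  rcases j with (_ | _) | j
  · rw [Function.update_of_ne (by simp)]; rfl
  · rw [Function.update_of_ne (by simp)]; rfl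
  · by_cases h : j = .ofNat _ k
    · subst h
      rw [Function.update_self]
      simp [tmStk, Nat.mod_eq_of_lt hk]
    · rw [Function.update_of_ne (by simpa using h)]
      have : (j : ℕ) ≠ k := fun e => h (Fin.ext (by simp [e, Nat.mod_eq_of_lt hk]))
      simp [tmStk, this]

theorem tmStk_ofNat (a : List Bool) (b : List Sym) (T : ℕ → List (Sym ⊕ X)) (k : ℕ)
    (hk : k < N.bd + 1) : N.tmStk a b T (.inr (.ofNat _ k)) = T k := by
  simp [tmStk, Nat.mod_eq_of_lt hk]

theorem tmStk_input (a a' : List Bool) (b : List Sym) (T : ℕ → List (Sym ⊕ X)) :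
    (Function.update (N.tmStk a b T) (.inl false) a' : ∀ k, List (N.tmΓ k)) =
      N.tmStk a' b T := by
  funext j
  rcases j with (_ | _) | j
  · rw [Function.update_self]; rfl
  · rw [Function.update_of_ne (by simp)]; rfl
  · rw [Function.update_of_ne (by simp)]; rfl

theorem tmStk_output (a : List Bool) (b b' : List Sym) (T : ℕ → List (Sym ⊕ X)) :
    (Function.update (N.tmStk a b T) (.inl true) b' : ∀ k, List (N.tmΓ k)) =
      N.tmStk a b' T := by
  funext j
  rcases j with (_ | _) | j
  · rw [Function.update_of_ne (by simp)]; rfl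
  · rw [Function.update_self]; rfl
  · rw [Function.update_of_ne (by simp)]; rfl

/-- The Turing machine evolves from the first configuration to the second one in `n` steps. -/
def Ev (n : ℕ) (c c' : TM2.Cfg N.tmΓ (Option (Option N.S)) N.tmσ) : Prop :=
  (flip bind (TM2.step N.tmProg))^[n] (some c) = some c'

variable {N}

theorem Ev.trans {m n : ℕ} {c c' c'' : TM2.Cfg N.tmΓ (Option (Option N.S)) N.tmσ} (h : N.Ev m c c')
    (h' : N.Ev n c' c'') : N.Ev (n + m) c c'' := by
  rw [Ev, Function.iterate_add_apply, h, h']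

theorem ev_one {l : Option (Option N.S)} {v : N.tmσ} {S : ∀ k, List (N.tmΓ k)}
    {c : TM2.Cfg N.tmΓ (Option (Option N.S)) N.tmσ} (h : TM2.stepAux (N.tmProg l) v S = c) :
    N.Ev 1 ⟨some l, v, S⟩ c := congrArg some h

theorem ev_input (n i : ℕ) (T : ℕ → List (Sym ⊕ X)) (hT : T 0 = (tk i).map .inl) (v : N.tmσ) :
    ∃ v', N.Ev (n + 1) ⟨some none, v, N.tmStk (List.replicate n true) [] T⟩
      ⟨some (some N.start), v', N.tmStk [] [] (Function.update T 0 ((tk (n + i)).map .inl))⟩ := by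
  induction n generalizing i T v with
  | zero =>
    refine ⟨(none, v.2), ev_one ?_⟩
    rw [Nat.zero_add, ← hT, Function.update_eq_self]
    simp only [tmProg, TM2.stepAux, tmStk_input]
    rfl
  | succ n ih =>
    obtain ⟨v', h⟩ := ih (i + 1) (Function.update T 0 ((tk (i + 1)).map .inl)) (by simp)
      (some true, v.2)
    refine ⟨v', ?_⟩
    rw [Function.update_idem, show n + (i + 1) = n + 1 + i by omega] at h
    refine Ev.trans (ev_one ?_) h
    simp only [tmProg, TM2.stepAux, tmStk_input]
    simp only [tmStk, List.replicate_succ, List.head?_cons, Option.isSome_some, cond_true,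
      List.tail_cons]
    rw [← tmStk_update _ _ _ _ _ (Nat.succ_pos _)]
    simp [hT, tk, List.replicate_succ]

theorem ev_reach {s s' : Option N.S} {T T' : ℕ → List (Sym ⊕ X)} {t : ℕ} (h : N.Reach s T s' T' t)
    (v : N.tmσ) :
    ∃ v', N.Ev t ⟨some (some s), v, N.tmStk [] [] T⟩ ⟨some (some s'), v', N.tmStk [] [] T'⟩ := by
  induction h generalizing v with
  | refl s T => exact ⟨v, rfl⟩
  | step s T s' T' t _ ih =>
    have hs := N.stack_lt s
    suffices ∃ v', N.Ev 1 ⟨some (some (some s)), v, N.tmStk [] [] T⟩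
        ⟨some (some ((N.op s).exec T).1), v', N.tmStk [] [] ((N.op s).exec T).2⟩ by
      obtain ⟨v', h'⟩ := this
      obtain ⟨v'', h''⟩ := ih v'
      exact ⟨v'', h'.trans h''⟩
    cases h : N.op s with
    | push k a u =>
      rw [h] at hs
      change k < _ at hs
      refine ⟨v, ev_one ?_⟩
      simp only [tmProg, h, TM2.stepAux, Op.exec]
      rw [← tmStk_update _ _ _ _ _ hs, tmStk_ofNat _ _ _ _ _ hs]
    | pop k f =>
      rw [h] at hs
      change k < _ at hs
      refine ⟨(v.1, f (T k).head?, v.2.2), ev_one ?_⟩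
      simp only [tmProg, h, TM2.stepAux, Op.exec]
      rw [← tmStk_update _ _ _ _ _ hs, tmStk_ofNat _ _ _ _ _ hs]
    | peek k f =>
      rw [h] at hs
      change k < _ at hs
      refine ⟨(v.1, f (T k).head?, v.2.2), ev_one ?_⟩
      simp only [tmProg, h, TM2.stepAux, Op.exec]
      rw [tmStk_ofNat _ _ _ _ _ hs]
    | jump u => exact ⟨v, ev_one (by simp only [tmProg, h, TM2.stepAux, Op.exec])⟩

theorem ev_output (l b : List Sym) (v : N.tmσ) :
    N.Ev (l.length + 1)
      ⟨some (some none), v, N.tmStk [] b (st (Function.update (fun _ => []) 2 l))⟩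
      ⟨none, (none, none, none), N.tmStk [] (l.reverse ++ b) fun _ => []⟩ := by
  have h2 : 2 < N.bd + 1 := by simp [bd]
  induction l generalizing b v with
  | nil =>
    have : st (Function.update (fun _ => []) 2 ([] : List Sym)) =
        (fun _ => [] : ℕ → List (Sym ⊕ X)) := by
      funext j
      by_cases h : j = 2 <;> simp [st, h]
    rw [this]
    refine ev_one ?_
    simp only [tmProg, TM2.stepAux]
    rw [tmStk_ofNat _ _ _ _ _ h2]
    simp only [List.head?_nil, Option.map_none, Option.isSome_none, cond_false, List.tail_nil]
    rw [tmStk_update _ _ _ _ _ h2, Function.update_eq_self_iff.2 rfl]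
    rfl
  | cons s l ih =>
    have h := ih (s :: b) (v.1, v.2.1, some s)
    rw [List.reverse_cons, List.append_assoc]
    refine Ev.trans (ev_one ?_) h
    simp only [tmProg, TM2.stepAux]
    rw [tmStk_ofNat _ _ _ _ _ h2, tmStk_update _ _ _ _ _ h2, tmStk_output]
    have : (Function.update (st (Function.update (fun _ => []) 2 (s :: l))) 2
        (st (Function.update (fun _ => []) 2 (s :: l)) 2).tail : ℕ → List (Sym ⊕ X)) =
        st (Function.update (fun _ => []) 2 l) := by
      funext j
      by_cases h : j = 2
      · subst h; simp [st]
      · simp [st, h]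
    rw [this]
    simp [st, tmStk, outSym]

end Mach

/-- A family of objects whose descriptions are computable in polynomial time is uniform. -/
theorem PT.uniform {α : Type} {code : α → List Sym} {C : ℕ → α}
    (h : PT X natEnv fun κ => code (C κ)) : Uniform code C := by
  have hlen := h.length_bound
  obtain ⟨M, t, ht, hM⟩ := h
  -- At the end all stacks except the output must be empty, hence the clearing. Stack `2` receives
  -- the description in reverse, and the output loop of the Turing machine reverses it once more.
  let N : Mach (Sym ⊕ X) := M.seq ((Mach.clear 0).seq (Mach.pour 1 2))
  obtain ⟨P, hP⟩ := ht.add ((PB.self.add (.const 1)).add (((PB.const 2).mul hlen).add (.const 1)))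
  obtain ⟨Q, hQ⟩ := hlen
  have hN : ∀ κ, N.RunsS (natEnv.val κ) (Function.update (fun _ => []) 2 (code (C κ)).reverse)
      (P.eval κ) := fun κ => by
    have h₁ := Mach.runsS_clear (X := X) 0 (tk κ) ((natEnv.snoc fun κ => code (C κ)).val κ)
      (by simp [natEnv, Env.snoc])
    have h₂ := Mach.runsS_pour (X := X) (k := 1) (j := 2) (by omega) (code (C κ))
      (Function.update ((natEnv.snoc fun κ => code (C κ)).val κ) 0 [])
      (by simp [natEnv, Env.snoc])
    have := hP κ
    rw [natEnv_size] at this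
    refine ((hM κ).seq (h₁.seq h₂)).cast ?_ ((by simp [natEnv_size] : _ ≤ _).trans this)
    funext j
    simp only [natEnv, Env.snoc, Function.update_apply]
    split_ifs <;> first | contradiction | omega | simp
  -- `κ + 1` steps read the input, `P` bounds the run of `N`, and `Q` bounds the length of the
  -- description, which is written in one step per symbol and a last step to halt.
  refine ⟨⟨⟨N.toTM, .refl _, .refl _⟩, .X + 1 + P + Q + 1, fun κ => ?_⟩⟩
  have run : ∃ n ≤ κ + 1 + P.eval κ + Q.eval κ + 1,
      N.Ev n ⟨some none, (none, none, none), N.tmStk (List.replicate κ true) [] fun _ => []⟩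
        ⟨none, (none, none, none), N.tmStk [] (code (C κ)) fun _ => []⟩ := by
    obtain ⟨v₁, h₁⟩ := Mach.ev_input (N := N) κ 0 (fun _ => []) rfl (none, none, none)
    obtain ⟨u, hu, hr⟩ := hN κ
    obtain ⟨v₂, h₂⟩ := Mach.ev_reach hr v₁
    have h₃ := Mach.ev_output (code (C κ)).reverse [] v₂
    have e : (Function.update (fun _ => []) 0 ((tk (κ + 0)).map .inl) : ℕ → List (Sym ⊕ X)) =
        st (natEnv.val κ) := by
      funext j
      by_cases h : j = 0
      · subst h; simp [natEnv, st]
      · simp [natEnv, st, h]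
    rw [e] at h₁
    rw [List.reverse_reverse, List.append_nil] at h₃
    have : (code (C κ)).length ≤ Q.eval κ := by
      simpa only [natEnv_size] using hQ κ
    exact ⟨_, by simp; omega, (h₁.trans h₂).trans h₃⟩
  have init : ∀ l, initList N.toTM l =
      (⟨some none, (none, none, none), N.tmStk l [] fun _ => []⟩ :
        TM2.Cfg N.tmΓ (Option (Option N.S)) N.tmσ) := fun l => by
    have := initList_stk N.toTM l
    have e : (Function.update (fun _ => []) N.toTM.k₀ l : ∀ k, List (N.toTM.Γ k)) =
        N.tmStk l [] fun _ => [] := by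
      refine Eq.trans ?_ (N.tmStk_input [] l [] fun _ => [])
      congr 1
      funext j
      rcases j with (_ | _) | j <;> rfl
    rw [e] at this
    show (⟨some none, (none, none, none), (initList N.toTM l).stk⟩ :
        TM2.Cfg N.tmΓ (Option (Option N.S)) N.tmσ) = _
    rw [this]
  have halt : ∀ l, haltList N.toTM l =
      (⟨none, (none, none, none), N.tmStk [] l fun _ => []⟩ :
        TM2.Cfg N.tmΓ (Option (Option N.S)) N.tmσ) := fun l => by
    have := haltList_stk N.toTM l
    have e : (Function.update (fun _ => []) N.toTM.k₁ l : ∀ k, List (N.toTM.Γ k)) =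
        N.tmStk [] l fun _ => [] := by
      refine Eq.trans ?_ (N.tmStk_output [] [] l fun _ => [])
      congr 1
      funext j
      rcases j with (_ | _) | j <;> rfl
    rw [e] at this
    show (⟨none, (none, none, none), (haltList N.toTM l).stk⟩ :
        TM2.Cfg N.tmΓ (Option (Option N.S)) N.tmσ) = _
    rw [this]
  have key : ∀ l l' T, l = List.replicate κ true → l' = code (C κ) →
      T = κ + 1 + P.eval κ + Q.eval κ + 1 →
      Nonempty (StateTransition.EvalsToInTime N.toTM.step (initList N.toTM l)
        (some (haltList N.toTM l')) T) := by
    rintro _ _ _ rfl rfl rfl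
    obtain ⟨n, hn, h⟩ := run
    refine ⟨⟨⟨n, ?_⟩, hn⟩⟩
    exact (congrArg _ (congrArg some (init _))).trans (Eq.trans h (congrArg some (halt _)).symm)
  exact (key _ _ _ ((List.map_id _).trans (unaryEncodeNat_eq κ)) (List.map_id _)
    (by simp [unaryEncodeNat_eq])).some

/-! ## The reduction -/

/-- The inverse gate. -/
def Gate.inv {W : Type} : Gate W → Gate W
  | .t w => .tdg w
  | .tdg w => .t w
  | g => g

/-- The inverse circuit. -/
def invCircuit {W : Type} (c : List (Gate W)) : List (Gate W) := (c.map Gate.inv).reverse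

/-- The concatenation of `f (n - 1)`, …, `f 0`. -/
def loopDown {α : Type} : ℕ → (ℕ → List α) → List α
  | 0, _ => []
  | p + 1, f => f p ++ loopDown p f

/-- The wires of the pirate on which programs are evaluated: the program itself is kept in place,
and all other registers are shifted. -/
def evw (N : ℕ) (w : Wire) : Wire :=
  if w.kind = .inp ∧ w.reg = 0 then w else ⟨w.kind, w.reg + N, w.pos⟩

/-- The wires of the table entry with number `idx`: `L` coins, and the value at these coins. -/
def tabWire (k : Kind) (N L reg idx p : ℕ) : Wire := ⟨k, reg, N + idx * (L + 1) + p⟩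

/-- Choose random coins, and evaluate the program `0` at the coins without disturbing it. -/
def fetch (ev : Circuit) (N L : ℕ) (tab : ℕ → Wire) : Circuit :=
  loopDown L (fun p => [.h (tab p)]) ++
    (loopDown L (fun p => [.cx (tab p) ⟨.inp, 1 + N, p⟩]) ++
      -- Compute, copy the answer, uncompute. The answer is a definite bit for each value of the
      -- coins, so the copy does not disturb the program.
      (ev.map (Gate.map (evw N)) ++ ([.cx ⟨.out, N, 0⟩ (tab L)] ++
        (invCircuit (ev.map (Gate.map (evw N))) ++
          loopDown L (fun p => [.cx (tab p) ⟨.inp, 1 + N, p⟩])))))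

/-- Answer a query from a table entry. -/
def answer (L : ℕ) (tab : ℕ → Wire) : Circuit :=
  loopDown (L + 1) (fun p => [.cx (tab p) ⟨.ans, 0, p⟩]) ++ [.cx ⟨.ask, 0, 0⟩ ⟨.ans, 0, L⟩]

/-- The length of the description of a list of gates. -/
def ix (l : List OGate) : ℕ := (l.flatMap OGate.code).length

/-- Replace the gates and the queries; the queries are numbered by the length of the description of
what follows them. -/
def expand (e : Gate Wire → Circuit) (q : ℕ → Circuit) (b : ℕ) : List OGate → Circuit
  | [] => []
  | .gate g :: l => e g ++ expand e q b l
  | .query :: l => q (ix l + b) ++ expand e q b l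

/-- The length of the description of the remaining freeloaders, with the end mark of the current
one. -/
def ixFree (l : List (List OGate)) : ℕ := (listCode (listCode OGate.code) l).length + 1

/-- Prepare the tables of the freeloaders from number `i` on. -/
def fetchFree (c : ℕ → ℕ → Circuit) : ℕ → List (List OGate) → Circuit
  | _, [] => []
  | i, l :: r => expand (fun _ => []) (c i) (ixFree r) l ++ fetchFree c (i + 1) r

/-- Choose a random last bit of the challenge. -/
def guessBit (N L : ℕ) : Circuit := [.h ⟨.work, N, 0⟩, .cx ⟨.work, N, 0⟩ ⟨.inp, 1, L⟩]

/-- Add the random last bit of the challenge to the answer. -/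
def unguess (N : ℕ) : Circuit := [.cx ⟨.work, N, 0⟩ outBit]

/-- The freeloaders of the reduction. -/
def simFree (N L : ℕ) : List (List OGate) → List Circuit
  | [] => []
  | l :: r => (guessBit N L ++ (expand (fun g => [g])
      (fun i => answer L (tabWire .inp N L 0 i)) (ixFree r) l ++ unguess N)) :: simFree N L r

/-- The reduction: an adversary against the copy protection scheme with evaluation `ev`, from one
against the encryption scheme. -/
def reduction (ev : Circuit) (N L : ℕ) (A : Adversary OGate) : Adversary (Gate Wire) where
  -- All tables, also those of the freeloaders, are prepared before any gate of `A` acts, while the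
  -- program is still intact. The table entries of a freeloader lie in the output register that is
  -- passed to it.
  pirate := expand (fun _ => []) (fun i => fetch ev N L (tabWire .ans N L 0 i)) 0 A.pirate ++
    (fetchFree (fun r i => fetch ev N L (tabWire .out N L r i)) 0 A.free ++
      expand (fun g => [g]) (fun i => answer L (tabWire .ans N L 0 i)) 0 A.pirate)
  free := simFree N L A.free

/-! ### Building blocks of the reduction as strings -/

/-- The description of a circuit without the end mark. -/
def cdc (c : Circuit) : List Sym := c.flatMap Gate.code

@[simp] theorem cdc_nil : cdc [] = [] := rfl

@[simp] theorem cdc_cons (g : Gate Wire) (c : Circuit) : cdc (g :: c) = g.code ++ cdc c := rfl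

@[simp] theorem cdc_append (c c' : Circuit) : cdc (c ++ c') = cdc c ++ cdc c' :=
  List.flatMap_append

theorem unary_eq (n : ℕ) : unary n = tk n ++ [.sep] := rfl

namespace PT
variable {α : Type} {E : Env α}

theorem wire (k : Kind) {r p : α → ℕ} (hr : PT X E fun a => tk (r a))
    (hp : PT X E fun a => tk (p a)) : PT X E fun a => (⟨k, r a, p a⟩ : Wire).code :=
  ((hr.append (const [.sep])).append (hp.append (const [.sep]))).cons k.code

theorem h {w : α → Wire} (hw : PT X E fun a => (w a).code) :
    PT X E fun a => cdc [.h (w a)] := (hw.cons .h).congr fun _ => by simp [Gate.code]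

theorem cx {w w' : α → Wire} (hw : PT X E fun a => (w a).code) (hw' : PT X E fun a => (w' a).code) :
    PT X E fun a => cdc [.cx (w a) (w' a)] :=
  ((hw.append hw').cons .cx).congr fun _ => by simp [Gate.code]

theorem circuit_append {c c' : α → Circuit} (hc : PT X E fun a => cdc (c a))
    (hc' : PT X E fun a => cdc (c' a)) : PT X E fun a => cdc (c a ++ c' a) :=
  (hc.append hc').congr fun _ => cdc_append _ _

theorem loopDown {n : α → ℕ} {f : α → ℕ → Circuit} (hn : PT X E fun a => tk (n a))
    (hf : PT X E.recEnv fun p => cdc (f p.1 p.2.1.length)) :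
    PT X E fun a => cdc (loopDown (n a) (f a)) :=
  (hn.scan (g := fun _ a t => cdc (f a t.length)) fun _ => hf).congr fun a => by
    induction n a with
    | zero => rfl
    | succ n ih => rw [CopyProt.loopDown, cdc_append, scan_tk, ih, length_tk]

theorem natConst (n : ℕ) : PT X E fun _ => tk n := const _

end PT

theorem scan_self (g : Sym → List Sym → List Sym) (w l : List Sym)
    (h : ∀ s ∈ w, ∀ t, g s t = [s]) : scan g (w ++ l) = w ++ scan g l := by
  induction w with
  | nil => rfl
  | cons s w ih =>
    simp only [List.cons_append, scan, h s List.mem_cons_self]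
    rw [ih fun s hs => h s (List.mem_cons_of_mem _ hs)]
    rfl

theorem scan_drop (g : Sym → List Sym → List Sym) (w l : List Sym)
    (h : ∀ s ∈ w, ∀ t, g s t = []) : scan g (w ++ l) = scan g l := by
  induction w with
  | nil => rfl
  | cons s w ih =>
    simp only [List.cons_append, scan, h s List.mem_cons_self]
    rw [ih fun s hs => h s (List.mem_cons_of_mem _ hs)]
    rfl

/-- The symbols with which the descriptions of gates begin. -/
def Sym.isGate : Sym → Bool
  | .x | .h | .t | .tdg | .cx | .ccx => true
  | _ => false

/-- The symbols that occur in the descriptions of wires. -/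
def Sym.isWire : Sym → Bool
  | .tick | .sep | .inp | .out | .work | .ask | .ans => true
  | _ => false

theorem mem_wire_code {w : Wire} {s : Sym} (h : s ∈ w.code) : s.isWire = true := by
  obtain ⟨k, r, p⟩ := w
  simp only [Wire.code, unary, List.mem_cons, List.mem_append, List.mem_replicate,
    List.not_mem_nil, or_false] at h
  rcases h with rfl | (⟨_, rfl⟩ | rfl) | ⟨_, rfl⟩ | rfl
  · cases k <;> rfl
  all_goals rfl

/-- The first symbol of the description of a gate. -/
def Gate.head : Gate Wire → Sym
  | .x _ => .x
  | .h _ => .h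
  | .t _ => .t
  | .tdg _ => .tdg
  | .cx _ _ => .cx
  | .ccx _ _ _ => .ccx

/-- The description of the wires of a gate. -/
def Gate.args : Gate Wire → List Sym
  | .x w | .h w | .t w | .tdg w => w.code
  | .cx c w => c.code ++ w.code
  | .ccx c c' w => c.code ++ c'.code ++ w.code

theorem Gate.code_eq (g : Gate Wire) : g.code = g.head :: g.args := by cases g <;> rfl

theorem Gate.mem_args {g : Gate Wire} {s : Sym} (h : s ∈ g.args) : s.isWire = true := by
  cases g <;> simp only [Gate.args, List.mem_append] at h
  case cx => rcases h with h | h <;> exact mem_wire_code h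
  case ccx => rcases h with (h | h) | h <;> exact mem_wire_code h
  all_goals exact mem_wire_code h

theorem Gate.mem_code {g : Gate Wire} {s : Sym} (h : s ∈ g.code) : s ≠ .query ∧ s ≠ .fin := by
  rw [Gate.code_eq, List.mem_cons] at h
  rcases h with rfl | h
  · cases g <;> exact ⟨by simp [Gate.head], by simp [Gate.head]⟩
  · have := Gate.mem_args h
    constructor <;> rintro rfl <;> simp [Sym.isWire] at this

/-! ### The evaluation circuit -/

/-- The shift of the registers, on descriptions. -/
def evwSym (N : ℕ) (s : Sym) (t : List Sym) : List Sym :=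
  match s with
  | .out | .work | .ask | .ans => s :: tk N
  -- Register numbers are in unary, so the register is `0` exactly if the separator follows at once.
  -- Elsewhere, ticks inserted behind the kind add to the register number.
  | .inp => if t.head? = some .sep then [.inp] else .inp :: tk N
  | s => [s]

theorem scan_evwSym_wire (N : ℕ) (w : Wire) (l : List Sym) :
    scan (evwSym N) (w.code ++ l) = (evw N w).code ++ scan (evwSym N) l := by
  obtain ⟨k, r, p⟩ := w
  have h : scan (evwSym N) (unary r ++ unary p ++ l) = unary r ++ unary p ++ scan (evwSym N) l := by
    refine scan_self _ _ _ fun s hs t => ?_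
    simp only [unary, List.mem_append, List.mem_replicate, List.mem_cons, List.not_mem_nil,
      or_false] at hs
    rcases hs with (⟨_, rfl⟩ | rfl) | ⟨_, rfl⟩ | rfl <;> rfl
  have ht : unary (r + N) = tk N ++ unary r := by
    rw [unary_eq, unary_eq, Nat.add_comm, tk_add, List.append_assoc]
  rw [Wire.code, List.cons_append, scan, h]
  by_cases hk : k = .inp
  · subst hk
    cases r with
    | zero => simp [evw, evwSym, Kind.code, Wire.code, unary]
    | succ r =>
      have : evwSym N Kind.inp.code (unary (r + 1) ++ unary p ++ l) = .inp :: tk N := by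
        simp [evwSym, Kind.code, unary, List.replicate_succ]
      rw [this]
      simp [evw, Kind.code, Wire.code, ht]
  · have : evwSym N k.code (unary r ++ unary p ++ l) = k.code :: tk N := by
      cases k <;> first | exact absurd rfl hk | rfl
    rw [this]
    simp [evw, hk, Wire.code, ht]

theorem scan_evwSym (N : ℕ) (c : Circuit) :
    scan (evwSym N) (cdc c) = cdc (c.map (Gate.map (evw N))) := by
  induction c with
  | nil => rfl
  | cons g c ih =>
    rw [cdc_cons, List.map_cons, cdc_cons, ← ih]
    cases g <;>
      simp only [Gate.code, Gate.map, List.cons_append, List.append_assoc, scan, evwSym,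
        scan_evwSym_wire, List.nil_append]

theorem PT.evw {α : Type} {E : Env α} {c : α → Circuit} {N : α → ℕ}
    (hc : PT X E fun a => cdc (c a)) (hN : PT X E fun a => tk (N a)) :
    PT X E fun a => cdc ((c a).map (Gate.map (evw (N a)))) := by
  have hsep : ∀ {β : Type} {F : Env β} {y : β → List Sym}, PT X F y →
      PT X F fun b => if (y b).head? = some .sep then [] else [.tick] := fun hy =>
    recOn (fun _ t => if t.head? = some .sep then [] else [.tick]) hy (const [.tick])
      (g := fun s _ => if s = .sep then [] else [.tick]) (fun _ => const _) (fun _ => rfl)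
      (fun _ s t => by simp) (.const 1) fun a t _ => by split_ifs <;> simp
  refine (hc.scan (g := fun s a t => evwSym (N a) s t) fun s => ?_).congr fun a =>
    (scan_evwSym _ _).symm
  have hk : PT X E.recEnv fun p => s :: tk (N p.1) := hN.ctx.cons s
  have hi := ((hsep tl).ite_nil (const [.inp]) (hN.ctx.cons .inp)).congr
    (g := fun p => evwSym (N p.1) .inp p.2.1) fun p => by
      by_cases h : p.2.1.head? = some .sep <;> simp [evwSym, h]
  cases s
  case inp => exact hi
  case out => exact hk
  case work => exact hk
  case ask => exact hk
  case ans => exact hk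
  all_goals exact const _

/-- The first symbol of the inverse gate. -/
def Sym.inv : Sym → Sym
  | .t => .tdg
  | .tdg => .t
  | s => s

/-- The inverse circuit, on descriptions. -/
def invSym : List Sym → List Sym
  | [] => []
  | s :: t => if s.isGate then invSym t ++ s.inv :: t.takeWhile (fun s => s.isWire) else invSym t

theorem invSym_wire (w l : List Sym) (h : ∀ s ∈ w, s.isWire = true) :
    invSym (w ++ l) = invSym l := by
  induction w with
  | nil => rfl
  | cons s w ih =>
    have hs := h s List.mem_cons_self
    have : s.isGate = false := by cases s <;> first | rfl | simp [Sym.isWire] at hs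
    rw [List.cons_append, invSym, this]
    simpa using ih fun s hs => h s (List.mem_cons_of_mem _ hs)

/-- A gate description is a gate symbol followed by wire symbols only. So each gate symbol can
collect its wires by `takeWhile`, and placing it behind the image of the rest reverses the order of
the gates. -/
theorem invSym_cdc (c : Circuit) : invSym (cdc c) = cdc (invCircuit c) := by
  induction c with
  | nil => rfl
  | cons g c ih =>
    have h₁ : g.head.isGate = true := by cases g <;> rfl
    have h₂ : g.inv.code = g.head.inv :: g.args := by cases g <;> rfl
    have h₃ : (cdc c).takeWhile (fun s => s.isWire) = [] := by
      cases c with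
      | nil => rfl
      | cons g c => rw [cdc_cons, Gate.code_eq]; cases g <;> simp [Gate.head, Sym.isWire]
    rw [cdc_cons, Gate.code_eq, List.cons_append, invSym, h₁, if_pos rfl,
      invSym_wire _ _ (fun s hs => Gate.mem_args hs), ih,
      List.takeWhile_append_of_pos (fun s hs => Gate.mem_args hs), h₃]
    simp [invCircuit, h₂]

theorem PT.invCircuit {α : Type} {E : Env α} {c : α → Circuit} (hc : PT X E fun a => cdc (c a)) :
    PT X E fun a => cdc (invCircuit (c a)) := by
  -- Each symbol contributes at most one gate, no longer than what is left of the string. This crude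
  -- bound is all that bounded recursion needs.
  have hle : ∀ t, (invSym t).length ≤ t.length * t.length := fun t => by
    induction t with
    | nil => simp [invSym]
    | cons s t ih =>
      have := (List.takeWhile_prefix (l := t) fun s => s.isWire).length_le
      simp only [invSym]
      split_ifs
      · simp only [List.length_append, List.length_cons]
        nlinarith
      · simp only [List.length_cons]
        nlinarith
  have hl := hc.length_bound
  refine (recOn (fun _ t => invSym t) hc nil (g := fun s p => if s.isGate then
    p.2.2 ++ s.inv :: p.2.1.takeWhile (fun s => s.isWire) else p.2.2) (fun s => ?_)
    (fun _ => rfl) (fun _ _ _ => rfl) (hl.mul hl) fun a t ht => (hle t).trans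
      (Nat.mul_le_mul ht.length_le ht.length_le)).congr fun a => (invSym_cdc _).symm
  cases h : s.isGate
  · exact val
  · exact val.append ((tl.takeWhile _).cons _)

/-! ### The reduction on descriptions -/

namespace PT
variable {α : Type} {E : Env α}

theorem tabWire (k : Kind) {N L r i p : α → ℕ} (hN : PT X E fun a => tk (N a))
    (hL : PT X E fun a => tk (L a)) (hr : PT X E fun a => tk (r a)) (hi : PT X E fun a => tk (i a))
    (hp : PT X E fun a => tk (p a)) :
    PT X E fun a => (tabWire k (N a) (L a) (r a) (i a) (p a)).code :=
  wire k hr ((hN.add (hi.mul (hL.add (natConst 1)))).add hp)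

theorem fetch (k : Kind) {ev : α → Circuit} {N L r i : α → ℕ} (hev : PT X E fun a => cdc (ev a))
    (hN : PT X E fun a => tk (N a)) (hL : PT X E fun a => tk (L a))
    (hr : PT X E fun a => tk (r a)) (hi : PT X E fun a => tk (i a)) :
    PT X E fun a => cdc (fetch (ev a) (N a) (L a) (CopyProt.tabWire k (N a) (L a) (r a) (i a))) := by
  have ht := tabWire k hN.ctx hL.ctx hr.ctx hi.ctx tl.len
  have hcx := loopDown hL (f := fun a p => [.cx (CopyProt.tabWire k (N a) (L a) (r a) (i a) p)
    ⟨.inp, 1 + N a, p⟩]) (cx ht (wire .inp ((natConst 1).add hN.ctx) tl.len))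
  have hE := PT.evw hev hN
  exact (loopDown hL (f := fun a p => [.h (CopyProt.tabWire k (N a) (L a) (r a) (i a) p)])
    (h ht)).circuit_append (hcx.circuit_append (hE.circuit_append ((cx (wire .out hN (natConst 0))
      (tabWire k hN hL hr hi hL)).circuit_append ((PT.invCircuit hE).circuit_append hcx))))

theorem answer (k : Kind) {N L r i : α → ℕ} (hN : PT X E fun a => tk (N a))
    (hL : PT X E fun a => tk (L a)) (hr : PT X E fun a => tk (r a)) (hi : PT X E fun a => tk (i a)) :
    PT X E fun a => cdc (answer (L a) (CopyProt.tabWire k (N a) (L a) (r a) (i a))) :=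
  (loopDown (hL.add (natConst 1)) (f := fun a p =>
    [.cx (CopyProt.tabWire k (N a) (L a) (r a) (i a) p) ⟨.ans, 0, p⟩])
    (cx (tabWire k hN.ctx hL.ctx hr.ctx hi.ctx tl.len) (wire .ans (natConst 0) tl.len))).circuit_append
    (cx (w := fun _ => ⟨.ask, 0, 0⟩) (wire .ask (natConst 0) (natConst 0))
      (wire .ans (natConst 0) hL))

theorem count {f : α → List Sym} (hf : PT X E f) : PT X E fun a => tk ((f a).count .fin) :=
  (hf.scan (g := fun s _ _ => if s = .fin then [.tick] else []) fun _ => const _).congr fun a => by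
    induction f a with
    | nil => rfl
    | cons s l ih =>
      rw [CopyProt.scan, ← ih, List.count_cons]
      by_cases h : s = .fin
      · simp [h, tk, List.replicate_succ]
      · simp [h]

end PT

/-- The symbol `query` does not occur inside descriptions of gates, so a scan that treats it
separately acts gate by gate. What the scan sees behind a query is the rest of the circuit and `w`,
whose length is the number of that query. -/
theorem scan_expand (g : Sym → List Sym → List Sym) (e : Gate Wire → Circuit) (q : ℕ → Circuit)
    (w : List Sym) (hq : ∀ l : List OGate, g .query (l.flatMap OGate.code ++ w) =
      cdc (q (ix l + w.length)))
    (he : (∀ s, s ≠ .query → s ≠ .fin → ∀ t, g s t = [s]) ∧ e = (fun g => [g]) ∨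
      (∀ s, s ≠ .query → s ≠ .fin → ∀ t, g s t = []) ∧ e = fun _ => []) (l : List OGate) :
    scan g (l.flatMap OGate.code ++ w) = cdc (expand e q w.length l) ++ scan g w := by
  induction l with
  | nil => rfl
  | cons o l ih =>
    cases o with
    | query =>
      simp only [List.flatMap_cons, OGate.code, List.cons_append, List.nil_append, scan, expand,
        cdc_append, ih, hq, List.append_assoc]
    | gate o =>
      simp only [List.flatMap_cons, OGate.code, List.append_assoc, expand, cdc_append]
      rcases he with ⟨h, rfl⟩ | ⟨h, rfl⟩
      · rw [scan_self _ _ _ fun s hs => h s (Gate.mem_code hs).1 (Gate.mem_code hs).2, ih]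
        simp
      · rw [scan_drop _ _ _ fun s hs => h s (Gate.mem_code hs).1 (Gate.mem_code hs).2, ih]
        simp

theorem OGate.mem_code {o : OGate} {s : Sym} (h : s ∈ o.code) : s ≠ .fin := by
  cases o with
  | gate g => exact (Gate.mem_code h).2
  | query =>
    rw [OGate.code, List.mem_singleton] at h
    rw [h]
    simp

theorem count_gates (l : List OGate) : (l.flatMap OGate.code).count .fin = 0 := by
  rw [List.count_eq_zero, List.mem_flatMap]
  rintro ⟨o, _, h⟩
  exact OGate.mem_code h rfl

theorem count_free (l : List (List OGate)) :
    (listCode (listCode OGate.code) l).count .fin = l.length + 1 := by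
  induction l with
  | nil => rfl
  | cons o l ih =>
    simp only [listCode, List.flatMap_cons, List.append_assoc, List.count_append,
      count_gates] at ih ⊢
    simp at ih ⊢
    omega

/-- The preparation of the tables of the freeloaders, on descriptions; `n` is one more than the
number of freeloaders. -/
def fetchFreeSym (c : ℕ → ℕ → Circuit) (n : ℕ) (s : Sym) (t : List Sym) : List Sym :=
  if s = .query then cdc (c (n - t.count .fin) t.length) else []

/-- The end marks still ahead tell to which freeloader a position belongs: its own mark, one for
each later freeloader, and the mark of the list. Subtracting their number from `i + l.length + 1`
gives the index. -/
theorem scan_fetchFreeSym (c : ℕ → ℕ → Circuit) (i : ℕ) (l : List (List OGate)) :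
    scan (fetchFreeSym c (i + l.length + 1)) (listCode (listCode OGate.code) l) =
      cdc (fetchFree c i l) := by
  induction l generalizing i with
  | nil => rfl
  | cons o l ih =>
    have e : listCode (listCode OGate.code) (o :: l) =
        o.flatMap OGate.code ++ .fin :: listCode (listCode OGate.code) l := by simp [listCode]
    rw [e, scan_expand _ (fun _ => []) (c i), fetchFree, cdc_append]
    · congr 1
      have := ih (i + 1)
      rw [show i + 1 + l.length + 1 = i + (o :: l).length + 1 by simp; omega] at this
      rw [← this]
      rfl
    · intro l'
      simp only [fetchFreeSym, if_true, List.count_append, count_gates, List.count_cons_self,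
        count_free, List.length_append, ix]
      congr 2
      simp
    · exact .inr ⟨fun s h _ t => if_neg h, rfl⟩

/-- The freeloaders of the reduction, on descriptions. -/
def simFreeSym (N L : ℕ) (s : Sym) (t : List Sym) : List Sym :=
  if s = .query then cdc (answer L (tabWire .inp N L 0 t.length))
  else if s = .fin then
    -- With no end mark ahead, this is the mark of the whole list. With exactly one ahead, it ends
    -- the last freeloader, and no new guess is opened.
    if tk (t.count .fin) = [] then [.fin]
    else cdc (unguess N) ++ .fin :: if tk (t.count .fin - 1) = [] then [] else cdc (guessBit N L)
  else [s]

/-- The guess of a freeloader is emitted at the end mark of its predecessor. The first freeloader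
has none, which accounts for the separate initial `guessBit`. -/
theorem scan_simFreeSym (N L : ℕ) (l : List (List OGate)) :
    (if tk l.length = [] then [] else cdc (guessBit N L)) ++
      scan (simFreeSym N L) (listCode (listCode OGate.code) l) =
      listCode (listCode Gate.code) (simFree N L l) := by
  induction l with
  | nil => rfl
  | cons o l ih =>
    have e : listCode (listCode OGate.code) (o :: l) =
        o.flatMap OGate.code ++ .fin :: listCode (listCode OGate.code) l := by simp [listCode]
    have hN : ∀ n, tk (n + 1) ≠ [] := fun n => by simp [tk, List.replicate_succ]
    have hf : simFreeSym N L .fin (listCode (listCode OGate.code) l) = cdc (unguess N) ++ .fin ::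
        if tk l.length = [] then [] else cdc (guessBit N L) := by
      simp [simFreeSym, count_free, hN]
    rw [e, scan_expand _ (fun g => [g]) (fun i => answer L (tabWire .inp N L 0 i)), scan, hf]
    · simp only [List.length_cons, hN, if_false]
      have e' : ∀ (c : Circuit) r, listCode (listCode Gate.code) (c :: r) =
          cdc c ++ .fin :: listCode (listCode Gate.code) r := fun c r => by simp [listCode, cdc]
      rw [simFree, e', ← ih]
      simp only [cdc_append, List.append_assoc, ixFree, List.cons_append]
    · intro l'
      simp [simFreeSym, ix]
    · exact .inl ⟨fun s h h' t => by simp [simFreeSym, h, h'], rfl⟩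

theorem takeWhile_code (A : Adversary OGate) :
    (A.code OGate.code).takeWhile (fun s => s ≠ .fin) = A.pirate.flatMap OGate.code := by
  rw [Adversary.code, listCode, List.append_assoc, List.takeWhile_append_of_pos]
  · simp
  · intro s hs
    obtain ⟨o, _, h⟩ := List.mem_flatMap.1 hs
    simpa using OGate.mem_code h

theorem afterFin_code (A : Adversary OGate) :
    afterFin (A.code OGate.code) = listCode (listCode OGate.code) A.free := by
  have h : ∀ w l : List Sym, (∀ s ∈ w, s ≠ .fin) → afterFin (w ++ .fin :: l) = l := fun w l => by
    induction w with
    | nil => intro _; rfl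
    | cons s w ih =>
      intro h
      have hs := h s List.mem_cons_self
      have := ih fun s hs => h s (List.mem_cons_of_mem _ hs)
      cases s <;> first | exact (hs rfl).elim | exact this
  rw [Adversary.code, listCode, List.append_assoc]
  refine h _ _ fun s hs => ?_
  obtain ⟨o, _, h⟩ := List.mem_flatMap.1 hs
  exact OGate.mem_code h

/-- A number that exceeds all register and qubit numbers. -/
def shiftNo (ev : Circuit) (A : Adversary OGate) (c : ℕ) : ℕ :=
  (A.code OGate.code).length + (listCode Gate.code ev).length + c

/-- Each component of the reduction is a scan of the description of the pirate or of the
freeloaders. The shift is a sum of lengths of descriptions and a polynomial, so it is computable in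
unary as well. -/
theorem PT.adversary {A : ℕ → Adversary OGate} {ev : ℕ → Circuit} (len P : Polynomial ℕ)
    (hA : PT X natEnv fun κ => (A κ).code OGate.code)
    (hev : PT X natEnv fun κ => listCode Gate.code (ev κ)) :
    PT X natEnv fun κ => (reduction (ev κ) (shiftNo (ev κ) (A κ) (P.eval κ)) (len.eval κ)
      (A κ)).code Gate.code := by
  set N : ℕ → ℕ := fun κ => shiftNo (ev κ) (A κ) (P.eval κ)
  set L : ℕ → ℕ := fun κ => len.eval κ
  have hN : PT X natEnv fun κ => tk (N κ) := (hA.len.add hev.len).add (PT.self.eval P)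
  have hL : PT X natEnv fun κ => tk (L κ) := PT.self.eval len
  have hE : PT X natEnv fun κ => cdc (ev κ) :=
    (hev.takeWhile fun s => s ≠ .fin).congr fun κ => by
      rw [listCode, List.takeWhile_append_of_pos]
      · simp [cdc]
      · intro s hs
        obtain ⟨o, _, h⟩ := List.mem_flatMap.1 hs
        simpa using (Gate.mem_code h).2
  have hp := (hA.takeWhile fun s => s ≠ .fin).congr fun κ => (takeWhile_code (A κ)).symm
  have hf := hA.afterFin.congr fun κ => (afterFin_code (A κ)).symm
  have hl : PT X natEnv fun κ => tk (A κ).free.length :=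
    (hf.count.sub (PT.natConst 1)).congr fun κ => by rw [count_free]; rfl
  have h₁ : PT X natEnv fun κ => cdc (expand (fun _ => [])
      (fun i => CopyProt.fetch (ev κ) (N κ) (L κ) (CopyProt.tabWire .ans (N κ) (L κ) 0 i)) 0 (A κ).pirate) := by
    refine (hp.scan (g := fun s κ t => if s = .query then
      cdc (CopyProt.fetch (ev κ) (N κ) (L κ) (CopyProt.tabWire .ans (N κ) (L κ) 0 t.length)) else [])
      fun s => ?_).congr fun κ => ?_
    · by_cases h : s = .query
      · simpa [h] using PT.fetch .ans hE.ctx hN.ctx hL.ctx (PT.natConst 0) PT.tl.len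
      · simpa [h] using PT.nil
    · have := scan_expand (fun s t => if s = .query then
        cdc (CopyProt.fetch (ev κ) (N κ) (L κ) (CopyProt.tabWire .ans (N κ) (L κ) 0 t.length)) else [])
        (fun _ => []) (fun i => CopyProt.fetch (ev κ) (N κ) (L κ) (CopyProt.tabWire .ans (N κ) (L κ) 0 i)) []
        (fun l => by simp [ix]) (.inr ⟨fun s h _ t => if_neg h, rfl⟩) (A κ).pirate
      simpa [CopyProt.scan] using this.symm
  have h₂ : PT X natEnv fun κ => cdc (fetchFree
      (fun r i => CopyProt.fetch (ev κ) (N κ) (L κ) (CopyProt.tabWire .out (N κ) (L κ) r i)) 0 (A κ).free) := by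
    refine (hf.scan (g := fun s κ t => fetchFreeSym (fun r i => CopyProt.fetch (ev κ) (N κ) (L κ)
      (CopyProt.tabWire .out (N κ) (L κ) r i)) (0 + (A κ).free.length + 1) s t) fun s => ?_).congr
      fun κ => (scan_fetchFreeSym _ _ _).symm
    by_cases h : s = .query
    · simpa [h, fetchFreeSym] using PT.fetch .out hE.ctx hN.ctx hL.ctx
        ((((PT.natConst 0).add hl.ctx).add (PT.natConst 1)).sub PT.tl.count) PT.tl.len
    · simpa [h, fetchFreeSym] using PT.nil
  have h₃ : PT X natEnv fun κ => cdc (expand (fun g => [g])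
      (fun i => CopyProt.answer (L κ) (CopyProt.tabWire .ans (N κ) (L κ) 0 i)) 0 (A κ).pirate) := by
    refine (hp.scan (g := fun s κ t => if s = .query then
      cdc (CopyProt.answer (L κ) (CopyProt.tabWire .ans (N κ) (L κ) 0 t.length)) else [s])
      fun s => ?_).congr fun κ => ?_
    · by_cases h : s = .query
      · simpa [h] using PT.answer .ans hN.ctx hL.ctx (PT.natConst 0) PT.tl.len
      · simpa [h] using PT.const [s]
    · have := scan_expand (fun s t => if s = .query then
        cdc (CopyProt.answer (L κ) (CopyProt.tabWire .ans (N κ) (L κ) 0 t.length)) else [s])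
        (fun g => [g]) (fun i => CopyProt.answer (L κ) (CopyProt.tabWire .ans (N κ) (L κ) 0 i)) []
        (fun l => by simp [ix]) (.inl ⟨fun s h _ t => if_neg h, rfl⟩) (A κ).pirate
      simpa [CopyProt.scan] using this.symm
  have hw : PT X natEnv fun κ => (⟨.work, N κ, 0⟩ : Wire).code := .wire .work hN (.natConst 0)
  have hg : PT X natEnv fun κ => cdc (guessBit (N κ) (L κ)) :=
    ((PT.h hw).circuit_append (PT.cx hw (.wire .inp (.natConst 1) hL))).congr fun _ => rfl
  have hu : PT X natEnv fun κ => cdc (unguess (N κ)) := PT.cx hw (.const _)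
  have h₄ : PT X natEnv fun κ => listCode (listCode Gate.code) (simFree (N κ) (L κ) (A κ).free) := by
    refine ((hl.ite_nil .nil hg).append (hf.scan (g := fun s κ t => simFreeSym (N κ) (L κ) s t)
      fun s => ?_)).congr fun κ => (scan_simFreeSym _ _ _).symm
    by_cases h : s = .query
    · simpa [h, simFreeSym] using PT.answer .inp hN.ctx hL.ctx (PT.natConst 0) PT.tl.len
    · by_cases h' : s = .fin
      · have := PT.tl.count.ite_nil (.const [.fin]) (hu.ctx.append
          (((PT.tl.count.sub (.natConst 1)).ite_nil .nil hg.ctx).cons .fin))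
        refine this.congr fun p => ?_
        simp only [simFreeSym, h', if_true]
        rfl
      · simpa [h, h', simFreeSym] using PT.const [s]
  exact (((h₁.circuit_append (h₂.circuit_append h₃)).append (.const [.fin])).append h₄).congr
    fun κ => rfl

theorem reduction_uniform {A : ℕ → Adversary OGate} {ev : ℕ → Circuit} (len P : Polynomial ℕ)
    (hA : Uniform (Adversary.code OGate.code) A) (hev : QPT ev) :
    Uniform (Adversary.code Gate.code) fun κ =>
      reduction (ev κ) (shiftNo (ev κ) (A κ) (P.eval κ)) (len.eval κ) (A κ) := by
  obtain ⟨c⟩ := hA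
  obtain ⟨d⟩ := hev
  -- The two given Turing machines are run inside one stack machine, so their alphabets are put side
  -- by side.
  exact PT.uniform (X := (Σ k, c.tm.Γ k) ⊕ Σ k, d.tm.Γ k)
    (.adversary len P (.ofUniform c .inl) (.ofUniform d .inr))

/-! ## Gates as linear maps -/

section Gates
variable {W : Type}

/-- The wires of a gate. -/
def Gate.wires : Gate W → List W
  | .x w | .h w | .t w | .tdg w => [w]
  | .cx c w => [c, w]
  | .ccx c₁ c₂ w => [c₁, c₂, w]

/-- The wire on which a gate acts. -/
def Gate.tgt : Gate W → W
  | .x w | .h w | .t w | .tdg w | .cx _ w | .ccx _ _ w => w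

theorem Gate.tgt_mem (g : Gate W) : g.tgt ∈ g.wires := by
  cases g <;> simp [tgt, wires]

theorem Gate.wires_map {V : Type} (f : W → V) (g : Gate W) : (g.map f).wires = g.wires.map f := by
  cases g <;> rfl

theorem Gate.tgt_map {V : Type} (f : W → V) (g : Gate W) : (g.map f).tgt = f g.tgt := by
  cases g <;> rfl

theorem Gate.tgt_inv (g : Gate W) : g.inv.tgt = g.tgt := by
  cases g <;> rfl

theorem Gate.wires_inv (g : Gate W) : g.inv.wires = g.wires := by
  cases g <;> rfl

theorem ket_self (s : Finset W) : ket s s = 1 := Finsupp.single_eq_same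

theorem ket_of_ne {s t : Finset W} (h : s ≠ t) : ket s t = 0 := Finsupp.single_eq_of_ne' h

/-- Linear maps are determined by the images of the basis states. -/
theorem linear_ext {M : Type} [AddCommMonoid M] [Module ℂ M] {f g : State W →ₗ[ℂ] M}
    (h : ∀ s, f (ket s) = g (ket s)) : f = g :=
  Finsupp.lhom_ext' fun s => LinearMap.ext_ring (h s)

theorem expect_eq_sum {ψ : State W} {T : Finset (Finset W)} (h : ψ.support ⊆ T)
    (v : Finset W → ℝ) : expect ψ v = ∑ s ∈ T, ‖ψ s‖ ^ 2 * v s :=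
  Finsupp.sum_of_support_subset _ h _ fun _ _ => by simp

variable [DecidableEq W]

/-- Toggle one wire. -/
def toggle (s : Finset W) (w : W) : Finset W := symmDiff s {w}

theorem mem_toggle {s : Finset W} {w v : W} : v ∈ toggle s w ↔ (v ∈ s ↔ v ≠ w) := by
  by_cases h : v = w <;> simp [toggle, Finset.mem_symmDiff, h]

theorem toggle_toggle (s : Finset W) (w : W) : toggle (toggle s w) w = s := by
  simp [toggle]

theorem toggle_comm (s : Finset W) (v w : W) : toggle (toggle s w) v = toggle (toggle s v) w := by
  simp [toggle, symmDiff_right_comm]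

theorem toggle_inj {s t : Finset W} {w : W} : toggle s w = toggle t w ↔ s = t :=
  ⟨fun h => by rw [← toggle_toggle s w, h, toggle_toggle], fun h => by rw [h]⟩

/-- The matrix entries of a gate: the diagonal ones, and those for toggling the target. -/
def Gate.entries (s : Finset W) : Gate W → ℂ × ℂ
  | .x _ => (0, 1)
  | .h w => ((if w ∈ s then -((1 / Real.sqrt 2 : ℝ) : ℂ) else ((1 / Real.sqrt 2 : ℝ) : ℂ)),
      ((1 / Real.sqrt 2 : ℝ) : ℂ))
  | .t w => (if w ∈ s then Complex.exp (Complex.I * (Real.pi / 4)) else 1, 0)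
  | .tdg w => (if w ∈ s then Complex.exp (-(Complex.I * (Real.pi / 4))) else 1, 0)
  | .cx c w => if c ≠ w ∧ c ∈ s then (0, 1) else (1, 0)
  | .ccx c₁ c₂ w => if c₁ ≠ w ∧ c₂ ≠ w ∧ c₁ ∈ s ∧ c₂ ∈ s then (0, 1) else (1, 0)

def Gate.diag (g : Gate W) (s : Finset W) : ℂ := (g.entries s).1

def Gate.off (g : Gate W) (s : Finset W) : ℂ := (g.entries s).2

theorem toggle_of_mem {s : Finset W} {w : W} (h : w ∈ s) : toggle s w = s.erase w := by
  ext v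
  rw [mem_toggle, Finset.mem_erase]
  by_cases hv : v = w <;> simp [hv, h]

theorem toggle_of_notMem {s : Finset W} {w : W} (h : w ∉ s) : toggle s w = insert w s := by
  ext v
  rw [mem_toggle, Finset.mem_insert]
  by_cases hv : v = w <;> simp [hv, h]

theorem Gate.onKet_h_of_mem {s : Finset W} {w : W} (h : w ∈ s) : (Gate.h w).onKet s =
    ((1 / Real.sqrt 2 : ℝ) : ℂ) • ket (toggle s w) + (-((1 / Real.sqrt 2 : ℝ) : ℂ)) • ket s := by
  simp [onKet, h, toggle_of_mem h]

theorem Gate.onKet_h_of_notMem {s : Finset W} {w : W} (h : w ∉ s) : (Gate.h w).onKet s =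
    ((1 / Real.sqrt 2 : ℝ) : ℂ) • ket s + ((1 / Real.sqrt 2 : ℝ) : ℂ) • ket (toggle s w) := by
  simp [onKet, h, toggle_of_notMem h]

/-- A common normal form: each gate mixes a basis state only with the one in which its target is
toggled. Commutation, inversion and unitarity then become identities between two coefficients. -/
theorem Gate.onKet_eq (g : Gate W) (s : Finset W) :
    g.onKet s = g.diag s • ket s + g.off s • ket (toggle s g.tgt) := by
  cases g with
  | h w =>
    by_cases h : w ∈ s
    · simp only [onKet_h_of_mem h, diag, off, entries, h, tgt, if_true, add_comm]
    · simp only [onKet_h_of_notMem h, diag, off, entries, h, tgt, if_false]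
  | x w => simp [onKet, tgt, toggle, diag, off, entries]
  | t w => simp [onKet, diag, off, entries]
  | tdg w => simp [onKet, diag, off, entries]
  | cx c w =>
    simp only [onKet, toggle, tgt, diag, off, entries]
    split_ifs <;> simp
  | ccx c d w =>
    simp only [onKet, toggle, tgt, diag, off, entries]
    split_ifs <;> simp

/-- The matrix entries depend only on the wires of the gate. -/
theorem Gate.entries_toggle {g : Gate W} {w : W} (h : w ∉ g.wires) (s : Finset W) :
    g.diag (toggle s w) = g.diag s ∧ g.off (toggle s w) = g.off s := by
  have hm : ∀ v ∈ g.wires, (v ∈ toggle s w ↔ v ∈ s) := fun v hv => by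
    have : v ≠ w := fun e => h (e ▸ hv)
    simp [mem_toggle, this]
  cases g <;> simp_all [wires, diag, off, entries]

/-- The linear map of a gate. -/
def Gate.op (g : Gate W) : State W →ₗ[ℂ] State W := Finsupp.linearCombination ℂ g.onKet

theorem Gate.apply_eq (g : Gate W) (ψ : State W) : g.apply ψ = g.op ψ :=
  (Finsupp.linearCombination_apply ℂ ψ).symm

theorem Gate.op_ket (g : Gate W) (s : Finset W) :
    g.op (ket s) = g.diag s • ket s + g.off s • ket (toggle s g.tgt) := by
  rw [← onKet_eq, op, ket, Finsupp.linearCombination_single, one_smul]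

theorem Gate.op_apply (g : Gate W) (ψ : State W) (s : Finset W) :
    g.op ψ s = g.diag s * ψ s + g.off (toggle s g.tgt) * ψ (toggle s g.tgt) := by
  have : (Finsupp.lapply s).comp g.op = g.diag s • Finsupp.lapply s +
      g.off (toggle s g.tgt) • (Finsupp.lapply (toggle s g.tgt) : State W →ₗ[ℂ] ℂ) := by
    refine linear_ext fun t => ?_
    simp only [LinearMap.comp_apply, op_ket, map_add, map_smul, Finsupp.lapply_apply,
      LinearMap.add_apply, LinearMap.smul_apply, smul_eq_mul]
    congr 1
    · by_cases h : t = s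
      · rw [h]
      · simp [ket_of_ne h]
    · by_cases h : t = toggle s g.tgt
      · rw [h, toggle_toggle, ket_self, ket_self]
      · rw [ket_of_ne h, ket_of_ne fun e => h (by rw [← e, toggle_toggle])]
        simp
  exact LinearMap.congr_fun this ψ

/-- Toggling the target of one gate does not affect the coefficients of the other, so the two
products have the same four terms. -/
theorem Gate.apply_comm {g k : Gate W} (h : ∀ w ∈ g.wires, w ∉ k.wires) (ψ : State W) :
    g.apply (k.apply ψ) = k.apply (g.apply ψ) := by
  simp only [apply_eq]
  have : g.op.comp k.op = k.op.comp g.op := by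
    refine linear_ext fun s => ?_
    have h₁ := k.entries_toggle (h _ g.tgt_mem) s
    have h₂ := g.entries_toggle (fun e => h _ e k.tgt_mem) s
    simp only [LinearMap.comp_apply, op_ket, map_add, map_smul, smul_add, smul_smul, h₁, h₂,
      toggle_comm s g.tgt k.tgt, mul_comm (k.diag s), mul_comm (k.off s)]
    abel
  exact LinearMap.congr_fun this ψ

theorem Gate.inv_apply (g : Gate W) (ψ : State W) : g.inv.apply (g.apply ψ) = ψ := by
  simp only [apply_eq]
  have : g.inv.op.comp g.op = LinearMap.id := by
    refine linear_ext fun s => ?_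
    simp only [LinearMap.comp_apply, op_ket, map_add, map_smul, smul_add, smul_smul, g.tgt_inv,
      toggle_toggle, LinearMap.id_apply]
    have h2 : ((1 / Real.sqrt 2 : ℝ) : ℂ) * ((1 / Real.sqrt 2 : ℝ) : ℂ) = 1 / 2 := by
      rw [← Complex.ofReal_mul, div_mul_div_comm, Real.mul_self_sqrt (by norm_num)]
      norm_num
    -- The coefficient of `ket s` must be one, and that of the toggled state, in `h₂`, must vanish.
    have h₁ : g.diag s * g.inv.diag s + g.off s * g.inv.off (toggle s g.tgt) = 1 := by
      simp only [diag, off]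
      cases g with
      | h w => by_cases h : w ∈ s <;> simp only [entries, inv, h, if_true, if_false, neg_mul_neg, h2] <;> norm_num
      | t w => by_cases h : w ∈ s <;> simp [entries, inv, h, ← Complex.exp_add]
      | tdg w => by_cases h : w ∈ s <;> simp [entries, inv, h, ← Complex.exp_add]
      | x w => simp [entries, inv]
      | cx c w =>
        by_cases h : c ≠ w ∧ c ∈ s
        · simp [entries, inv, h, mem_toggle, tgt]
        · simp only [entries, inv, h, if_false]; simp
      | ccx c d w =>
        by_cases h : c ≠ w ∧ d ≠ w ∧ c ∈ s ∧ d ∈ s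
        · simp [entries, inv, h, mem_toggle, tgt]
        · simp only [entries, inv, h, if_false]; simp
    have h₂ : g.diag s * g.inv.off s + g.off s * g.inv.diag (toggle s g.tgt) = 0 := by
      simp only [diag, off]
      cases g with
      | h w => by_cases h : w ∈ s <;> simp [entries, inv, h, mem_toggle, tgt]
      | t w => simp [entries, inv]
      | tdg w => simp [entries, inv]
      | x w => simp [entries, inv]
      | cx c w =>
        by_cases h : c ≠ w ∧ c ∈ s
        · simp [entries, inv, h, mem_toggle, tgt]
        · simp only [entries, inv, h, if_false]; simp
      | ccx c d w =>
        by_cases h : c ≠ w ∧ d ≠ w ∧ c ∈ s ∧ d ∈ s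
        · simp [entries, inv, h, mem_toggle, tgt]
        · simp only [entries, inv, h, if_false]; simp
    calc _ = (g.diag s * g.inv.diag s + g.off s * g.inv.off (toggle s g.tgt)) • ket s +
        (g.diag s * g.inv.off s + g.off s * g.inv.diag (toggle s g.tgt)) • ket (toggle s g.tgt) := by
          simp only [add_smul]; abel
      _ = ket s := by simp [h₁, h₂]
  exact LinearMap.congr_fun this ψ

/-- A gate does not change the expectation of a quantity that does not depend on its target. -/
theorem Gate.expect_apply (g : Gate W) (ψ : State W) {v : Finset W → ℝ}
    (hv : ∀ s, v (toggle s g.tgt) = v s) : expect (g.apply ψ) v = expect ψ v := by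
  rw [apply_eq]
  set w := g.tgt with hw
  -- A finite set that contains both supports and is closed under toggling, so that sums over it can
  -- be reindexed by the toggle.
  set T : Finset (Finset W) := ψ.support ∪ ψ.support.image fun s => toggle s w with hT
  have hTf : ∀ s ∈ T, toggle s w ∈ T := fun s hs => by
    rw [hT, Finset.mem_union, Finset.mem_image] at hs ⊢
    rcases hs with hs | ⟨t, ht, rfl⟩
    · exact .inr ⟨s, hs, rfl⟩
    · exact .inl (by rwa [toggle_toggle])
  have hsum : ∀ F : Finset W → ℝ, ∑ s ∈ T, F (toggle s w) = ∑ s ∈ T, F s := fun F =>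
    Finset.sum_nbij' (fun s => toggle s w) (fun s => toggle s w) hTf hTf
      (fun s _ => toggle_toggle s w) (fun s _ => toggle_toggle s w) fun _ _ => rfl
  have h₁ : (g.op ψ).support ⊆ T := fun s hs => by
    rw [Finsupp.mem_support_iff, op_apply] at hs
    by_contra hn
    have h1 : ψ s = 0 := by
      by_contra h; exact hn (Finset.mem_union_left _ (Finsupp.mem_support_iff.2 h))
    have h2 : ψ (toggle s w) = 0 := by
      by_contra h
      exact hn (Finset.mem_union_right _ (Finset.mem_image.2
        ⟨_, Finsupp.mem_support_iff.2 h, toggle_toggle _ _⟩))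
    exact hs (by simp [h1, ← hw, h2])
  rw [expect_eq_sum h₁, expect_eq_sum (T := T) Finset.subset_union_left]
  -- The interference term of the squared modulus. By orthogonality of the columns (`hc`) it changes
  -- sign under the toggle, while `v` does not, so it cancels in the sum. The other terms add up by
  -- normalization of the columns (`hn`).
  set C : Finset W → ℝ := fun s =>
    2 * ((g.diag s * ψ s) * (starRingEnd ℂ) (g.off (toggle s w) * ψ (toggle s w))).re with hC
  have hr : ‖((1 / Real.sqrt 2 : ℝ) : ℂ)‖ ^ 2 = 1 / 2 := by
    rw [Complex.norm_real, Real.norm_eq_abs, sq_abs, div_pow, Real.sq_sqrt] <;> norm_num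
  have hn : ∀ s, ‖g.diag s‖ ^ 2 + ‖g.off s‖ ^ 2 = 1 := fun s => by
    simp only [diag, off]
    cases g with
    | h w' =>
      by_cases h : w' ∈ s <;> simp only [entries, h, if_true, if_false, norm_neg, hr] <;> norm_num
    | t w' => by_cases h : w' ∈ s <;> simp [entries, h, Complex.norm_exp]
    | tdg w' => by_cases h : w' ∈ s <;> simp [entries, h, Complex.norm_exp]
    | x w' => simp [entries]
    | cx c w' =>
      simp only [entries]
      split_ifs <;> simp
    | ccx c d w' =>
      simp only [entries]
      split_ifs <;> simp
  have hc : ∀ s, g.diag s * (starRingEnd ℂ) (g.off (toggle s w)) =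
      - (starRingEnd ℂ) (g.diag (toggle s w) * (starRingEnd ℂ) (g.off s)) := fun s => by
    simp only [diag, off]
    cases g with
    | h w' =>
      by_cases h : w' ∈ s <;> simp [entries, h, mem_toggle, hw, tgt]
    | t w' => simp [entries]
    | tdg w' => simp [entries]
    | x w' => simp [entries]
    | cx c w' =>
      by_cases h : c ≠ w' ∧ c ∈ s
      · simp [entries, h, mem_toggle, hw, tgt]
      · have h' : ¬ (c ≠ w' ∧ c ∈ toggle s w) := fun h' => h ⟨h'.1, by
          have := mem_toggle.1 h'.2; simp only [hw, tgt] at this; exact this.2 h'.1⟩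
        simp only [entries, h, h', if_false]; simp
    | ccx c d w' =>
      by_cases h : c ≠ w' ∧ d ≠ w' ∧ c ∈ s ∧ d ∈ s
      · simp [entries, h, mem_toggle, hw, tgt]
      · have h' : ¬ (c ≠ w' ∧ d ≠ w' ∧ c ∈ toggle s w ∧ d ∈ toggle s w) := fun h' =>
          h ⟨h'.1, h'.2.1, (mem_toggle.1 h'.2.2.1).2 h'.1, (mem_toggle.1 h'.2.2.2).2 h'.2.1⟩
        simp only [entries, h, h', if_false]; simp
  have hCf : ∀ s, C (toggle s w) = - C s := fun s => by
    simp only [hC, toggle_toggle, map_mul]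
    have h1 : g.diag s * ψ s * ((starRingEnd ℂ) (g.off (toggle s w)) *
        (starRingEnd ℂ) (ψ (toggle s w))) =
        (g.diag s * (starRingEnd ℂ) (g.off (toggle s w))) * (ψ s * (starRingEnd ℂ) (ψ (toggle s w))) := by
      ring
    have h2 : g.diag (toggle s w) * ψ (toggle s w) * ((starRingEnd ℂ) (g.off s) *
        (starRingEnd ℂ) (ψ s)) = (starRingEnd ℂ) ((starRingEnd ℂ)
        (g.diag (toggle s w) * (starRingEnd ℂ) (g.off s)) *
          (ψ s * (starRingEnd ℂ) (ψ (toggle s w)))) := by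
      simp only [map_mul, Complex.conj_conj]
      ring
    rw [h1, hc, h2, Complex.conj_re, neg_mul, Complex.neg_re]
    ring
  have h0 : ∑ s ∈ T, C s * v s = 0 := by
    have := hsum fun s => C s * v s
    simp only [hCf, hv, neg_mul, Finset.sum_neg_distrib] at this
    linarith
  calc ∑ s ∈ T, ‖g.op ψ s‖ ^ 2 * v s
      = ∑ s ∈ T, (‖g.diag s‖ ^ 2 * ‖ψ s‖ ^ 2 * v s +
          ‖g.off (toggle s w)‖ ^ 2 * ‖ψ (toggle s w)‖ ^ 2 * v (toggle s w) + C s * v s) := by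
        refine Finset.sum_congr rfl fun s _ => ?_
        rw [op_apply, ← hw, hv, ← Complex.normSq_eq_norm_sq, Complex.normSq_add,
          Complex.normSq_mul, Complex.normSq_mul, hC]
        simp only [← Complex.normSq_eq_norm_sq]
        ring
    _ = ∑ s ∈ T, ‖g.diag s‖ ^ 2 * ‖ψ s‖ ^ 2 * v s +
          ∑ s ∈ T, ‖g.off s‖ ^ 2 * ‖ψ s‖ ^ 2 * v s := by
        rw [Finset.sum_add_distrib, h0, add_zero, Finset.sum_add_distrib,
          hsum fun s => ‖g.off s‖ ^ 2 * ‖ψ s‖ ^ 2 * v s]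
    _ = ∑ s ∈ T, ‖ψ s‖ ^ 2 * v s := by
        rw [← Finset.sum_add_distrib]
        refine Finset.sum_congr rfl fun s _ => ?_
        linear_combination (‖ψ s‖ ^ 2 * v s) * hn s

end Gates

/-! ## Running circuits -/

section Circuits
variable {W : Type}

/-- The wires of a circuit. -/
def cwires (c : List (Gate W)) : List W := c.flatMap Gate.wires

theorem mem_cwires {c : List (Gate W)} {w : W} : w ∈ cwires c ↔ ∃ g ∈ c, w ∈ g.wires :=
  List.mem_flatMap

theorem cwires_append (c d : List (Gate W)) : cwires (c ++ d) = cwires c ++ cwires d :=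
  List.flatMap_append

theorem cwires_invCircuit {c : List (Gate W)} {w : W} (h : w ∈ cwires (invCircuit c)) :
    w ∈ cwires c := by
  obtain ⟨g, hg, hw⟩ := mem_cwires.1 h
  rw [invCircuit, List.mem_reverse, List.mem_map] at hg
  obtain ⟨k, hk, rfl⟩ := hg
  exact mem_cwires.2 ⟨k, hk, by rwa [k.wires_inv] at hw⟩

theorem tgt_ne_of_notMem {c : List (Gate W)} {w : W} (h : w ∉ cwires c) : ∀ g ∈ c, g.tgt ≠ w :=
  fun g hg e => h (mem_cwires.2 ⟨g, hg, e ▸ g.tgt_mem⟩)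

/-- Write the bits `u 0`, …, `u (L - 1)` to the wires `t 0`, …, `t (L - 1)`. -/
def write (t : ℕ → W) (L : ℕ) (u : ℕ → Bool) : List (Gate W) :=
  loopDown L fun p => if u p then [.x (t p)] else []

theorem mem_loopDown {α : Type} {n : ℕ} {f : ℕ → List α} {a : α} (h : a ∈ loopDown n f) :
    ∃ p < n, a ∈ f p := by
  induction n with
  | zero => simp [loopDown] at h
  | succ n ih =>
    rw [loopDown, List.mem_append] at h
    rcases h with h | h
    · exact ⟨n, n.lt_succ_self, h⟩
    · obtain ⟨p, hp, h⟩ := ih h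
      exact ⟨p, hp.trans n.lt_succ_self, h⟩

theorem mem_write {t : ℕ → W} {L : ℕ} {u : ℕ → Bool} {g : Gate W} (h : g ∈ write t L u) :
    ∃ p < L, g = .x (t p) := by
  obtain ⟨p, hp, h⟩ := mem_loopDown h
  by_cases hu : u p <;> simp [hu] at h
  exact ⟨p, hp, h⟩

theorem mem_cwires_write {t : ℕ → W} {L : ℕ} {u : ℕ → Bool} {w : W}
    (h : w ∈ cwires (write t L u)) : ∃ p < L, w = t p := by
  obtain ⟨g, hg, hw⟩ := mem_cwires.1 h
  obtain ⟨p, hp, rfl⟩ := mem_write hg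
  exact ⟨p, hp, by simpa [Gate.wires] using hw⟩

theorem write_congr {t : ℕ → W} {L : ℕ} {u u' : ℕ → Bool} (h : ∀ p < L, u p = u' p) :
    write t L u = write t L u' := by
  induction L with
  | zero => rfl
  | succ L ih =>
    rw [write, loopDown, ← write, ih fun p hp => h p (hp.trans L.lt_succ_self), write,
      h L L.lt_succ_self]
    rfl

/-- The bits `r`, followed by `a`. -/
def ent {L : ℕ} (r : Fin L → Bool) (a : Bool) (p : ℕ) : Bool :=
  if h : p < L then r ⟨p, h⟩ else a

theorem ent_self {L : ℕ} (r : Fin L → Bool) (a : Bool) : ent r a L = a := by simp [ent]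

theorem ent_congr {L : ℕ} (r : Fin L → Bool) (a b : Bool) {p : ℕ} (h : p < L) :
    ent r a p = ent r b p := by simp [ent, h]

variable [DecidableEq W]

theorem run_nil (ψ : State W) : run [] ψ = ψ := rfl

theorem run_cons (g : Gate W) (c : List (Gate W)) (ψ : State W) :
    run (g :: c) ψ = run c (g.apply ψ) := rfl

theorem run_append (c d : List (Gate W)) (ψ : State W) : run (c ++ d) ψ = run d (run c ψ) :=
  List.foldl_append

/-- The linear map of a circuit. -/
def runOp (c : List (Gate W)) : State W →ₗ[ℂ] State W :=
  c.foldl (fun f g => g.op.comp f) LinearMap.id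

theorem run_eq (c : List (Gate W)) (ψ : State W) : run c ψ = runOp c ψ := by
  have : ∀ (f : State W →ₗ[ℂ] State W), run c (f ψ) = c.foldl (fun f g => g.op.comp f) f ψ := by
    induction c with
    | nil => exact fun f => rfl
    | cons g c ih => exact fun f => by rw [run_cons, g.apply_eq]; exact ih (g.op.comp f)
  exact this LinearMap.id

theorem run_apply_comm {c : List (Gate W)} {g : Gate W} (h : ∀ w ∈ g.wires, w ∉ cwires c)
    (ψ : State W) : run c (g.apply ψ) = g.apply (run c ψ) := by
  induction c generalizing ψ with
  | nil => rfl
  | cons k c ih =>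
    rw [run_cons, run_cons, ← Gate.apply_comm, ih]
    · exact fun w hw h' => h w hw (mem_cwires.2 (by
        obtain ⟨k', hk, hw⟩ := mem_cwires.1 h'; exact ⟨k', List.mem_cons_of_mem _ hk, hw⟩))
    · exact fun w hw h' => h w hw (mem_cwires.2 ⟨k, List.mem_cons_self, h'⟩)

theorem run_comm {c d : List (Gate W)} (h : ∀ w ∈ cwires d, w ∉ cwires c) (ψ : State W) :
    run c (run d ψ) = run d (run c ψ) := by
  induction d generalizing ψ with
  | nil => rfl
  | cons g d ih =>
    rw [run_cons, run_cons, ih, run_apply_comm]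
    · exact fun w hw => h w (mem_cwires.2 ⟨g, List.mem_cons_self, hw⟩)
    · exact fun w hw => h w (by
        obtain ⟨k, hk, hw⟩ := mem_cwires.1 hw
        exact mem_cwires.2 ⟨k, List.mem_cons_of_mem _ hk, hw⟩)

theorem run_invCircuit (c : List (Gate W)) (ψ : State W) : run (invCircuit c) (run c ψ) = ψ := by
  induction c generalizing ψ with
  | nil => rfl
  | cons g c ih =>
    have : invCircuit (g :: c) = invCircuit c ++ [g.inv] := by simp [invCircuit]
    rw [this, run_append, run_cons g, ih, run_cons, run_nil, g.inv_apply]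

/-- The basic form of no-signalling: what is done to wires on which the measured quantity does not
depend cannot influence its expectation. -/
theorem run_expect (c : List (Gate W)) (ψ : State W) {v : Finset W → ℝ}
    (hv : ∀ g ∈ c, ∀ s, v (toggle s g.tgt) = v s) : expect (run c ψ) v = expect ψ v := by
  induction c generalizing ψ with
  | nil => rfl
  | cons g c ih =>
    rw [run_cons, ih _ fun k hk => hv k (List.mem_cons_of_mem _ hk),
      g.expect_apply ψ (hv g List.mem_cons_self)]

theorem x_apply (w : W) (ψ : State W) (s : Finset W) :
    (Gate.x w).apply ψ s = ψ (toggle s w) := by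
  simp [Gate.apply_eq, Gate.op_apply, Gate.diag, Gate.off, Gate.entries, Gate.tgt]

theorem x_comm (v w : W) (ψ : State W) :
    (Gate.x v).apply ((Gate.x w).apply ψ) = (Gate.x w).apply ((Gate.x v).apply ψ) := by
  ext s
  simp only [x_apply, toggle_comm]

theorem x_x (w : W) (ψ : State W) : (Gate.x w).apply ((Gate.x w).apply ψ) = ψ :=
  (Gate.x w).inv_apply ψ

theorem x_ket (w : W) (s : Finset W) : (Gate.x w).apply (ket s) = ket (toggle s w) := by
  rw [Gate.apply_eq, Gate.op_ket]
  simp [Gate.diag, Gate.off, Gate.entries, Gate.tgt]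

theorem run_write_x (t : ℕ → W) (L : ℕ) (u : ℕ → Bool) (w : W) (ψ : State W) :
    run (write t L u) ((Gate.x w).apply ψ) = (Gate.x w).apply (run (write t L u) ψ) := by
  have : ∀ c : List (Gate W), (∀ g ∈ c, ∃ v, g = .x v) → ∀ ψ,
      run c ((Gate.x w).apply ψ) = (Gate.x w).apply (run c ψ) := fun c => by
    induction c with
    | nil => exact fun _ _ => rfl
    | cons g c ih =>
      intro h ψ
      obtain ⟨v, rfl⟩ := h g List.mem_cons_self
      rw [run_cons, run_cons, x_comm, ih fun g hg => h g (List.mem_cons_of_mem _ hg)]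
  exact this _ (fun g hg => let ⟨p, _, e⟩ := mem_write hg; ⟨t p, e⟩) ψ

theorem write_succ (t : ℕ → W) (L : ℕ) (u : ℕ → Bool) (ψ : State W) :
    run (write t (L + 1) u) ψ = run (if u L then [.x (t L)] else []) (run (write t L u) ψ) := by
  rw [write, loopDown, ← write, run_append]
  by_cases h : u L
  · simp only [h, if_true, run_cons, run_nil, run_write_x]
  · simp only [h, if_false, run_nil, Bool.false_eq_true]

theorem write_write (t : ℕ → W) (L : ℕ) (u : ℕ → Bool) (ψ : State W) :
    run (write t L u) (run (write t L u) ψ) = ψ := by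
  induction L with
  | zero => rfl
  | succ L ih =>
    rw [write_succ, write_succ]
    by_cases h : u L
    · simp only [h, if_true, run_cons, run_nil, run_write_x, ih, x_x]
    · simp only [h, if_false, run_nil, ih, Bool.false_eq_true]

/-! ## Wires with a definite value -/

/-- The wire `w` has the value `b` in the state `ψ`. -/
def Has (ψ : State W) (w : W) (b : Bool) : Prop := ∀ s, ψ s ≠ 0 → (w ∈ s ↔ b = true)

theorem Has.apply {ψ : State W} {w : W} {b : Bool} (h : Has ψ w b) {g : Gate W} (hg : g.tgt ≠ w) :
    Has (g.apply ψ) w b := by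
  intro s hs
  rw [g.apply_eq, g.op_apply] at hs
  by_cases h0 : ψ s = 0
  · have : ψ (toggle s g.tgt) ≠ 0 := fun e => hs (by simp [h0, e])
    rw [← h _ this, mem_toggle]
    simp [hg.symm]
  · exact h s h0

theorem Has.run {ψ : State W} {w : W} {b : Bool} (h : Has ψ w b) {c : List (Gate W)}
    (hc : ∀ g ∈ c, g.tgt ≠ w) : Has (run c ψ) w b := by
  induction c generalizing ψ with
  | nil => exact h
  | cons g c ih =>
    exact ih (h.apply (hc g List.mem_cons_self)) fun k hk => hc k (List.mem_cons_of_mem _ hk)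

theorem Has.x {ψ : State W} {w : W} {b : Bool} (h : Has ψ w b) :
    Has ((Gate.x w).apply ψ) w (!b) := by
  intro s hs
  rw [x_apply] at hs
  have := h _ hs
  rw [mem_toggle] at this
  by_cases hw : w ∈ s <;> simp [hw] at this ⊢ <;> simp [this]

theorem has_ket (s : Finset W) (w : W) : Has (ket s) w (decide (w ∈ s)) := by
  intro t ht
  have : s = t := by
    by_contra h
    exact ht (ket_of_ne h)
  simp [this]

theorem has_write {ψ : State W} {t : ℕ → W} {L : ℕ} {u : ℕ → Bool}
    (h : ∀ p < L, Has ψ (t p) false) (ht : ∀ p < L, ∀ q < L, t p = t q → p = q) :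
    ∀ p < L, Has (run (write t L u) ψ) (t p) (u p) := by
  induction L with
  | zero => exact fun p hp => absurd hp p.not_lt_zero
  | succ L ih =>
    intro p hp
    rw [write_succ]
    rcases Nat.lt_succ_iff_lt_or_eq.1 hp with hp' | rfl
    · refine (ih (fun p hp => h p (hp.trans L.lt_succ_self)) (fun p hp q hq =>
        ht p (hp.trans L.lt_succ_self) q (hq.trans L.lt_succ_self)) p hp').run fun g hg e => ?_
      by_cases hu : u L <;> simp [hu] at hg
      subst hg
      exact hp'.ne (ht p hp L L.lt_succ_self e.symm)
    · have h0 : Has (run (write t p u) ψ) (t p) false := (h p hp).run fun g hg e => by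
        obtain ⟨q, hq, rfl⟩ := mem_write hg
        exact hq.ne (ht q (hq.trans hp) p hp e)
      by_cases hu : u p
      · simpa [hu, run_cons, run_nil] using h0.x
      · simpa [hu, run_nil] using h0

/-- A definite control makes the gate classically controlled: amplitudes with the other value of the
control vanish. -/
theorem Has.cx {ψ : State W} {c w : W} {b : Bool} (h : Has ψ c b) (hcw : c ≠ w) :
    (Gate.cx c w).apply ψ = CopyProt.run (if b then [.x w] else []) ψ := by
  ext s
  rw [Gate.apply_eq, Gate.op_apply]
  simp only [Gate.diag, Gate.off, Gate.entries, Gate.tgt, mem_toggle, hcw, ne_eq, not_false_eq_true,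
    true_and, iff_true]
  cases b
  · simp only [Bool.false_eq_true, if_false, run_nil]
    by_cases hc : c ∈ s
    · have h1 : ψ s = 0 := by
        by_contra h0; have := h s h0; simp [hc] at this
      have h2 : ψ (toggle s w) = 0 := by
        by_contra h0; have := h _ h0; simp [mem_toggle, hc, hcw] at this
      simp [hc, h1, h2]
    · simp [hc]
  · simp only [if_true, run_cons, run_nil, x_apply]
    by_cases hc : c ∈ s
    · simp [hc]
    · have h1 : ψ s = 0 := by
        by_contra h0; have := h s h0; simp [hc] at this
      have h2 : ψ (toggle s w) = 0 := by
        by_contra h0; have := h _ h0; simp [mem_toggle, hc, hcw] at this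
      simp [hc, h1, h2]

/-- Copying classical values. -/
theorem run_copy {ψ : State W} {t e : ℕ → W} {L : ℕ} {u : ℕ → Bool}
    (h : ∀ p < L, Has ψ (t p) (u p)) (hte : ∀ p < L, ∀ q < L, t p ≠ e q) :
    run (loopDown L fun p => [.cx (t p) (e p)]) ψ = run (write e L u) ψ := by
  induction L generalizing ψ with
  | zero => rfl
  | succ L ih =>
    rw [loopDown, write, loopDown, ← write, run_append, run_append, run_cons, run_nil,
      (h L L.lt_succ_self).cx (hte L L.lt_succ_self L L.lt_succ_self), ih]
    · refine fun p hp => (h p (hp.trans L.lt_succ_self)).run fun g hg e' => ?_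
      by_cases hu : u L <;> simp [hu] at hg
      subst hg
      exact hte p (hp.trans L.lt_succ_self) L L.lt_succ_self e'.symm
    · exact fun p hp q hq => hte p (hp.trans L.lt_succ_self) q (hq.trans L.lt_succ_self)

/-! ## Random bits -/

theorem h_apply {ψ : State W} {w : W} (h : Has ψ w false) : (Gate.h w).apply ψ =
    ((1 / Real.sqrt 2 : ℝ) : ℂ) • (ψ + (Gate.x w).apply ψ) := by
  ext s
  rw [Gate.apply_eq, Gate.op_apply]
  simp only [Gate.diag, Gate.off, Gate.entries, Gate.tgt, Finsupp.smul_apply, Finsupp.add_apply,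
    x_apply, smul_eq_mul, mul_add]
  congr 1
  by_cases hw : w ∈ s
  · have h1 : ψ s = 0 := by
      by_contra h0; have := h s h0; simp [hw] at this
    simp [h1]
  · simp [hw]

/-- A wire in the state `|+⟩` that is used only as a control afterwards is a random bit. -/
theorem expect_coin {ψ : State W} {w : W} (h : Has ψ w false) {c : List (Gate W)}
    (hc : ∀ g ∈ c, g.tgt ≠ w) (v : Finset W → ℝ) :
    expect (run (.h w :: c) ψ) v =
      𝔼 b : Bool, expect (run c (run (if b then [.x w] else []) ψ)) v := by
  rw [run_cons, h_apply h, run_eq, map_smul, map_add, ← run_eq, ← run_eq]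
  have h₀ := h.run hc
  have h₁ := h.x.run hc
  simp only [Fintype.expect_eq_sum_div_card, Fintype.sum_bool, Fintype.card_bool, if_true,
    Bool.false_eq_true, if_false, run_nil, run_cons]
  set φ := run c ψ
  set χ := run c ((Gate.x w).apply ψ)
  rw [expect_eq_sum (T := φ.support ∪ χ.support) _ v,
    expect_eq_sum (T := φ.support ∪ χ.support) Finset.subset_union_left v,
    expect_eq_sum (T := φ.support ∪ χ.support) Finset.subset_union_right v,
    ← Finset.sum_add_distrib, Finset.sum_div]
  · refine Finset.sum_congr rfl fun s _ => ?_
    have hr : ‖((1 / Real.sqrt 2 : ℝ) : ℂ)‖ ^ 2 = 1 / 2 := by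
      rw [Complex.norm_real, Real.norm_eq_abs, sq_abs, div_pow, Real.sq_sqrt] <;> norm_num
    rw [Finsupp.smul_apply, Finsupp.add_apply, smul_eq_mul, norm_mul, mul_pow, hr]
    -- The two branches have different values on `w` and are supported on disjoint sets of basis
    -- states, so there is no interference, and each counts with weight `1 / 2`.
    by_cases hw : w ∈ s
    · have : φ s = 0 := by
        by_contra h0; have := h₀ s h0; simp [hw] at this
      simp [this]; ring
    · have : χ s = 0 := by
        by_contra h0; have := h₁ s h0; simp [hw] at this
      simp [this]; ring
  · exact Finsupp.support_smul.trans Finsupp.support_add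

theorem expect_snoc {M : Type} [AddCommMonoid M] [Module ℚ≥0 M] {L : ℕ}
    (F : (Fin (L + 1) → Bool) → M) :
    𝔼 r, F r = 𝔼 b : Bool, 𝔼 r : Fin L → Bool, F (Fin.snoc (α := fun _ => Bool) r b) := by
  rw [← Finset.expect_product']
  exact (Fintype.expect_equiv (Fin.snocEquiv fun _ => Bool) _ _ fun _ => rfl).symm

/-- `expect_coin` applied wire by wire; `loopDown` starts with the last coin, hence the split of
tuples by `Fin.snoc`. The bit `a` is never written and may be chosen freely. -/
theorem expect_coins {t : ℕ → W} {L : ℕ} {ψ : State W} (h : ∀ p < L, Has ψ (t p) false)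
    (ht : ∀ p < L, ∀ q < L, t p = t q → p = q) {c : List (Gate W)}
    (hc : ∀ p < L, ∀ g ∈ c, g.tgt ≠ t p) (v : Finset W → ℝ) (a : Bool) :
    expect (run ((loopDown L fun p => [.h (t p)]) ++ c) ψ) v =
      𝔼 r : Fin L → Bool, expect (run c (run (write t L (ent r a)) ψ)) v := by
  induction L generalizing ψ with
  | zero => rw [Fintype.expect_eq_sum_div_card]; simp [write, loopDown, run_nil]
  | succ L ih =>
    have hL := L.lt_succ_self
    rw [loopDown, List.append_assoc, List.singleton_append, expect_coin (h L hL), expect_snoc]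
    · refine Finset.expect_congr rfl fun b _ => ?_
      rw [ih]
      · refine Finset.expect_congr rfl fun r _ => ?_
        have e₁ : ent (Fin.snoc (α := fun _ => Bool) r b) a L = b := by
          simp [ent, Fin.snoc]
        have e₂ : write t L (ent (Fin.snoc (α := fun _ => Bool) r b) a) = write t L (ent r a) :=
          write_congr fun p hp => by simp [ent, hp, hp.trans hL, Fin.snoc]
        rw [write.eq_1 t (L + 1), loopDown, ← write, run_append, e₁, e₂]
      · refine fun p hp => (h p (hp.trans hL)).run fun g hg e => ?_
        cases b <;> simp at hg
        subst hg
        exact hp.ne (ht p (hp.trans hL) L hL e.symm)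
      · exact fun p hp q hq => ht p (hp.trans hL) q (hq.trans hL)
      · exact fun p hp => hc p (hp.trans hL)
    · intro g hg e
      rcases List.mem_append.1 hg with hg | hg
      · obtain ⟨p, hp, hg⟩ := mem_loopDown hg
        rw [List.mem_singleton] at hg
        subst hg
        exact hp.ne (ht p (hp.trans hL) L hL e)
      · exact hc L hL g hg e

end Circuits

/-! ## Experiments with a random oracle table -/

section Tables
set_option linter.unusedSectionVars false
variable {W : Type}

/-- `fetch`, on arbitrary wires. -/
def fetchOn (ev : List (Gate W)) (e : ℕ → W) (o : W) (L : ℕ) (t : ℕ → W) : List (Gate W) :=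
  loopDown L (fun p => [.h (t p)]) ++
    (loopDown L (fun p => [.cx (t p) (e p)]) ++
      (ev ++ ([.cx o (t L)] ++
        (invCircuit ev ++ loopDown L (fun p => [.cx (t p) (e p)])))))

/-- `answer`, on arbitrary wires. -/
def answerOn (L : ℕ) (m : W) (a t : ℕ → W) : List (Gate W) :=
  loopDown (L + 1) (fun p => [.cx (t p) (a p)]) ++ [.cx m (a L)]

/-- The first `L + 1` wires of `t` are distinct and belong to `Z`. -/
def IsTab (L : ℕ) (Z : Set W) (t : ℕ → W) : Prop :=
  (∀ p ≤ L, ∀ q ≤ L, t p = t q → p = q) ∧ ∀ p ≤ L, t p ∈ Z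

/-- Disjoint table entries. -/
def Disj (L : ℕ) (t t' : ℕ → W) : Prop := ∀ p ≤ L, ∀ q ≤ L, t p ≠ t' q

variable [DecidableEq W]

/-- With `ev`, the value `f r` at every argument `r` can be computed. -/
def Evals (ev : List (Gate W)) (e : ℕ → W) (o : W) (L : ℕ) (f : (Fin L → Bool) → Bool)
    (ψ : State W) : Prop :=
  ∀ r, Has (run ev (run (write e L (ent r false)) ψ)) o (f r)

/-- For fixed coins `r` the evaluation leaves `f r` as a definite bit, so copying it is a classical
write on a wire outside the evaluation circuit. The inverse evaluation commutes with this write and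
cancels the evaluation. The net effect is to write `(r, f r)`. -/
theorem run_fetchOn {ev : List (Gate W)} {e : ℕ → W} {o : W} {L : ℕ} {f : (Fin L → Bool) → Bool}
    {ψ : State W} (hψ : Evals ev e o L f ψ) {Z : Set W} (hev : ∀ w ∈ cwires ev, w ∉ Z)
    (he : ∀ p < L, e p ∉ Z) (ho : o ∉ Z) {t : ℕ → W} (ht : IsTab L Z t)
    (h0 : ∀ p < L, Has ψ (t p) false) {c : List (Gate W)}
    (hc : ∀ p < L, ∀ g ∈ c, g.tgt ≠ t p) (v : Finset W → ℝ) :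
    expect (run (fetchOn ev e o L t ++ c) ψ) v =
      𝔼 r : Fin L → Bool, expect (run c (run (write t (L + 1) (ent r (f r))) ψ)) v := by
  have hte : ∀ p ≤ L, ∀ q < L, t p ≠ e q := fun p hp q hq h => he q hq (h ▸ ht.2 p hp)
  have htv : ∀ p ≤ L, t p ∉ cwires ev := fun p hp h => hev _ h (ht.2 p hp)
  have htv' : ∀ p ≤ L, t p ∉ cwires (invCircuit ev) := fun p hp h =>
    htv p hp (cwires_invCircuit h)
  have hto : ∀ p ≤ L, t p ≠ o := fun p hp h => ho (h ▸ ht.2 p hp)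
  have htL : ∀ p < L, t L ≠ t p := fun p hp h => hp.ne' (ht.1 _ le_rfl _ hp.le h)
  have hcopy : ∀ p < L, ∀ g ∈ loopDown L (fun p => [Gate.cx (t p) (e p)]), g.tgt ≠ t p :=
    fun p hp g hg => by
      obtain ⟨q, hq, hg⟩ := mem_loopDown hg
      rw [List.mem_singleton.1 hg]
      exact (hte p hp.le q hq).symm
  have hcL : ∀ p ≤ L, ∀ g ∈ ev, g.tgt ≠ t p := fun p hp => tgt_ne_of_notMem (htv p hp)
  have hcL' : ∀ p ≤ L, ∀ g ∈ invCircuit ev, g.tgt ≠ t p :=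
    fun p hp => tgt_ne_of_notMem (htv' p hp)
  rw [fetchOn, List.append_assoc, expect_coins (v := v) (a := false) h0
    fun p hp q hq => ht.1 p hp.le q hq.le]
  · refine Finset.expect_congr rfl fun r _ => ?_
    congr 1
    rw [run_append]
    congr 1
    set u := ent r false
    have hwt : ∀ w ∈ cwires (write t L u), w ∈ Z := fun w hw => by
      obtain ⟨p, hp, rfl⟩ := mem_cwires_write hw
      exact ht.2 p hp.le
    have hwe : ∀ w ∈ cwires (write e L u), w ∉ Z := fun w hw => by
      obtain ⟨p, hp, rfl⟩ := mem_cwires_write hw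
      exact he p hp
    -- `e₁` to `e₅` move the writes past the evaluation, which uses no wire of `Z`, until evaluation
    -- and inverse meet.
    have e₁ : ∀ φ, run (write e L u) (run (write t L u) φ) =
        run (write t L u) (run (write e L u) φ) :=
      run_comm fun w hw hw' => hwe w hw' (hwt w hw)
    have e₂ : ∀ φ, run ev (run (write t L u) φ) = run (write t L u) (run ev φ) :=
      run_comm fun w hw hw' => hev w hw' (hwt w hw)
    have e₃ : ∀ φ, run (invCircuit ev) (run (write t L u) φ) =
        run (write t L u) (run (invCircuit ev) φ) :=
      run_comm fun w hw hw' => hev w (cwires_invCircuit hw') (hwt w hw)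
    set X : List (Gate W) := if f r then [.x (t L)] else [] with hX
    have hXm : ∀ w ∈ cwires X, w = t L := fun w hw => by
      by_cases h : f r <;> (simp [hX, h, cwires, Gate.wires] at hw; try exact hw)
    have e₄ : ∀ φ, run (invCircuit ev) (run X φ) = run X (run (invCircuit ev) φ) :=
      run_comm fun w hw hw' => htv' L le_rfl (hXm w hw ▸ hw')
    have e₅ : ∀ φ, run (write e L u) (run X φ) = run X (run (write e L u) φ) :=
      run_comm fun w hw hw' => hwe w hw' (hXm w hw ▸ ht.2 L le_rfl)
    have hw := has_write (u := u) h0 fun p hp q hq => ht.1 p hp.le q hq.le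
    have ho' : Has (run (write t L u) (run ev (run (write e L u) ψ))) o (f r) :=
      (hψ r).run fun g hg h => by
        obtain ⟨p, hp, rfl⟩ := mem_write hg
        exact hto p hp.le h
    -- The only place where the correctness of the evaluation is used.
    have hX' : run [.cx o (t L)] (run (write t L u) (run ev (run (write e L u) ψ))) =
        run X (run (write t L u) (run ev (run (write e L u) ψ))) :=
      ho'.cx (hto L le_rfl).symm
    have h₂ : ∀ p < L, Has (run X (run (write t L u) (run (write e L u) ψ))) (t p) (u p) :=
      fun p hp => by
        rw [← e₁]
        refine ((hw p hp).run fun g hg h => ?_).run fun g hg h => ?_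
        · obtain ⟨q, hq, rfl⟩ := mem_write hg
          exact hte p hp.le q hq h.symm
        · exact htL p hp ((hXm g.tgt (mem_cwires.2 ⟨g, hg, g.tgt_mem⟩)).symm.trans h)
    rw [run_append, run_append, run_append, run_append, run_copy hw fun p hp q hq =>
      hte p hp.le q hq, e₁, e₂, hX', e₄, e₃, run_invCircuit,
      run_copy h₂ fun p hp q hq => hte p hp.le q hq, e₅, e₁, write_write, write_succ, ent_self,
      write_congr (u := ent r (f r)) (u' := u) fun p hp => ent_congr r _ _ hp]
  · intro p hp g hg
    simp only [List.mem_append] at hg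
    rcases hg with (hg | hg | hg | hg | hg) | hg
    · exact hcopy p hp g hg
    · exact hcL p hp.le g hg
    · rw [List.mem_singleton.1 hg]
      exact htL p hp
    · exact hcL' p hp.le g hg
    · exact hcopy p hp g hg
    · exact hc p hp g hg

/-- The average of `F` over random tables. -/
def tavg (L : ℕ) (f : (Fin L → Bool) → Bool) (F : State W → ℝ) : List (ℕ → W) → State W → ℝ
  | [], ψ => F ψ
  | t :: T, ψ => 𝔼 r : Fin L → Bool, tavg L f F T (run (write t (L + 1) (ent r (f r))) ψ)

variable {L : ℕ} {f : (Fin L → Bool) → Bool}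

theorem tavg_append (F : State W → ℝ) (T T' : List (ℕ → W)) (ψ : State W) :
    tavg L f F (T ++ T') ψ = tavg L f (tavg L f F T') T ψ := by
  induction T generalizing ψ with
  | nil => rfl
  | cons t T ih => exact Finset.expect_congr rfl fun r _ => ih _

/-- A circuit that does not touch the tables commutes with writing them. -/
theorem tavg_run {F : State W → ℝ} {T : List (ℕ → W)} {c : List (Gate W)}
    (h : ∀ t ∈ T, ∀ p ≤ L, t p ∉ cwires c) (ψ : State W) :
    tavg L f F T (run c ψ) = tavg L f (fun φ => F (run c φ)) T ψ := by
  induction T generalizing ψ with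
  | nil => rfl
  | cons t T ih =>
    refine Finset.expect_congr rfl fun r _ => ?_
    rw [← ih fun t ht => h t (List.mem_cons_of_mem _ ht), run_comm]
    intro w hw hw'
    obtain ⟨p, hp, rfl⟩ := mem_cwires_write hw'
    exact h t List.mem_cons_self p (Nat.lt_succ_iff.1 hp) hw

theorem tavg_const {F : State W → ℝ} {T : List (ℕ → W)}
    (h : ∀ t ∈ T, ∀ u φ, F (run (write t (L + 1) u) φ) = F φ) (ψ : State W) :
    tavg L f F T ψ = F ψ := by
  induction T generalizing ψ with
  | nil => rfl
  | cons t T ih =>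
    rw [tavg]
    simp only [ih fun t ht => h t (List.mem_cons_of_mem _ ht), h t List.mem_cons_self,
      Fintype.expect_const]

theorem has_write_of_disj {ψ : State W} {t t' : ℕ → W} (h : Disj L t t') {u : ℕ → Bool} {p : ℕ}
    (hp : p ≤ L) {b : Bool} (hψ : Has ψ (t p) b) : Has (run (write t' (L + 1) u) ψ) (t p) b :=
  hψ.run fun g hg e => by
    obtain ⟨q, hq, rfl⟩ := mem_write hg
    exact h p hp q (Nat.lt_succ_iff.1 hq) e.symm

theorem Disj.symm {t t' : ℕ → W} (h : Disj L t t') : Disj L t' t :=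
  fun p hp q hq e => h q hq p hp e.symm

/-- Fetching tables is the same as getting random tables. -/
theorem expect_fetches {ev : List (Gate W)} {e : ℕ → W} {o : W} {Z : Set W}
    (hev : ∀ w ∈ cwires ev, w ∉ Z) (he : ∀ p < L, e p ∉ Z) (ho : o ∉ Z) {T : List (ℕ → W)}
    (hT : ∀ t ∈ T, IsTab L Z t) (hd : T.Pairwise (Disj L)) {c : List (Gate W)}
    (hc : ∀ t ∈ T, ∀ p < L, ∀ g ∈ c, g.tgt ≠ t p) (v : Finset W → ℝ) {ψ : State W}
    (hψ : Evals ev e o L f ψ) (h0 : ∀ t ∈ T, ∀ p < L, Has ψ (t p) false) :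
    expect (run (T.flatMap (fetchOn ev e o L) ++ c) ψ) v =
      tavg L f (fun φ => expect (run c φ) v) T ψ := by
  induction T generalizing ψ with
  | nil => rfl
  | cons t T ih =>
    have ht := hT t List.mem_cons_self
    rw [List.pairwise_cons] at hd
    have hT' := fun t h => hT t (List.mem_cons_of_mem _ h)
    rw [List.flatMap_cons, List.append_assoc, run_fetchOn hψ hev he ho ht
      (h0 t List.mem_cons_self)]
    · refine Finset.expect_congr rfl fun r _ => ?_
      refine ih hT' hd.2 (fun t h => hc t (List.mem_cons_of_mem _ h)) (fun r' => ?_)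
        fun t' ht' p hp => has_write_of_disj (hd.1 t' ht').symm hp.le
          (h0 t' (List.mem_cons_of_mem _ ht') p hp)
      -- The new entry lies in `Z`, out of reach of the evaluation, so the program can be evaluated
      -- again for the next entry.
      have hw : ∀ w ∈ cwires (write t (L + 1) (ent r (f r))), w ∈ Z := fun w hw => by
        obtain ⟨p, hp, rfl⟩ := mem_cwires_write hw
        exact ht.2 p (Nat.lt_succ_iff.1 hp)
      rw [run_comm (c := write e L (ent r' false)), run_comm (c := ev)]
      · refine (hψ r').run fun g hg h => ho (h ▸ hw _ (mem_cwires.2 ⟨g, hg, g.tgt_mem⟩))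
      · exact fun w h h' => hev w h' (hw w h)
      · intro w h h'
        obtain ⟨p, hp, rfl⟩ := mem_cwires_write h'
        exact he p hp (hw _ h)
    · intro p hp g hg
      rcases List.mem_append.1 hg with hg | hg
      · obtain ⟨t', ht', hg⟩ := List.mem_flatMap.1 hg
        have hz : ∀ w ∉ Z, w ≠ t p := fun w hw h => hw (h ▸ ht.2 p hp.le)
        have hcopy : ∀ g ∈ loopDown L (fun p => [Gate.cx (t' p) (e p)]), g.tgt ≠ t p :=
          fun g hg => by
            obtain ⟨q, hq, hg⟩ := mem_loopDown hg
            rw [List.mem_singleton.1 hg]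
            exact hz _ (he q hq)
        have htt := (hd.1 t' ht').symm
        simp only [fetchOn, List.mem_append] at hg
        rcases hg with hg | hg | hg | hg | hg | hg
        · obtain ⟨q, hq, hg⟩ := mem_loopDown hg
          rw [List.mem_singleton.1 hg]
          exact htt q hq.le p hp.le
        · exact hcopy g hg
        · exact hz _ (hev _ (mem_cwires.2 ⟨g, hg, g.tgt_mem⟩))
        · rw [List.mem_singleton.1 hg]
          exact htt L le_rfl p hp.le
        · exact hz _ (hev _ (cwires_invCircuit (mem_cwires.2 ⟨g, hg, g.tgt_mem⟩)))
        · exact hcopy g hg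
      · exact hc t List.mem_cons_self p hp g hg

/-! ## Queries -/

/-- The oracle of the scheme. -/
def oracle (f : (Fin L → Bool) → Bool) (b : Bool) (r : Fin L → Bool) : Content :=
  bits (Fin.snoc (α := fun _ => Bool) r (xor b (f r)))

theorem bits_snoc (r : Fin L → Bool) (b : Bool) :
    bits (Fin.snoc (α := fun _ => Bool) r b) =
      (Finset.range (L + 1)).filter fun p => ent r b p = true := by
  ext p
  simp only [bits, Finset.mem_image, Finset.mem_filter, Finset.mem_univ, true_and, Finset.mem_range]
  constructor
  · rintro ⟨j, hj, rfl⟩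
    refine ⟨j.2, ?_⟩
    induction j using Fin.lastCases with
    | last => simpa [ent] using hj
    | cast j => simpa [ent] using hj
  · rintro ⟨hp, h⟩
    refine ⟨⟨p, hp⟩, ?_, rfl⟩
    rcases Nat.lt_succ_iff_lt_or_eq.1 hp with h' | rfl
    · simpa [ent, h', Fin.snoc] using h
    · simpa [ent, Fin.snoc] using h

theorem run_write_ket {a : ℕ → W} (ha : Function.Injective a) (M : ℕ) (u : ℕ → Bool)
    (s : Finset W) : run (write a M u) (ket s) =
      ket (symmDiff s (load a ((Finset.range M).filter fun p => u p = true))) := by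
  induction M with
  | zero =>
    simp only [write, loopDown, run_nil, load, Finset.range_zero, Finset.filter_empty,
      Finset.image_empty]
    rw [← Finset.bot_eq_empty, symmDiff_bot]
  | succ M ih =>
    rw [write_succ, ih]
    by_cases h : u M
    · simp only [h, if_true, run_cons, run_nil, x_ket]
      rw [toggle, symmDiff_assoc]
      congr 2
      rw [Finset.range_add_one, Finset.filter_insert, if_pos h, load, load, Finset.image_insert,
        ← toggle, toggle_of_notMem]
      simp [ha.eq_iff]
    · simp only [h, if_false, run_nil, Bool.false_eq_true]
      rw [Finset.range_add_one, Finset.filter_insert, if_neg h]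

/-- An encryption with fixed coins is `(r, f r)` with the message added to the last bit. So a query
toggles the answer register by `(r, f r)` and applies a controlled not from the message wire, which
must not belong to that register. -/
theorem queryApply_oracle {m : W} {a : ℕ → W} (ha : Function.Injective a) (hm : ∀ p, m ≠ a p)
    (r : Fin L → Bool) (ψ : State W) : queryApply (fun b => oracle f b r) m a ψ =
      run (write a (L + 1) (ent r (f r)) ++ [.cx m (a L)]) ψ := by
  have : Finsupp.lmapDomain ℂ ℂ (fun s => symmDiff s (load a (oracle f (decide (m ∈ s)) r))) =
      runOp (write a (L + 1) (ent r (f r)) ++ [.cx m (a L)]) := by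
    refine linear_ext fun s => ?_
    rw [← run_eq, run_append]
    have hh : Has (run (write a (L + 1) (ent r (f r))) (ket s)) m (decide (m ∈ s)) :=
      (has_ket s m).run fun g hg e => by
        obtain ⟨p, _, rfl⟩ := mem_write hg
        exact hm p e.symm
    rw [run_cons, run_nil, hh.cx (hm L), Finsupp.lmapDomain_apply, ket, Finsupp.mapDomain_single,
      oracle, bits_snoc]
    by_cases hs : m ∈ s
    · have e : ∀ φ, run [.x (a L)] (run (write a (L + 1) (ent r (f r))) φ) =
          run (write a (L + 1) (ent r (!f r))) φ := fun φ => by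
        rw [write_succ, write_succ, ent_self, ent_self,
          write_congr (u := ent r (f r)) (u' := ent r (!f r)) fun p hp => ent_congr r _ _ hp]
        cases f r <;> simp [run_cons, run_nil, x_x]
      simp only [hs, decide_true, if_true, Bool.true_xor]
      exact ((e _).trans (run_write_ket ha _ _ _)).symm
    · simp only [hs, decide_false, Bool.false_eq_true, if_false, Bool.false_xor]
      exact (run_write_ket ha _ _ _).symm
  rw [run_eq, ← this]
  rfl

/-- The step uses only wires in `S`, where the answers to queries have `L + 1` bits. -/
def Step.Within (L : ℕ) (S : Set W) : Step W → Prop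
  | .gate g => ∀ w ∈ g.wires, w ∈ S
  | .query m a => m ∈ S ∧ (∀ p ≤ L, a p ∈ S) ∧ Function.Injective a ∧ ∀ p, m ≠ a p

theorem Step.Within.mono {S S' : Set W} (h : S ⊆ S') {st : Step W} (hs : st.Within L S) :
    st.Within L S' := by
  cases st with
  | gate g => exact fun w hw => h (hs w hw)
  | query m a => exact ⟨h hs.1, fun p hp => h (hs.2.1 p hp), hs.2.2⟩

theorem cwires_query {S : Set W} {m : W} {a : ℕ → W} (h : (Step.query m a).Within L S)
    (u : ℕ → Bool) : ∀ w ∈ cwires (write a (L + 1) u ++ [.cx m (a L)]), w ∈ S := fun w hw => by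
  rw [cwires_append, List.mem_append] at hw
  rcases hw with hw | hw
  · obtain ⟨p, hp, rfl⟩ := mem_cwires_write hw
    exact h.2.1 p (Nat.lt_succ_iff.1 hp)
  · simp only [cwires, List.flatMap_cons, Gate.wires, List.flatMap_nil, List.append_nil,
      List.mem_cons, List.not_mem_nil, or_false] at hw
    rcases hw with rfl | rfl
    exacts [h.1, h.2.1 L le_rfl]

section ExpRun
variable {R : Type} [Fintype R] (resp : Bool → R → Content) (v : Finset W → ℝ)

theorem expRun_append_congr {l l' : List (Step W)}
    (h : ∀ ψ, expRun resp v l ψ = expRun resp v l' ψ) (l₀ : List (Step W)) (ψ : State W) :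
    expRun resp v (l₀ ++ l) ψ = expRun resp v (l₀ ++ l') ψ := by
  induction l₀ generalizing ψ with
  | nil => exact h ψ
  | cons st l₀ ih =>
    cases st with
    | gate g => exact ih _
    | query m a => exact Finset.expect_congr rfl fun r _ => ih _

theorem expRun_gates (c : List (Gate W)) (l : List (Step W)) (ψ : State W) :
    expRun resp v (c.map .gate ++ l) ψ = expRun resp v l (run c ψ) := by
  induction c generalizing ψ with
  | nil => rfl
  | cons g c ih => exact ih _

/-- Linearity of expectation, which later allows the freeloaders to be treated one at a time. -/
theorem expRun_sum {ι : Type} [Fintype ι] (v : ι → Finset W → ℝ) (l : List (Step W))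
    (ψ : State W) : expRun resp (fun s => ∑ i, v i s) l ψ = ∑ i, expRun resp (v i) l ψ := by
  induction l generalizing ψ with
  | nil =>
    simp only [expRun, expect, Finsupp.sum, Finset.mul_sum]
    exact Finset.sum_comm
  | cons st l ih =>
    cases st with
    | gate g => exact ih _
    | query m a =>
      simp only [expRun, ih]
      exact Finset.expect_sum_comm _ _ _

end ExpRun

variable {v : Finset W → ℝ}

theorem expRun_query {S : Set W} {m : W} {a : ℕ → W} (h : (Step.query m a).Within L S)
    (l : List (Step W)) (ψ : State W) : expRun (oracle f) v (.query m a :: l) ψ =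
      𝔼 r : Fin L → Bool, expRun (oracle f) v l
        (run (write a (L + 1) (ent r (f r)) ++ [.cx m (a L)]) ψ) := by
  simp only [expRun, queryApply_oracle h.2.2.1 h.2.2.2]

/-- Operations before an experiment that concern neither the experiment nor the result. -/
theorem expRun_run {S : Set W} {l : List (Step W)} (hl : ∀ st ∈ l, st.Within L S)
    {c : List (Gate W)} (hc : ∀ w ∈ cwires c, w ∉ S)
    (hv : ∀ g ∈ c, ∀ s, v (toggle s g.tgt) = v s) (ψ : State W) :
    expRun (oracle f) v l (run c ψ) = expRun (oracle f) v l ψ := by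
  induction l generalizing ψ with
  | nil => exact run_expect c ψ hv
  | cons st l ih =>
    have hst := hl st List.mem_cons_self
    have ih := ih fun st h => hl st (List.mem_cons_of_mem _ h)
    cases st with
    | gate g =>
      rw [expRun, expRun, ← run_apply_comm, ih]
      exact fun w hw hw' => hc w hw' (hst w hw)
    | query m a =>
      rw [expRun_query hst, expRun_query hst]
      refine Finset.expect_congr rfl fun r _ => ?_
      rw [run_comm, ih]
      exact fun w hw hw' => hc w hw (cwires_query hst _ w hw')

/-- No-signalling for experiments: for each value of the coins a query is a circuit on the wires in
`S`, which affects neither the later steps nor the result. -/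
theorem expRun_drop_left {S S' : Set W} (hS : ∀ w ∈ S, w ∉ S') {l l' : List (Step W)}
    (hl : ∀ st ∈ l, st.Within L S) (hl' : ∀ st ∈ l', st.Within L S')
    (hv : ∀ w ∈ S, ∀ s, v (toggle s w) = v s) (ψ : State W) :
    expRun (oracle f) v (l ++ l') ψ = expRun (oracle f) v l' ψ := by
  induction l generalizing ψ with
  | nil => rfl
  | cons st l ih =>
    have hst := hl st List.mem_cons_self
    have ih := ih fun st h => hl st (List.mem_cons_of_mem _ h)
    have key : ∀ c : List (Gate W), (∀ w ∈ cwires c, w ∈ S) →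
        expRun (oracle f) v l' (run c ψ) = expRun (oracle f) v l' ψ := fun c hc =>
      expRun_run hl' (fun w hw => hS w (hc w hw))
        (fun g hg => hv _ (hc _ (mem_cwires.2 ⟨g, hg, g.tgt_mem⟩))) ψ
    cases st with
    | gate g =>
      rw [List.cons_append, expRun, ih]
      exact key [g] fun w hw => hst w (by simpa [cwires] using hw)
    | query m a =>
      rw [List.cons_append, expRun_query hst]
      simp only [ih, key _ (cwires_query hst _), Fintype.expect_const]

theorem expRun_drop {S : Set W} {l : List (Step W)} (hl : ∀ st ∈ l, st.Within L S)
    (hv : ∀ w ∈ S, ∀ s, v (toggle s w) = v s) (ψ : State W) :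
    expRun (oracle f) v l ψ = expect ψ v := by
  have := expRun_drop_left (f := f) (S' := ∅) (l' := []) (fun _ _ => id) hl
    (fun _ h => absurd h (by simp)) hv ψ
  rwa [List.append_nil] at this

/-! ## Simulating the oracle -/

/-- A step of an experiment in which every query comes with a table entry for its answer. -/
inductive TStep (W : Type)
  | gate (g : Gate W)
  | query (m : W) (a t : ℕ → W)

def TStep.toStep {W : Type} : TStep W → Step W
  | .gate g => .gate g
  | .query m a _ => .query m a

def TStep.sim {W : Type} (L : ℕ) : TStep W → List (Gate W)
  | .gate g => [g]
  | .query m a t => answerOn L m a t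

def TStep.tabs {W : Type} : TStep W → List (ℕ → W)
  | .gate _ => []
  | .query _ _ t => [t]

theorem mem_cwires_answerOn {m w : W} {a t : ℕ → W} (h : w ∈ cwires (answerOn L m a t)) :
    w = m ∨ (∃ p ≤ L, w = a p) ∨ ∃ p ≤ L, w = t p := by
  rw [answerOn, cwires_append, List.mem_append] at h
  rcases h with h | h
  · obtain ⟨g, hg, hw⟩ := mem_cwires.1 h
    obtain ⟨p, hp, hg⟩ := mem_loopDown hg
    rw [List.mem_singleton.1 hg] at hw
    simp only [Gate.wires, List.mem_cons, List.not_mem_nil, or_false] at hw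
    rcases hw with rfl | rfl
    · exact .inr (.inr ⟨p, Nat.lt_succ_iff.1 hp, rfl⟩)
    · exact .inr (.inl ⟨p, Nat.lt_succ_iff.1 hp, rfl⟩)
  · simp only [cwires, List.flatMap_cons, Gate.wires, List.flatMap_nil, List.append_nil,
      List.mem_cons, List.not_mem_nil, or_false] at h
    rcases h with rfl | rfl
    exacts [.inl rfl, .inr (.inl ⟨L, le_rfl, rfl⟩)]

theorem mem_cwires_sim {Z : Set W} {l : List (TStep W)} (hl : ∀ st ∈ l, st.toStep.Within L Zᶜ)
    {w : W} (h : w ∈ cwires (l.flatMap (TStep.sim L))) :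
    w ∉ Z ∨ ∃ t ∈ l.flatMap TStep.tabs, ∃ p ≤ L, w = t p := by
  obtain ⟨g, hg, hw⟩ := mem_cwires.1 h
  obtain ⟨st, hst, hg⟩ := List.mem_flatMap.1 hg
  have hs := hl st hst
  cases st with
  | gate k => exact .inl (hs w (by rwa [← List.mem_singleton.1 hg]))
  | query m a t =>
    rcases mem_cwires_answerOn (mem_cwires.2 ⟨g, hg, hw⟩) with rfl | ⟨p, hp, rfl⟩ | ⟨p, hp, rfl⟩
    · exact .inl hs.1
    · exact .inl (hs.2.1 p hp)
    · exact .inr ⟨t, List.mem_flatMap.2 ⟨_, hst, by simp [TStep.tabs]⟩, p, hp, rfl⟩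

/-- A random table simulates the oracle. -/
theorem tavg_sim {Z : Set W} (hv : ∀ w ∈ Z, ∀ s, v (toggle s w) = v s) {l : List (TStep W)}
    (hl : ∀ st ∈ l, st.toStep.Within L Zᶜ) (hT : ∀ t ∈ l.flatMap TStep.tabs, IsTab L Z t)
    (hd : (l.flatMap TStep.tabs).Pairwise (Disj L)) {ψ : State W}
    (h0 : ∀ t ∈ l.flatMap TStep.tabs, ∀ p ≤ L, Has ψ (t p) false) :
    tavg L f (fun φ => expect (run (l.flatMap (TStep.sim L)) φ) v) (l.flatMap TStep.tabs) ψ =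
      expRun (oracle f) v (l.map TStep.toStep) ψ := by
  induction l generalizing ψ with
  | nil => rfl
  | cons st l ih =>
    have hst := hl st List.mem_cons_self
    have hl' := fun st h => hl st (List.mem_cons_of_mem _ h)
    cases st with
    | gate g =>
      have hgT : ∀ t ∈ l.flatMap TStep.tabs, ∀ p ≤ L, t p ∉ cwires [g] := fun t ht p hp h =>
        hst (t p) (by simpa [cwires] using h) ((hT t ht).2 p hp)
      have e := ih hl' hT hd (ψ := run [g] ψ) fun t ht p hp =>
        (h0 t ht p hp).run (tgt_ne_of_notMem (hgT t ht p hp))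
      rw [tavg_run hgT] at e
      exact e
    | query m a t =>
      have hT' : ∀ t ∈ l.flatMap TStep.tabs, IsTab L Z t := fun t h =>
        hT t (List.mem_append_right _ h)
      have ht : IsTab L Z t := hT t (List.mem_append_left _ (by simp [TStep.tabs]))
      have hd' := List.pairwise_cons.1 hd
      have h0t := h0 t (List.mem_append_left _ (by simp [TStep.tabs]))
      have h0' : ∀ t ∈ l.flatMap TStep.tabs, ∀ p ≤ L, Has ψ (t p) false :=
        fun t h => h0 t (List.mem_append_right _ h)
      rw [List.map_cons, TStep.toStep, expRun_query hst]
      refine Finset.expect_congr rfl fun r _ => ?_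
      set c := write a (L + 1) (ent r (f r)) ++ [Gate.cx m (a L)] with hcdef
      set w := write t (L + 1) (ent r (f r)) with hwdef
      have hcZ : ∀ x ∈ cwires c, x ∉ Z := cwires_query hst _
      have hcT : ∀ t ∈ l.flatMap TStep.tabs, ∀ p ≤ L, t p ∉ cwires c := fun t ht p hp h =>
        hcZ _ h ((hT' t ht).2 p hp)
      rw [← ih hl' hT' hd'.2 fun t' ht' p hp =>
        (h0' t' ht' p hp).run (tgt_ne_of_notMem (hcT t' ht' p hp))]
      have hw : ∀ x ∈ cwires w, ∃ p ≤ L, x = t p := fun x hx => by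
        obtain ⟨p, hp, rfl⟩ := mem_cwires_write hx
        exact ⟨p, Nat.lt_succ_iff.1 hp, rfl⟩
      have hwT : ∀ t' ∈ l.flatMap TStep.tabs, ∀ p ≤ L, t' p ∉ cwires w := fun t' ht' p hp h => by
        obtain ⟨q, hq, e⟩ := hw _ h
        exact hd'.1 t' ht' q hq p hp e.symm
      have haT : ∀ t' ∈ l.flatMap TStep.tabs, ∀ p ≤ L, t' p ∉ cwires (answerOn L m a t) :=
        fun t' ht' p hp h => by
          rcases mem_cwires_answerOn h with e | ⟨q, hq, e⟩ | ⟨q, hq, e⟩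
          · exact hst.1 (e ▸ (hT' t' ht').2 p hp)
          · exact hst.2.1 q hq (e ▸ (hT' t' ht').2 p hp)
          · exact hd'.1 t' ht' q hq p hp e.symm
      -- With `(r, f r)` written to the table entry, answering from it does what the oracle does
      -- with coins `r`.
      have e₁ : run (answerOn L m a t) (run w ψ) = run w (run c ψ) := by
        have hh := has_write (u := ent r (f r)) (fun p hp => h0t p (Nat.lt_succ_iff.1 hp))
          fun p hp q hq => ht.1 p (Nat.lt_succ_iff.1 hp) q (Nat.lt_succ_iff.1 hq)
        rw [answerOn, run_append, run_copy hh, ← run_append, ← hcdef, run_comm]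
        · intro x hx hx'
          obtain ⟨p, hp, rfl⟩ := hw x hx
          exact hcZ _ hx' (ht.2 p hp)
        · intro p hp q hq e
          exact hst.2.1 q (Nat.lt_succ_iff.1 hq) (e ▸ ht.2 p (Nat.lt_succ_iff.1 hp))
      -- The entry is not used by any later step, since each query has its own, and `v` does not
      -- depend on it. So its content can be forgotten, and only fresh coins remain.
      have e₂ : ∀ φ, expect (run (l.flatMap (TStep.sim L)) (run w φ)) v =
          expect (run (l.flatMap (TStep.sim L)) φ) v := fun φ => by
        rw [run_comm, run_expect]
        · intro g hg
          obtain ⟨p, hp, e⟩ := hw _ (mem_cwires.2 ⟨g, hg, g.tgt_mem⟩)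
          exact hv _ (e ▸ ht.2 p hp)
        · intro x hx hx'
          obtain ⟨p, hp, rfl⟩ := hw x hx
          rcases mem_cwires_sim hl' hx' with h | ⟨t', ht', q, hq, e⟩
          · exact h (ht.2 p hp)
          · exact hd'.1 t' ht' p hp q hq e
      have e₃ := tavg_run (f := f) (F := fun φ => expect (run (l.flatMap (TStep.sim L)) φ) v)
        haT (run w ψ)
      rw [e₁, tavg_run hwT] at e₃
      simp only [e₂] at e₃
      simp only [← run_append] at e₃
      exact e₃.symm

end Tables

/-! ## Renaming wires -/

section Rename
set_option linter.unusedSectionVars false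
variable {V W : Type} [DecidableEq V] [DecidableEq W]

theorem toggle_image {j : V → W} (hj : Function.Injective j) (s : Finset V) (w : V) :
    toggle (s.image j) (j w) = (toggle s w).image j := by
  rw [toggle, toggle, Finset.image_symmDiff _ _ hj, Finset.image_singleton]

theorem Gate.entries_map {j : V → W} (hj : Function.Injective j) (g : Gate V) (s : Finset V) :
    (g.map j).entries (s.image j) = g.entries s := by
  cases g <;> simp [map, entries, hj.eq_iff, Finset.mem_image]

theorem run_map {j : V → W} (hj : Function.Injective j) (c : List (Gate V)) (ψ : State V) :
    run (c.map (Gate.map j)) (ψ.mapDomain (Finset.image j)) =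
      (run c ψ).mapDomain (Finset.image j) := by
  induction c generalizing ψ with
  | nil => rfl
  | cons g c ih =>
    rw [List.map_cons, run_cons, run_cons, ← ih]
    congr 1
    rw [Gate.apply_eq, Gate.apply_eq]
    have : (g.map j).op.comp (Finsupp.lmapDomain ℂ ℂ (Finset.image j)) =
        (Finsupp.lmapDomain ℂ ℂ (Finset.image j)).comp g.op := by
      have hk : ∀ s : Finset V, Finsupp.lmapDomain ℂ ℂ (Finset.image j) (ket s) =
          ket (s.image j) := fun s => by
        rw [Finsupp.lmapDomain_apply, ket, Finsupp.mapDomain_single]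
        rfl
      refine linear_ext fun s => ?_
      rw [LinearMap.comp_apply, LinearMap.comp_apply, hk, Gate.op_ket, Gate.op_ket, map_add,
        map_smul, map_smul, hk, hk, Gate.tgt_map, toggle_image hj, Gate.diag, Gate.off,
        Gate.entries_map hj]
      rfl
    exact LinearMap.congr_fun this ψ

theorem Has.mapDomain {j : V → W} (hj : Function.Injective j) {ψ : State V} {w : V} {b : Bool}
    (h : Has ψ w b) : Has (ψ.mapDomain (Finset.image j)) (j w) b := by
  intro s hs
  obtain ⟨t, ht, rfl⟩ := Finset.mem_image.1 (Finsupp.mapDomain_support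
    (Finsupp.mem_support_iff.2 hs))
  rw [← h t (Finsupp.mem_support_iff.1 ht), Finset.mem_image]
  exact ⟨fun ⟨v, hv, e⟩ => hj e ▸ hv, fun h => ⟨w, h, rfl⟩⟩

theorem Gate.map_map {U : Type} (f : V → W) (h : W → U) (g : Gate V) :
    (g.map f).map h = g.map fun w => h (f w) := by
  cases g <;> rfl

theorem expect_ket (s : Finset W) (v : Finset W → ℝ) : expect (ket s) v = v s := by
  simp [expect, ket]

/-- An outcome of probability one. -/
theorem has_of_prob {c : List (Gate W)} {s : Finset W} {w : W} {b : Bool}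
    (h : prob (run c (ket s)) {s | decide (w ∈ s) = b} = 1) : Has (run c (ket s)) w b := by
  set ψ := run c (ket s) with hψ
  -- Circuits preserve the norm. A nonzero amplitude outside the event would therefore push its
  -- probability strictly below one.
  have h1 : expect ψ (fun _ => 1) = 1 := by
    rw [hψ, run_expect c _ fun _ _ _ => rfl, expect_ket]
  rw [prob, ← h1, expect, expect, Finsupp.sum, Finsupp.sum] at h
  intro t ht
  by_contra hn
  refine ne_of_lt (Finset.sum_lt_sum (fun t _ => ?_)
    ⟨t, Finsupp.mem_support_iff.2 ht, ?_⟩) h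
  · gcongr
    by_cases ht : t ∈ {s : Finset W | decide (w ∈ s) = b} <;> simp [ht]
  · have : t ∉ {s : Finset W | decide (w ∈ s) = b} := fun e => hn (by
      rw [Set.mem_ofPred_eq] at e; rw [← e, decide_eq_true_iff])
    rw [Set.indicator_of_notMem this, mul_zero, mul_one]
    have := norm_pos_iff.2 ht
    positivity

/-- Toggle all wires of a set. -/
def toggles (D : Finset W) : List (Gate W) := D.toList.map .x

theorem mem_cwires_toggles {D : Finset W} {w : W} : w ∈ cwires (toggles D) ↔ w ∈ D := by
  simp [cwires, toggles, Gate.wires, List.mem_flatMap]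

/-- Presents a part of the initial state as a circuit, which can be commuted past other circuits and
dropped if it concerns nothing of interest. -/
theorem run_toggles {s D : Finset W} (h : Disjoint s D) :
    run (toggles D) (ket s) = ket (s ∪ D) := by
  have : ∀ (l : List W) (s : Finset W), l.Nodup → (∀ w ∈ l, w ∉ s) →
      run (l.map .x) (ket s) = ket (s ∪ l.toFinset) := fun l => by
    induction l with
    | nil => intro s _ _; simp [run_nil]
    | cons w l ih =>
      intro s hl hs
      rw [List.nodup_cons] at hl
      rw [List.map_cons, run_cons, x_ket, toggle_of_notMem (hs w List.mem_cons_self), ih _ hl.2]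
      · congr 1
        simp
      · intro v hv hv'
        rcases Finset.mem_insert.1 hv' with rfl | h
        · exact hl.1 hv
        · exact hs v (List.mem_cons_of_mem _ hv) h
  rw [toggles, this _ _ D.nodup_toList fun w hw hs =>
    Finset.disjoint_left.1 h hs (Finset.mem_toList.1 hw), Finset.toList_toFinset]

end Rename

theorem bits_eq {L : ℕ} (r : Fin L → Bool) (a : Bool) :
    bits r = (Finset.range L).filter fun p => ent r a p = true := by
  ext p
  simp only [bits, Finset.mem_image, Finset.mem_filter, Finset.mem_univ, true_and, Finset.mem_range]
  constructor
  · rintro ⟨j, hj, rfl⟩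
    exact ⟨j.2, by simpa [ent] using hj⟩
  · rintro ⟨hp, h⟩
    exact ⟨⟨p, hp⟩, by simpa [ent, hp] using h, rfl⟩

/-! ## Evaluating programs in a game -/

/-- The runs of the source in a game. -/
def sources (prog : Circuit) (n : ℕ) : List (Gate GWire) :=
  (List.range n).flatMap fun i => prog.map (Gate.map fun w => (.source i, w))

theorem mem_cwires_map {V W : Type} {f : V → W} {c : List (Gate V)} {w : W} :
    w ∈ cwires (c.map (Gate.map f)) ↔ ∃ v ∈ cwires c, f v = w := by
  simp only [mem_cwires, List.mem_map]
  constructor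
  · rintro ⟨_, ⟨g, hg, rfl⟩, hw⟩
    rw [Gate.wires_map, List.mem_map] at hw
    obtain ⟨v, hv, rfl⟩ := hw
    exact ⟨v, ⟨g, hg, hv⟩, rfl⟩
  · rintro ⟨v, ⟨g, hg, hv⟩, rfl⟩
    exact ⟨_, ⟨g, hg, rfl⟩, by rw [Gate.wires_map]; exact List.mem_map_of_mem hv⟩

theorem mem_cwires_sources {prog : Circuit} {n : ℕ} {w : GWire} (h : w ∈ cwires (sources prog n)) :
    ∃ i, w.1 = .source i := by
  obtain ⟨g, hg, hw⟩ := mem_cwires.1 h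
  obtain ⟨i, _, hg⟩ := List.mem_flatMap.1 hg
  obtain ⟨v, _, rfl⟩ := mem_cwires_map.1 (mem_cwires.2 ⟨g, hg, hw⟩)
  exact ⟨i, rfl⟩

theorem pirateWire_injective (n : ℕ) : Function.Injective (pirateWire n) := by
  rintro ⟨k, r, p⟩ ⟨k', r', p'⟩ h
  simp only [pirateWire] at h
  split_ifs at h with h₁ h₂ h₂ <;> simp at h ⊢
  · exact ⟨h₁.1.trans h₂.1.symm, h⟩
  · exact h

theorem freeWire_injective (i : ℕ) : Function.Injective (freeWire i) := by
  rintro ⟨k, r, p⟩ ⟨k', r', p'⟩ h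
  simp only [freeWire] at h
  split_ifs at h with h₁ h₂ h₂ <;> simp at h ⊢
  · exact ⟨h₁.1.trans h₂.1.symm, h₁.2.trans h₂.2.symm, h⟩
  · exact h

/-- The wires in a game on which programs are evaluated. -/
def evalOn (N : ℕ) : Wire ⊕ Wire → GWire
  | .inl w => (.source 0, w)
  | .inr w => (.pirate, ⟨w.kind, w.reg + N, w.pos⟩)

theorem evalOn_injective (N : ℕ) : Function.Injective (evalOn N) := by
  rintro (⟨k, r, p⟩ | ⟨k, r, p⟩) (⟨k', r', p'⟩ | ⟨k', r', p'⟩) h <;> simp [evalOn] at h ⊢ <;> exact h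

/-- The input register `0` is the program from source `0`, which exists because `1 ≤ n`. A shift by
`N ≥ n` takes all other registers away from the inputs that are wired to sources. -/
theorem evalOn_evalWire {n N : ℕ} (hn : 1 ≤ n) (hN : n ≤ N) (w : Wire) :
    evalOn N (evalWire w) = pirateWire n (evw N w) := by
  obtain ⟨k, r, p⟩ := w
  by_cases h : k = .inp ∧ r = 0
  · have : 0 < n := hn
    simp [evalWire, evw, h, evalOn, pirateWire, this]
  · have h' : ¬ (k = .inp ∧ r + N < n) := fun h => by omega
    simp [evalWire, evw, h, evalOn, pirateWire, h']

theorem has_prepEval {prog ev : Circuit} {key u : Content} {b : Bool}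
    (h : prob (prepEval prog ev key u) {s | decide (Sum.inr outBit ∈ s) = b} = 1) (N : ℕ) :
    Has ((run (prog.map (Gate.map Sum.inl) ++ ev.map (Gate.map evalWire))
      (ket (load (fun j => Sum.inl ⟨.inp, 0, j⟩) key ∪ load (fun j => Sum.inr ⟨.inp, 1, j⟩) u))
      ).mapDomain (Finset.image (evalOn N))) (evalOn N (.inr outBit)) b :=
  Has.mapDomain (evalOn_injective N) (has_of_prob h)

/-- After the programs were generated, the first one can be evaluated. -/
theorem evals_sources {prog ev : Circuit} {key : Content} {L : ℕ} {f : (Fin L → Bool) → Bool}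
    (hc : ∀ x, prob (prepEval prog ev key (bits x))
      {s | decide (Sum.inr outBit ∈ s) = f x} = 1) {n N : ℕ} (hn : 1 ≤ n) (hN : n ≤ N)
    {D : Finset GWire} (hD : ∀ w ∈ D, (∃ i, w.1 = .source (i + 1)) ∨ ∃ i, w.1 = .free i) :
    Evals (ev.map (Gate.map fun w => pirateWire n (evw N w)))
      (fun p => pirateWire n ⟨.inp, 1 + N, p⟩) (pirateWire n ⟨.out, N, 0⟩) L f
      (run (sources prog n)
        (ket (load (fun j => ((.source 0, ⟨.inp, 0, j⟩) : GWire)) key ∪ D))) := by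
  have hH := fun x => has_prepEval (hc x) N
  clear hc
  intro x
  obtain ⟨n, rfl⟩ : ∃ n', n = n' + 1 := ⟨n - 1, by omega⟩
  set K : Finset GWire := load (fun j => (.source 0, ⟨.inp, 0, j⟩)) key with hK
  set S : List (Gate GWire) := prog.map (Gate.map fun w => (.source 0, w)) with hS
  set S' : List (Gate GWire) := (List.range n).flatMap fun i =>
    prog.map (Gate.map fun w => (.source (i + 1), w)) with hS'
  have hSS : sources prog (n + 1) = S ++ S' := by
    rw [sources, List.range_succ_eq_map, List.flatMap_cons, List.flatMap_map]
  have hSw : ∀ w ∈ cwires S, w.1 = .source 0 := fun w hw => by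
    obtain ⟨v, _, rfl⟩ := mem_cwires_map.1 hw
    rfl
  have hSw' : ∀ w ∈ cwires S', ∃ i, w.1 = .source (i + 1) := fun w hw => by
    obtain ⟨g, hg, hw⟩ := mem_cwires.1 hw
    obtain ⟨i, _, hg⟩ := List.mem_flatMap.1 hg
    obtain ⟨v, _, rfl⟩ := mem_cwires_map.1 (mem_cwires.2 ⟨g, hg, hw⟩)
    exact ⟨i, rfl⟩
  have hevJ : (ev.map (Gate.map evalWire)).map (Gate.map (evalOn N)) =
      ev.map (Gate.map fun w => pirateWire (n + 1) (evw N w)) := by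
    simp only [List.map_map, Function.comp_def, Gate.map_map, evalOn_evalWire hn hN]
  set E := ev.map (Gate.map fun w => pirateWire (n + 1) (evw N w)) with hE
  have hin : ∀ p, pirateWire (n + 1) ⟨.inp, 1 + N, p⟩ = evalOn N (.inr ⟨.inp, 1, p⟩) := fun p => by
    have : ¬ 1 + N < n + 1 := by omega
    simp [pirateWire, evalOn, this]
  have hout : pirateWire (n + 1) ⟨.out, N, 0⟩ = evalOn N (.inr outBit) := by
    simp [pirateWire, evalOn, outBit]
  simp only [hin]
  rw [hout]
  set w₀ := write (fun p => evalOn N (.inr ⟨.inp, 1, p⟩)) L (ent x false) with hw₀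
  have hEw : ∀ w ∈ cwires E, w.1 = .source 0 ∨ w.1 = .pirate := fun w hw => by
    rw [← hevJ] at hw
    obtain ⟨v, _, rfl⟩ := mem_cwires_map.1 hw
    cases v
    exacts [.inl rfl, .inr rfl]
  have hww : ∀ w ∈ cwires w₀, w.1 = .pirate := fun w hw => by
    obtain ⟨p, _, rfl⟩ := mem_cwires_write hw
    rfl
  have hDw : ∀ w ∈ cwires (toggles D), (∃ i, w.1 = .source (i + 1)) ∨ ∃ i, w.1 = .free i :=
    fun w hw => hD w (mem_cwires_toggles.1 hw)
  have hKD : Disjoint K D := Finset.disjoint_left.2 fun w hw hw' => by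
    rw [hK, load, Finset.mem_image] at hw
    obtain ⟨j, _, rfl⟩ := hw
    rcases hD _ hw' with ⟨i, h⟩ | ⟨i, h⟩ <;> simp at h
  have hr : ∀ w ∈ cwires (toggles D ++ S'), w.1 ≠ .source 0 ∧ w.1 ≠ .pirate := fun w hw => by
    rw [cwires_append, List.mem_append] at hw
    rcases hw with hw | hw
    · rcases hDw w hw with ⟨i, h⟩ | ⟨i, h⟩ <;> simp [h]
    · obtain ⟨i, h⟩ := hSw' w hw
      simp [h]
  -- The experiment of the correctness property, transported to the wires of the game.
  have hp : Has (run E (run S (run w₀ (ket K)))) (evalOn N (.inr outBit)) (f x) := by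
    have h := hH x
    rw [← run_map (evalOn_injective N), List.map_append, hevJ, run_append] at h
    have hSJ : (prog.map (Gate.map Sum.inl)).map (Gate.map (evalOn N)) = S := by
      simp only [hS, List.map_map, Function.comp_def, Gate.map_map]
      rfl
    have hk : (ket (load (fun j => Sum.inl ⟨.inp, 0, j⟩) key ∪
        load (fun j => Sum.inr ⟨.inp, 1, j⟩) (bits x)) : State (Wire ⊕ Wire)).mapDomain
          (Finset.image (evalOn N)) = run w₀ (ket K) := by
      rw [ket, Finsupp.mapDomain_single, ← ket, hw₀, run_write_ket
        (fun p q h => by simpa [evalOn] using h), ← bits_eq, Finset.image_union, hK, load, load,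
        load, load, Finset.image_image, Finset.image_image]
      have : Disjoint (Finset.image (fun j => ((.source 0, ⟨.inp, 0, j⟩) : GWire)) key)
          (Finset.image (fun p => evalOn N (Sum.inr { kind := Kind.inp, reg := 1, pos := p }))
            (bits x)) := Finset.disjoint_left.2 fun w hw hw' => by
        obtain ⟨j, _, rfl⟩ := Finset.mem_image.1 hw
        obtain ⟨p, _, h⟩ := Finset.mem_image.1 hw'
        simp [evalOn] at h
      rw [this.symmDiff_eq_sup]
      rfl
    rwa [hSJ, hk] at h
  -- Everything else, namely the other sources and the contents `D`, acts on wires apart from source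
  -- `0` and the pirate, and is moved to the end.
  have e₁ : run (sources prog (n + 1)) (ket (K ∪ D)) =
      run (toggles D ++ S') (run S (ket K)) := by
    rw [← run_toggles hKD, hSS, run_append, run_append, run_comm (c := S)]
    intro w h₁ h₂
    have h := hSw w h₂
    rcases hDw w h₁ with ⟨i, h'⟩ | ⟨i, h'⟩ <;> simp [h'] at h
  have e₂ : ∀ φ, run w₀ (run (toggles D ++ S') φ) = run (toggles D ++ S') (run w₀ φ) :=
    run_comm fun w h₁ h₂ => (hr w h₁).2 (hww w h₂)
  have e₃ : ∀ φ, run E (run (toggles D ++ S') φ) = run (toggles D ++ S') (run E φ) :=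
    run_comm fun w h₁ h₂ => (hEw w h₂).elim (hr w h₁).1 (hr w h₁).2
  have e₄ : ∀ φ, run w₀ (run S φ) = run S (run w₀ φ) :=
    run_comm fun w h₁ h₂ => by
      have h := hww w h₂
      rw [hSw w h₁] at h
      simp at h
  rw [e₁, e₂, e₃, e₄]
  refine hp.run fun g hg e => (hr _ (mem_cwires.2 ⟨g, hg, g.tgt_mem⟩)).2 ?_
  rw [e]
  rfl

/-! ## The steps of the reduction -/

theorem Wire.length_code (w : Wire) : w.code.length = w.reg + w.pos + 3 := by
  simp [Wire.code, unary]; omega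

/-- Numbers of wires are written in unary, so lengths of descriptions bound them. This is why a
shift by such a length leads to unused wires. -/
theorem Gate.lt_length_code {g : Gate Wire} {w : Wire} (h : w ∈ g.wires) :
    w.reg + w.pos < g.code.length := by
  cases g <;> simp [wires] at h <;> (try rcases h with rfl | rfl | rfl) <;>
    simp [code, Wire.length_code] <;> omega

theorem length_le_flatMap {α β : Type} {f : α → List β} {l : List α} {a : α} (h : a ∈ l) :
    (f a).length ≤ (l.flatMap f).length := by
  obtain ⟨s, t, rfl⟩ := List.append_of_mem h
  simp only [List.flatMap_append, List.flatMap_cons, List.length_append]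
  omega

/-- All wires have small numbers. -/
def Low (N : ℕ) (l : List OGate) : Prop :=
  ∀ g, OGate.gate g ∈ l → ∀ w ∈ g.wires, w.reg < N ∧ w.pos < N

theorem low_of_length {l : List OGate} {N : ℕ} (h : (l.flatMap OGate.code).length ≤ N) :
    Low N l := fun g hg w hw => by
  have h1 := g.lt_length_code hw
  have h2 := length_le_flatMap (f := OGate.code) hg
  rw [OGate.code] at h2
  omega

/-- The numbers of the queries. -/
def idxs (b : ℕ) : List OGate → List ℕ
  | [] => []
  | .gate _ :: l => idxs b l
  | .query :: l => (ix l + b) :: idxs b l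

theorem ix_cons (o : OGate) (l : List OGate) : ix (o :: l) = o.code.length + ix l := by
  simp [ix]

theorem idxs_lt {b i : ℕ} {l : List OGate} (h : i ∈ idxs b l) : i < ix l + b := by
  induction l with
  | nil => simp [idxs] at h
  | cons o l ih =>
    rw [ix_cons]
    cases o with
    | gate g => exact (ih h).trans_le (by omega)
    | query =>
      simp only [OGate.code, List.length_singleton]
      rcases List.mem_cons.1 h with rfl | h
      · omega
      · have := ih h
        omega

/-- The remaining description gets strictly shorter from query to query. -/
theorem idxs_nodup (b : ℕ) (l : List OGate) : (idxs b l).Nodup := by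
  induction l with
  | nil => exact List.nodup_nil
  | cons o l ih =>
    cases o with
    | gate g => exact ih
    | query => exact List.nodup_cons.2 ⟨fun h => (idxs_lt h).false, ih⟩

theorem expand_nil (q : ℕ → Circuit) (b : ℕ) (l : List OGate) :
    expand (fun _ => []) q b l = (idxs b l).flatMap q := by
  induction l with
  | nil => rfl
  | cons o l ih =>
    cases o with
    | gate g => exact ih
    | query => rw [expand, idxs, List.flatMap_cons, ih]

/-- The numbers of all queries of the freeloaders. -/
def idxFree : ℕ → List (List OGate) → List (ℕ × ℕ)
  | _, [] => []
  | i, l :: r => (idxs (ixFree r) l).map (Prod.mk i) ++ idxFree (i + 1) r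

theorem fetchFree_eq (c : ℕ → ℕ → Circuit) (i : ℕ) (l : List (List OGate)) :
    fetchFree c i l = (idxFree i l).flatMap fun x => c x.1 x.2 := by
  induction l generalizing i with
  | nil => rfl
  | cons o l ih =>
    rw [fetchFree, idxFree, List.flatMap_append, ih, expand_nil, List.flatMap_map]

theorem le_of_mem_idxFree {i : ℕ} {l : List (List OGate)} {x : ℕ × ℕ} (h : x ∈ idxFree i l) :
    i ≤ x.1 := by
  induction l generalizing i with
  | nil => simp [idxFree] at h
  | cons o l ih =>
    rcases List.mem_append.1 h with h | h
    · obtain ⟨j, _, rfl⟩ := List.mem_map.1 h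
      exact le_rfl
    · exact (Nat.le_succ i).trans (ih h)

theorem idxFree_nodup (i : ℕ) (l : List (List OGate)) : (idxFree i l).Nodup := by
  induction l generalizing i with
  | nil => exact List.nodup_nil
  | cons o l ih =>
    refine List.nodup_append'.2 ⟨(idxs_nodup _ _).map fun a b h => (Prod.mk.inj h).2, ih _, ?_⟩
    intro x hx hx'
    obtain ⟨j, _, rfl⟩ := List.mem_map.1 hx
    exact absurd (le_of_mem_idxFree hx') (by simp)

/-- Isolates the tables of one freeloader; those in `X` and `Y` belong to others and will be
discarded. -/
theorem idxFree_split (s : ℕ) (l : List (List OGate)) (i : ℕ) (hi : i < l.length) :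
    ∃ X Y, idxFree s l = X ++ (idxs (ixFree (l.drop (i + 1))) l[i]).map (Prod.mk (s + i)) ++ Y ∧
      (∀ x ∈ X, x.1 ≠ s + i) ∧ ∀ x ∈ Y, x.1 ≠ s + i := by
  induction l generalizing s i with
  | nil => exact absurd hi (Nat.not_lt_zero _)
  | cons o l ih =>
    cases i with
    | zero =>
      refine ⟨[], idxFree (s + 1) l, rfl, fun x hx => absurd hx (by simp), fun x hx => ?_⟩
      have := le_of_mem_idxFree hx
      omega
    | succ i =>
      obtain ⟨X, Y, e, hX, hY⟩ := ih (s + 1) i (Nat.lt_of_succ_lt_succ hi)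
      have hs : s + 1 + i = s + (i + 1) := by omega
      rw [hs] at e hX hY
      refine ⟨(idxs (ixFree l) o).map (Prod.mk s) ++ X, Y, ?_, fun x hx => ?_, hY⟩
      · rw [idxFree, e]
        simp
      · rcases List.mem_append.1 hx with hx | hx
        · obtain ⟨j, _, rfl⟩ := List.mem_map.1 hx
          simp
        · exact hX x hx

theorem simFree_getD (N L : ℕ) (l : List (List OGate)) (i : ℕ) : (simFree N L l).getD i [] =
    if h : i < l.length then guessBit N L ++ (expand (fun g => [g])
      (fun j => answer L (tabWire .inp N L 0 j)) (ixFree (l.drop (i + 1))) l[i] ++ unguess N)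
    else [] := by
  induction l generalizing i with
  | nil => simp [simFree]
  | cons o l ih =>
    cases i with
    | zero => simp [simFree]
    | succ i => simpa [simFree] using ih i

section Label
variable {W : Type}

/-- The steps of a party with its table entries. -/
def label (φ : Wire → W) (tb : ℕ → ℕ → W) (b : ℕ) : List OGate → List (TStep W)
  | [] => []
  | .gate g :: l => .gate (g.map φ) :: label φ tb b l
  | .query :: l =>
    .query (φ ⟨.ask, 0, 0⟩) (fun j => φ ⟨.ans, 0, j⟩) (tb (ix l + b)) :: label φ tb b l

theorem label_toStep (φ : Wire → W) (tb : ℕ → ℕ → W) (b : ℕ) (l : List OGate) :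
    (label φ tb b l).map TStep.toStep = l.map (OGate.toStep φ) := by
  induction l with
  | nil => rfl
  | cons o l ih => cases o <;> simp [label, TStep.toStep, OGate.toStep, ih]

theorem label_tabs (φ : Wire → W) (tb : ℕ → ℕ → W) (b : ℕ) (l : List OGate) :
    (label φ tb b l).flatMap TStep.tabs = (idxs b l).map tb := by
  induction l with
  | nil => rfl
  | cons o l ih => cases o <;> simp [label, TStep.tabs, idxs, ih]

theorem map_loopDown {α β : Type} (f : α → β) (n : ℕ) (F : ℕ → List α) :
    (loopDown n F).map f = loopDown n fun p => (F p).map f := by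
  induction n with
  | zero => rfl
  | succ n ih => rw [loopDown, loopDown, List.map_append, ih]

theorem map_answer (φ : Wire → W) (L : ℕ) (t : ℕ → Wire) :
    (answer L t).map (Gate.map φ) = answerOn L (φ ⟨.ask, 0, 0⟩) (fun j => φ ⟨.ans, 0, j⟩)
      fun p => φ (t p) := by
  simp only [answer, answerOn, List.map_append, map_loopDown]
  rfl

theorem map_invCircuit {V : Type} (φ : V → W) (c : List (Gate V)) :
    (invCircuit c).map (Gate.map φ) = invCircuit (c.map (Gate.map φ)) := by
  simp only [invCircuit, List.map_reverse, List.map_map]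
  congr 1
  refine List.map_congr_left fun g _ => ?_
  cases g <;> rfl

theorem map_fetch (φ : Wire → W) (ev : Circuit) (N L : ℕ) (t : ℕ → Wire) :
    (fetch ev N L t).map (Gate.map φ) = fetchOn (ev.map (Gate.map fun w => φ (evw N w)))
      (fun p => φ ⟨.inp, 1 + N, p⟩) (φ ⟨.out, N, 0⟩) L fun p => φ (t p) := by
  have : (ev.map (Gate.map (evw N))).map (Gate.map φ) = ev.map (Gate.map fun w => φ (evw N w)) := by
    rw [List.map_map]
    exact List.map_congr_left fun g _ => Gate.map_map _ _ g
  simp only [fetch, fetchOn, List.map_append, map_loopDown, map_invCircuit, this]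
  rfl

theorem label_sim (φ : Wire → W) (L b : ℕ) (t : ℕ → ℕ → Wire) (l : List OGate) :
    (expand (fun g => [g]) (fun i => answer L (t i)) b l).map (Gate.map φ) =
      (label φ (fun i p => φ (t i p)) b l).flatMap (TStep.sim L) := by
  induction l with
  | nil => rfl
  | cons o l ih =>
    cases o with
    | gate g => simp [expand, label, TStep.sim, ih]
    | query => simp [expand, label, TStep.sim, ih, map_answer]

theorem within_toStep {φ : Wire → W} (hφ : Function.Injective φ) {S : Set W} {L : ℕ}
    {l : List OGate} (h : ∀ g, OGate.gate g ∈ l → ∀ w ∈ g.wires, φ w ∈ S)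
    (hm : φ ⟨.ask, 0, 0⟩ ∈ S) (ha : ∀ p ≤ L, φ ⟨.ans, 0, p⟩ ∈ S) :
    ∀ st ∈ l.map (OGate.toStep φ), st.Within L S := by
  intro st hst
  obtain ⟨o, ho, rfl⟩ := List.mem_map.1 hst
  cases o with
  | gate g =>
    intro w hw
    rw [Gate.wires_map, List.mem_map] at hw
    obtain ⟨w, hw, rfl⟩ := hw
    exact h g ho w hw
  | query =>
    exact ⟨hm, ha, fun p q e => by simpa using hφ e, fun p e => by simpa using hφ e⟩

end Label

/-! ## Table entries in a game -/

/-- The wires of the table entries in a game. -/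
def gtab (k : Kind) (N L reg idx p : ℕ) : GWire := (.pirate, tabWire k N L reg idx p)

/-- The set of all wires of tables. -/
def tabZone (N : ℕ) : Set GWire := {w | w.1 = .pirate ∧ N ≤ w.2.pos}

theorem isTab_gtab (k : Kind) (N L reg idx : ℕ) : IsTab L (tabZone N) (gtab k N L reg idx) :=
  ⟨fun p _ q _ h => by simpa [gtab, tabWire] using h,
    fun p _ => ⟨rfl, by simp only [gtab, tabWire]; omega⟩⟩

/-- Entries of one register occupy consecutive blocks of length `L + 1`, so division by `L + 1`
recovers the number of the entry. -/
theorem disj_gtab {k k' : Kind} {N L reg reg' idx idx' : ℕ}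
    (h : k ≠ k' ∨ reg ≠ reg' ∨ idx ≠ idx') :
    Disj L (gtab k N L reg idx) (gtab k' N L reg' idx') := by
  intro p hp q hq e
  simp only [gtab, tabWire, Prod.mk.injEq, Wire.mk.injEq, true_and] at e
  rcases h with h | h | h
  · exact h e.1
  · exact h e.2.1
  · have e' := e.2.2
    have h1 : idx * (L + 1) + p = idx' * (L + 1) + q := by omega
    have h2 : (idx * (L + 1) + p) / (L + 1) = idx := by
      rw [mul_comm, Nat.mul_add_div (by omega), Nat.div_eq_of_lt (by omega), add_zero]
    have h3 : (idx' * (L + 1) + q) / (L + 1) = idx' := by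
      rw [mul_comm, Nat.mul_add_div (by omega), Nat.div_eq_of_lt (by omega), add_zero]
    exact h (by rw [← h2, ← h3, h1])

theorem pirateWire_pos (n : ℕ) (w : Wire) : (pirateWire n w).2.pos = w.pos := by
  unfold pirateWire; split_ifs <;> rfl

theorem freeWire_pos (i : ℕ) (w : Wire) : (freeWire i w).2.pos = w.pos := by
  unfold freeWire; split_ifs <;> rfl

theorem pirateWire_gtab {k : Kind} (hk : k ≠ .inp) (n N L reg idx p : ℕ) :
    pirateWire n (tabWire k N L reg idx p) = gtab k N L reg idx p := by
  simp [pirateWire, tabWire, gtab, hk]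

/-- The table written by the pirate to its output register `i` is what the `i`-th freeloader finds
in its input register `0`. -/
theorem freeWire_gtab (i N L idx p : ℕ) :
    freeWire i (tabWire .inp N L 0 idx p) = gtab .out N L i idx p := by
  simp [freeWire, tabWire, gtab]

theorem notMem_tabZone {N : ℕ} {w : GWire} (h : w.2.pos < N) : w ∉ tabZone N :=
  fun h' => (h.trans_le h'.2).false

/-! ## Single freeloaders -/

/-- The indicator of the event that the answer of the `i`-th freeloader is `y`. -/
def answerIs (i : ℕ) (y : Bool) (s : Finset GWire) : ℝ :=
  if decide (((Party.free i, outBit) : GWire) ∈ s) = y then 1 else 0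

theorem answerIs_toggle {i : ℕ} {y : Bool} {w : GWire} (h : w ≠ (.free i, outBit))
    (s : Finset GWire) : answerIs i y (toggle s w) = answerIs i y s := by
  simp [answerIs, mem_toggle, h.symm]

theorem answerIs_toggle_self (i : ℕ) (y : Bool) (s : Finset GWire) :
    answerIs i y (toggle s (.free i, outBit)) = answerIs i (!y) s := by
  by_cases h : ((Party.free i, outBit) : GWire) ∈ s <;> cases y <;> simp [answerIs, mem_toggle, h]

theorem score_eq_sum {m : ℕ} (target : Fin m → Bool) :
    score target = fun s => ∑ i : Fin m, answerIs i (target i) s := by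
  funext s
  simp [score, answerIs]

/-- The wires that the `i`-th freeloader uses. -/
def freeZone (i : ℕ) : Set GWire :=
  {w | w.1 = .free i ∨ w.1 = .pirate ∧ w.2.kind = .out ∧ w.2.reg = i}

theorem freeWire_mem (i : ℕ) (w : Wire) : freeWire i w ∈ freeZone i := by
  unfold freeWire
  split_ifs
  exacts [.inr ⟨rfl, rfl, rfl⟩, .inl rfl]

theorem freeZone_disjoint {i j : ℕ} (h : i ≠ j) {w : GWire} (hw : w ∈ freeZone i) :
    w ∉ freeZone j := fun hw' => by
  rcases hw with hw | hw <;> rcases hw' with hw' | hw'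
  · rw [hw] at hw'; exact h (Party.free.inj hw')
  · rw [hw] at hw'; simp at hw'
  · rw [hw'] at hw; simp at hw
  · exact h (hw.2.2.symm.trans hw'.2.2)

variable {L : ℕ} {f : (Fin L → Bool) → Bool}

/-- Freeloaders act on pairwise disjoint zones, and the answer of one lies in its own zone. Those
after `i` are dropped at the end, those before `i` by `expRun_drop_left`. -/
theorem expRun_single {F : ℕ → List (Step GWire)} (hF : ∀ j, ∀ st ∈ F j, st.Within L (freeZone j))
    {i m : ℕ} (hi : i < m) (y : Bool) (l : List (Step GWire)) (ψ : State GWire) :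
    expRun (oracle f) (answerIs i y) (l ++ (List.range m).flatMap F) ψ =
      expRun (oracle f) (answerIs i y) (l ++ F i) ψ := by
  have hv : ∀ w ∈ {w | ∃ j ≠ i, w ∈ freeZone j}, ∀ s,
      answerIs i y (toggle s w) = answerIs i y s := by
    rintro w ⟨j, hj, hw⟩ s
    refine answerIs_toggle ?_ s
    rintro rfl
    exact freeZone_disjoint hj hw (.inl rfl)
  have hd : ∀ w ∈ {w | ∃ j ≠ i, w ∈ freeZone j}, w ∉ freeZone i := by
    rintro w ⟨j, hj, hw⟩
    exact freeZone_disjoint hj hw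
  obtain ⟨d, rfl⟩ : ∃ d, m = i + (1 + d) := ⟨m - i - 1, by omega⟩
  refine expRun_append_congr _ _ (fun ψ => ?_) l ψ
  rw [List.range_add, List.range_add, List.map_append, List.flatMap_append, List.flatMap_append]
  rw [← expRun_drop_left (f := f) (l := (List.range i).flatMap F) hd _ (hF i) hv]
  · refine expRun_append_congr _ _ (fun ψ => ?_) _ ψ
    have e : ((List.range 1).map (i + ·)).flatMap F = F i := by simp
    rw [e, ← List.append_nil (F i), List.append_assoc]
    refine expRun_append_congr _ _ (fun ψ => ?_) _ ψ
    rw [List.nil_append, expRun_drop _ hv, expRun]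
    intro st hst
    obtain ⟨j, hj, hst⟩ := List.mem_flatMap.1 hst
    simp only [List.mem_map, List.mem_range] at hj
    obtain ⟨a, ⟨b, hb, rfl⟩, rfl⟩ := hj
    exact (hF _ st hst).mono (S' := {w | ∃ j ≠ i, w ∈ freeZone j})
      fun w hw => ⟨_, by omega, hw⟩
  · intro st hst
    obtain ⟨j, hj, hst⟩ := List.mem_flatMap.1 hst
    exact (hF _ st hst).mono (S' := {w | ∃ j ≠ i, w ∈ freeZone j})
      fun w hw => ⟨j, (List.mem_range.1 hj).ne, hw⟩

/-- The initial state of a game with only the `i`-th freeloader. -/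
def soloInit (n i : ℕ) (key u : Content) : Finset GWire :=
  ((Finset.range n).biUnion fun i => load (fun j => (.source i, ⟨.inp, 0, j⟩)) key) ∪
    load (fun j => (.free i, ⟨.inp, 1, j⟩)) u

/-- The probability that the answer of the `i`-th freeloader is `y`, in a game without the other
freeloaders. -/
def solo (f : (Fin L → Bool) → Bool) (prog : Circuit) (key : Content) (n : ℕ) (A : Adversary OGate)
    (i : ℕ) (y : Bool) (u : Content) : ℝ :=
  expRun (oracle f) (answerIs i y) (((sources prog n).map .gate ++
    A.pirate.map (OGate.toStep (pirateWire n))) ++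
      (A.free.getD i []).map (OGate.toStep (freeWire i))) (ket (soloInit n i key u))

theorem sources_map_gate (prog : Circuit) (n : ℕ) :
    ((List.range n).flatMap fun i => prog.map fun g =>
      (Step.gate (g.map fun w => ((.source i, w) : GWire)))) = (sources prog n).map .gate := by
  simp only [sources, List.map_flatMap, List.map_map, Function.comp_def]

theorem within_free (L i : ℕ) (l : List OGate) :
    ∀ st ∈ l.map (OGate.toStep (freeWire i)), st.Within L (freeZone i) :=
  within_toStep (freeWire_injective i) (fun _ _ w _ => freeWire_mem i w) (freeWire_mem i _)
    fun _ _ => freeWire_mem i _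

theorem within_sources (prog : Circuit) (n : ℕ) :
    ∀ st ∈ (sources prog n).map Step.gate, st.Within L {w : GWire | ∃ i, w.1 = .source i} := by
  intro st hst
  obtain ⟨g, hg, rfl⟩ := List.mem_map.1 hst
  exact fun w hw => mem_cwires_sources (mem_cwires.2 ⟨g, hg, hw⟩)

theorem pirateWire_mem (n : ℕ) (w : Wire) :
    (∃ i, (pirateWire n w).1 = .source i) ∨ (pirateWire n w).1 = .pirate := by
  unfold pirateWire
  split_ifs
  exacts [.inl ⟨_, rfl⟩, .inr rfl]

theorem within_pirate (L n : ℕ) (l : List OGate) :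
    ∀ st ∈ l.map (OGate.toStep (pirateWire n)),
      st.Within L {w : GWire | (∃ i, w.1 = .source i) ∨ w.1 = .pirate} :=
  within_toStep (pirateWire_injective n) (fun _ _ w _ => pirateWire_mem n w) (pirateWire_mem n _)
    fun _ _ => pirateWire_mem n _

/-- The answer of a freeloader does not depend on the other freeloaders. -/
theorem expRun_game (prog : Circuit) (key : Content) (n : ℕ) {m : ℕ} (A : Adversary OGate)
    (chal : Fin m → Content) (i : Fin m) (y : Bool) :
    expRun (oracle f) (answerIs i y) (gameSteps prog n m A) (ket (gameInit n m key chal)) =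
      solo f prog key n A i y (chal i) := by
  rw [gameSteps, sources_map_gate, expRun_single (fun j => within_free L j _) i.2, solo]
  -- The challenges of the other freeloaders: toggles of wires that none of the remaining steps
  -- uses.
  set D : Finset GWire := (Finset.univ.filter fun j : Fin m => j ≠ i).biUnion fun j =>
    load (fun p => (.free j, ⟨.inp, 1, p⟩)) (chal j) with hD
  have hDm : ∀ w ∈ D, ∃ j : Fin m, j ≠ i ∧ w.1 = .free j := fun w hw => by
    obtain ⟨j, hj, hw⟩ := Finset.mem_biUnion.1 hw
    obtain ⟨p, _, rfl⟩ := Finset.mem_image.1 hw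
    exact ⟨j, (Finset.mem_filter.1 hj).2, rfl⟩
  have hne : ∀ {j : Fin m}, j ≠ i → (j : ℕ) ≠ i := fun h h' => h (Fin.ext h')
  have e : gameInit n m key chal = soloInit n i key (chal i) ∪ D := by
    rw [gameInit, soloInit, Finset.union_assoc]
    congr 1
    ext w
    simp only [hD, Finset.mem_biUnion, Finset.mem_union, Finset.mem_filter, Finset.mem_univ,
      true_and]
    constructor
    · rintro ⟨j, hj⟩
      by_cases h : j = i
      · exact .inl (h ▸ hj)
      · exact .inr ⟨j, h, hj⟩
    · rintro (h | ⟨j, _, h⟩)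
      exacts [⟨i, h⟩, ⟨j, h⟩]
  have hdisj : Disjoint (soloInit n i key (chal i)) D := Finset.disjoint_left.2 fun w hw hw' => by
    obtain ⟨j, hj, h⟩ := hDm w hw'
    rcases Finset.mem_union.1 hw with hw | hw
    · obtain ⟨a, _, hw⟩ := Finset.mem_biUnion.1 hw
      obtain ⟨p, _, rfl⟩ := Finset.mem_image.1 hw
      simp at h
    · obtain ⟨p, _, rfl⟩ := Finset.mem_image.1 hw
      exact hne hj (Party.free.inj h).symm
  rw [e, ← run_toggles hdisj]
  refine expRun_run (S := {w | ∀ j ≠ (i : ℕ), w.1 ≠ .free j}) ?_ ?_ ?_ _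
  · intro st hst
    simp only [List.mem_append] at hst
    rcases hst with (hst | hst) | hst
    · refine (within_sources prog n st hst).mono ?_
      rintro w ⟨a, h⟩ j _
      simp [h]
    · refine (within_pirate L n _ st hst).mono ?_
      rintro w (⟨a, h⟩ | h) j _ <;> simp [h]
    · refine (within_free L i _ st hst).mono ?_
      rintro w (h | h) j hj <;> simp [h, hj.symm]
  · intro w hw h
    obtain ⟨j, hj, h'⟩ := hDm w (mem_cwires_toggles.1 hw)
    exact h j (hne hj) h'
  · intro g hg s
    refine answerIs_toggle (fun e => ?_) s
    obtain ⟨j, hj, h⟩ := hDm _ (mem_cwires_toggles.1 (mem_cwires.2 ⟨g, hg, g.tgt_mem⟩))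
    rw [e] at h
    exact hne hj (Party.free.inj h).symm

/-- The answer of a missing freeloader is `0`. -/
theorem solo_missing (prog : Circuit) (key : Content) (n : ℕ) {A : Adversary OGate} {i : ℕ}
    (hi : A.free.length ≤ i) (y : Bool) (u : Content) :
    solo f prog key n A i y u = if y = false then 1 else 0 := by
  rw [solo, List.getD_eq_default _ _ hi, List.map_nil, List.append_nil,
    expRun_drop (S := {w | (∃ i, w.1 = .source i) ∨ w.1 = .pirate}), expect_ket]
  · have : ((Party.free i, outBit) : GWire) ∉ soloInit n i key u := fun h => by
      rcases Finset.mem_union.1 h with h | h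
      · obtain ⟨a, _, h⟩ := Finset.mem_biUnion.1 h
        obtain ⟨p, _, h⟩ := Finset.mem_image.1 h
        simp at h
      · obtain ⟨p, _, h⟩ := Finset.mem_image.1 h
        simp [outBit] at h
    simp [answerIs, this, eq_comm]
  · intro st hst
    rcases List.mem_append.1 hst with hst | hst
    · exact (within_sources prog n st hst).mono fun w hw => .inl hw
    · exact within_pirate L n _ st hst
  · rintro w (⟨a, h⟩ | h) s <;> refine answerIs_toggle (fun e => ?_) s <;> simp [e] at h

/-! ## The reduction simulates the oracle -/

theorem expect_x {W : Type} [DecidableEq W] (w : W) (ψ : State W) (v : Finset W → ℝ) :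
    expect ((Gate.x w).apply ψ) v = expect ψ fun s => v (toggle s w) := by
  have : (Gate.x w).op = Finsupp.lmapDomain ℂ ℂ fun s => toggle s w := by
    refine linear_ext fun s => ?_
    rw [← Gate.apply_eq, x_ket, Finsupp.lmapDomain_apply, ket, ket, Finsupp.mapDomain_single]
  rw [Gate.apply_eq, this, Finsupp.lmapDomain_apply, expect,
    Finsupp.sum_mapDomain_index_inj fun s t h => toggle_inj.1 h]
  rfl

/-- The random last bit of the challenge. -/
theorem expect_guess {φ : State GWire} {e c : GWire} {i : ℕ} (he : Has φ e false) (hec : e ≠ c)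
    (heo : e ≠ (.free i, outBit)) {l : List (Gate GWire)} (hl : e ∉ cwires l) (y : Bool) :
    expect (run ([.h e, .cx e c] ++ (l ++ [.cx e (.free i, outBit)])) φ) (answerIs i y) =
      𝔼 b : Bool, expect (run l (run (if b then [.x c] else []) φ)) (answerIs i (xor y b)) := by
  rw [List.cons_append, expect_coin he]
  · refine Finset.expect_congr rfl fun b _ => ?_
    have h₁ : Has (run (if b then [.x e] else []) φ) e b := by
      cases b
      · exact he
      · exact he.x
    have h₂ : Has (run l (run (if b then [.x c] else []) (run (if b then [.x e] else []) φ))) e b := by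
      refine (h₁.run ?_).run (tgt_ne_of_notMem hl)
      intro g hg h
      cases b <;> simp at hg
      subst hg
      exact hec h.symm
    rw [List.cons_append, List.nil_append, run_cons, h₁.cx hec, run_append, run_cons, run_nil,
      h₂.cx heo]
    cases b
    · simp only [Bool.false_eq_true, if_false, run_nil, Bool.xor_false]
    · simp only [if_true, run_cons, run_nil, Bool.xor_true]
      -- For `b = true` the final gate flips the answer, so the event to be tested before it is that
      -- of the opposite answer. The coin itself no longer matters.
      rw [x_comm c e, run_apply_comm (fun w hw => by rwa [List.mem_singleton.1 hw]), expect_x]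
      simp only [answerIs_toggle_self]
      exact Gate.expect_apply _ _ fun s => answerIs_toggle heo s
  · intro g hg h
    simp only [List.cons_append, List.nil_append, List.mem_cons, List.mem_append,
      List.not_mem_nil, or_false] at hg
    rcases hg with rfl | hg | rfl
    · exact hec h.symm
    · exact tgt_ne_of_notMem hl g hg h
    · exact heo h.symm

theorem tgt_sim {W : Type} {Z : Set W} {l : List (TStep W)}
    (hl : ∀ st ∈ l, st.toStep.Within L Zᶜ) {g : Gate W} (hg : g ∈ l.flatMap (TStep.sim L)) :
    g.tgt ∉ Z := by
  obtain ⟨st, hst, hg⟩ := List.mem_flatMap.1 hg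
  have hs := hl st hst
  cases st with
  | gate k =>
    rw [List.mem_singleton.1 hg]
    exact hs _ k.tgt_mem
  | query m a t =>
    rcases List.mem_append.1 hg with hg | hg
    · obtain ⟨p, hp, hg⟩ := mem_loopDown hg
      rw [List.mem_singleton.1 hg]
      exact hs.2.1 p (Nat.lt_succ_iff.1 hp)
    · rw [List.mem_singleton.1 hg]
      exact hs.2.1 L le_rfl

/-- Tables that are not used can be omitted. -/
theorem tavg_middle {W : Type} [DecidableEq W] {F : State W → ℝ} {T X T' Y : List (ℕ → W)}
    (hX : ∀ t ∈ X, ∀ u φ, F (run (write t (L + 1) u) φ) = F φ)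
    (hY : ∀ t ∈ Y, ∀ u φ, F (run (write t (L + 1) u) φ) = F φ)
    (hd : ∀ t ∈ X, ∀ t' ∈ T', Disj L t t') (ψ : State W) :
    tavg L f F (T ++ (X ++ T' ++ Y)) ψ = tavg L f F (T ++ T') ψ := by
  have e₁ : tavg L f F Y = F := funext (tavg_const hY)
  have e₂ : tavg L f (tavg L f F T') X = tavg L f F T' := funext fun φ => by
    refine tavg_const (fun t ht u φ => ?_) φ
    rw [tavg_run]
    · simp only [hX t ht u]
    · intro t' ht' p hp h
      obtain ⟨q, hq, e⟩ := mem_cwires_write h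
      exact hd t ht t' ht' q (Nat.lt_succ_iff.1 hq) p hp e.symm
  have e₃ : tavg L f F (X ++ T' ++ Y) = tavg L f F T' := funext fun φ => by
    rw [tavg_append, e₁, tavg_append, e₂]
  rw [tavg_append, e₃, tavg_append]

/-- Adding the guess to the challenge `x`, whose position `L` is still empty, gives the challenge
with last bit `b`. -/
theorem soloInit_snoc (n i : ℕ) (key : Content) (x : Fin L → Bool) (b : Bool) :
    run (if b then [.x (.free i, ⟨.inp, 1, L⟩)] else []) (ket (soloInit n i key (bits x))) =
      ket (soloInit n i key (bits (Fin.snoc (α := fun _ => Bool) x b))) := by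
  have hb : bits (Fin.snoc (α := fun _ => Bool) x b) = if b then insert L (bits x) else bits x := by
    rw [bits_snoc, bits_eq x b, Finset.range_add_one, Finset.filter_insert, ent_self]
  rw [hb]
  cases b
  · rfl
  · simp only [if_true, run_cons, run_nil, x_ket]
    rw [toggle_of_notMem, soloInit, soloInit, load, load, Finset.image_insert, Finset.union_insert]
    intro h
    rcases Finset.mem_union.1 h with h | h
    · obtain ⟨a, _, h⟩ := Finset.mem_biUnion.1 h
      obtain ⟨p, _, h⟩ := Finset.mem_image.1 h
      simp at h
    · obtain ⟨p, hp, h⟩ := Finset.mem_image.1 h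
      simp only [Prod.mk.injEq, Wire.mk.injEq, true_and] at h
      subst h
      simp [bits_eq x false] at hp

section Simulation
variable {prog ev : Circuit} {key : Content} {n N : ℕ} {A : Adversary OGate}

theorem evals_solo
    (hc : ∀ x, prob (prepEval prog ev key (bits x)) {s | decide (Sum.inr outBit ∈ s) = f x} = 1)
    (hn : 1 ≤ n) (hN : n ≤ N) (i : ℕ) (u : Content) :
    Evals (ev.map (Gate.map fun w => pirateWire n (evw N w)))
      (fun p => pirateWire n ⟨.inp, 1 + N, p⟩) (pirateWire n ⟨.out, N, 0⟩) L f
      (run (sources prog n) (ket (soloInit n i key u))) := by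
  obtain ⟨n, rfl⟩ : ∃ n', n = n' + 1 := ⟨n - 1, by omega⟩
  have e : soloInit (n + 1) i key u = load (fun j => ((.source 0, ⟨.inp, 0, j⟩) : GWire)) key ∪
      (((Finset.range n).biUnion fun i => load (fun j => (.source (i + 1), ⟨.inp, 0, j⟩)) key) ∪
        load (fun j => (.free i, ⟨.inp, 1, j⟩)) u) := by
    rw [soloInit, ← Finset.union_assoc]
    congr 1
    ext w
    simp only [Finset.mem_biUnion, Finset.mem_union, Finset.mem_range]
    constructor
    · rintro ⟨a, ha, h⟩
      cases a with
      | zero => exact .inl h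
      | succ a => exact .inr ⟨a, by omega, h⟩
    · rintro (h | ⟨a, ha, h⟩)
      exacts [⟨0, by omega, h⟩, ⟨a + 1, by omega, h⟩]
  rw [e]
  refine evals_sources hc hn hN fun w hw => ?_
  rcases Finset.mem_union.1 hw with h | h
  · obtain ⟨a, _, h⟩ := Finset.mem_biUnion.1 h
    obtain ⟨p, _, rfl⟩ := Finset.mem_image.1 h
    exact .inl ⟨a, rfl⟩
  · obtain ⟨p, _, rfl⟩ := Finset.mem_image.1 h
    exact .inr ⟨i, rfl⟩

/-- Brings the pirate into the form to which `expect_fetches` and `tavg_sim` apply: first all table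
entries, then the simulated steps. -/
theorem map_reduction_pirate (ev : Circuit) (n N L : ℕ) (A : Adversary OGate) :
    (reduction ev N L A).pirate.map (Gate.map (pirateWire n)) =
      ((idxs 0 A.pirate).map (gtab .ans N L 0) ++
        (idxFree 0 A.free).map fun x => gtab .out N L x.1 x.2).flatMap
          (fetchOn (ev.map (Gate.map fun w => pirateWire n (evw N w)))
            (fun p => pirateWire n ⟨.inp, 1 + N, p⟩) (pirateWire n ⟨.out, N, 0⟩) L) ++
      (label (pirateWire n) (gtab .ans N L 0) 0 A.pirate).flatMap (TStep.sim L) := by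
  have h := fun r idx => funext (pirateWire_gtab (k := .ans) (by simp) n N L r idx)
  have h' := fun r idx => funext (pirateWire_gtab (k := .out) (by simp) n N L r idx)
  have h₀ : (fun idx p => pirateWire n (tabWire .ans N L 0 idx p)) = gtab .ans N L 0 := funext (h 0)
  simp only [reduction, List.map_append, label_sim, expand_nil, fetchFree_eq, List.map_flatMap,
    map_fetch, List.flatMap_append, List.flatMap_map, List.append_assoc, h, h', h₀]

theorem map_reduction_free (ev : Circuit) (N L : ℕ) {A : Adversary OGate} {i : ℕ}
    (hi : i < A.free.length) :
    ((reduction ev N L A).free.getD i []).map (Gate.map (freeWire i)) =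
      [.h (.free i, ⟨.work, N, 0⟩), .cx (.free i, ⟨.work, N, 0⟩) (.free i, ⟨.inp, 1, L⟩)] ++
        ((label (freeWire i) (gtab .out N L i) (ixFree (A.free.drop (i + 1)))
          A.free[i]).flatMap (TStep.sim L) ++
            [.cx (.free i, ⟨.work, N, 0⟩) (.free i, outBit)]) := by
  have h : (fun idx p => freeWire i (tabWire .inp N L 0 idx p)) = gtab .out N L i :=
    funext fun idx => funext (freeWire_gtab i N L idx)
  have h₁ : freeWire i ⟨.inp, 1, L⟩ = (.free i, ⟨.inp, 1, L⟩) := by simp [freeWire]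
  have h₂ : freeWire i ⟨.work, N, 0⟩ = (.free i, ⟨.work, N, 0⟩) := by simp [freeWire]
  have h₃ : freeWire i outBit = (.free i, outBit) := by simp [freeWire, outBit]
  simp only [reduction, simFree_getD, hi, dif_pos, List.map_append, label_sim, guessBit, unguess,
    List.map_cons, List.map_nil, Gate.map, h, h₁, h₂, h₃]

/-- The pirate and a freeloader, on random tables. -/
theorem expect_simulation
    (hc : ∀ x, prob (prepEval prog ev key (bits x)) {s | decide (Sum.inr outBit ∈ s) = f x} = 1)
    (hn : 1 ≤ n) (hN : n ≤ N) (hL : L < N) (hp : Low N A.pirate) (hf : ∀ l ∈ A.free, Low N l)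
    (hev : ∀ g ∈ ev, ∀ w ∈ g.wires, w.pos < N) {i : ℕ} (hi : i < A.free.length) (y : Bool)
    (u : Content) :
    expect (run ((sources prog n ++ (reduction ev N L A).pirate.map (Gate.map (pirateWire n))) ++
      (label (freeWire i) (gtab .out N L i) (ixFree (A.free.drop (i + 1)))
        A.free[i]).flatMap (TStep.sim L)) (ket (soloInit n i key u))) (answerIs i y) =
      solo f prog key n A i y u := by
  set lP := label (pirateWire n) (gtab .ans N L 0) 0 A.pirate with hlP
  set lF := label (freeWire i) (gtab .out N L i) (ixFree (A.free.drop (i + 1))) A.free[i] with hlF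
  set T := (idxs 0 A.pirate).map (gtab .ans N L 0) with hTd
  obtain ⟨X, Y, hXY, hX, hY⟩ := idxFree_split 0 A.free i hi
  rw [zero_add] at hXY hX hY
  have hv : ∀ w ∈ tabZone N, ∀ s, answerIs i y (toggle s w) = answerIs i y s := fun w hw s => by
    refine answerIs_toggle (fun e => ?_) s
    have := hw.1
    rw [e] at this
    simp at this
  have hlZ : ∀ st ∈ lP ++ lF, st.toStep.Within L (tabZone N)ᶜ := by
    have h1 : ∀ st ∈ (lP ++ lF).map TStep.toStep, st.Within L (tabZone N)ᶜ := by
      rw [List.map_append, hlP, hlF, label_toStep, label_toStep]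
      intro st hst
      rcases List.mem_append.1 hst with hst | hst
      · refine within_toStep (pirateWire_injective n) (fun g hg w hw => notMem_tabZone ?_)
          (notMem_tabZone ?_) (fun p hp => notMem_tabZone ?_) st hst <;> rw [pirateWire_pos]
        · exact (hp g hg w hw).2
        · exact (Nat.zero_le L).trans_lt hL
        · exact hp.trans_lt hL
      · refine within_toStep (freeWire_injective i) (fun g hg w hw => notMem_tabZone ?_)
          (notMem_tabZone ?_) (fun p hp => notMem_tabZone ?_) st hst <;> rw [freeWire_pos]
        · exact (hf _ (List.getElem_mem hi) g hg w hw).2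
        · exact (Nat.zero_le L).trans_lt hL
        · exact hp.trans_lt hL
    exact fun st hst => h1 _ (List.mem_map_of_mem hst)
  have htabs : (lP ++ lF).flatMap TStep.tabs =
      T ++ (idxs (ixFree (A.free.drop (i + 1))) A.free[i]).map (gtab .out N L i) := by
    rw [List.flatMap_append, hlP, hlF, label_tabs, label_tabs]
  have hTF : (idxFree 0 A.free).map (fun x => gtab .out N L x.1 x.2) =
      X.map (fun x => gtab .out N L x.1 x.2) ++
        (idxs (ixFree (A.free.drop (i + 1))) A.free[i]).map (gtab .out N L i) ++
          Y.map fun x => gtab .out N L x.1 x.2 := by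
    rw [hXY, List.map_append, List.map_append, List.map_map]
    rfl
  have hTab : ∀ t ∈ T ++ (idxFree 0 A.free).map fun x => gtab .out N L x.1 x.2,
      IsTab L (tabZone N) t := by
    intro t ht
    rcases List.mem_append.1 ht with ht | ht <;> obtain ⟨a, _, rfl⟩ := List.mem_map.1 ht <;>
      exact isTab_gtab _ _ _ _ _
  have hd : (T ++ (idxFree 0 A.free).map fun x => gtab .out N L x.1 x.2).Pairwise (Disj L) := by
    rw [List.pairwise_append]
    refine ⟨?_, ?_, ?_⟩
    · exact List.pairwise_map.2 ((idxs_nodup 0 A.pirate).imp fun h =>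
        disj_gtab (.inr (.inr h)))
    · exact List.pairwise_map.2 ((idxFree_nodup 0 A.free).imp fun {a b} h => disj_gtab (by
        by_contra hn
        push Not at hn
        exact h (Prod.ext hn.2.1 hn.2.2)))
    · intro t ht t' ht'
      obtain ⟨a, _, rfl⟩ := List.mem_map.1 ht
      obtain ⟨b, _, rfl⟩ := List.mem_map.1 ht'
      exact disj_gtab (.inl (by simp))
  have hsub : ((lP ++ lF).flatMap TStep.tabs).Sublist
      (T ++ (idxFree 0 A.free).map fun x => gtab .out N L x.1 x.2) := by
    rw [htabs, hTF]
    refine (List.Sublist.refl T).append ?_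
    rw [List.append_assoc]
    exact (List.sublist_append_left _ _).trans (List.sublist_append_right _ _)
  have h0 : ∀ t ∈ T ++ (idxFree 0 A.free).map fun x => gtab .out N L x.1 x.2, ∀ p ≤ L,
      Has (run (sources prog n) (ket (soloInit n i key u))) (t p) false := by
    intro t ht p hp
    have h1 := ((hTab t ht).2 p hp).1
    have h2 : t p ∉ soloInit n i key u := fun h => by
      rcases Finset.mem_union.1 h with h | h
      · obtain ⟨a, _, h⟩ := Finset.mem_biUnion.1 h
        obtain ⟨p, _, h⟩ := Finset.mem_image.1 h
        rw [← h] at h1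
        simp at h1
      · obtain ⟨p, _, h⟩ := Finset.mem_image.1 h
        rw [← h] at h1
        simp at h1
    have h3 := has_ket (soloInit n i key u) (t p)
    rw [decide_eq_false h2] at h3
    refine h3.run fun g hg e => ?_
    obtain ⟨a, h⟩ := mem_cwires_sources (mem_cwires.2 ⟨g, hg, g.tgt_mem⟩)
    rw [e, h1] at h
    simp at h
  -- Neither the pirate nor the `i`-th freeloader uses the table entries of another freeloader, so
  -- what is written there is irrelevant.
  have hinv : ∀ x : ℕ × ℕ, x.1 ≠ i → ∀ u φ,
      expect (run ((lP ++ lF).flatMap (TStep.sim L))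
        (run (write (gtab .out N L x.1 x.2) (L + 1) u) φ)) (answerIs i y) =
      expect (run ((lP ++ lF).flatMap (TStep.sim L)) φ) (answerIs i y) := by
    intro x hx u φ
    have hw : ∀ w ∈ cwires (write (gtab .out N L x.1 x.2) (L + 1) u), ∃ p ≤ L,
        w = gtab .out N L x.1 x.2 p := fun w hw => by
      obtain ⟨p, hp, rfl⟩ := mem_cwires_write hw
      exact ⟨p, Nat.lt_succ_iff.1 hp, rfl⟩
    have hz := (isTab_gtab .out N L x.1 x.2).2
    rw [run_comm, run_expect]
    · intro g hg
      obtain ⟨p, hp, e⟩ := hw _ (mem_cwires.2 ⟨g, hg, g.tgt_mem⟩)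
      exact hv _ (e ▸ hz p hp)
    · intro w hw' h
      obtain ⟨p, hp, rfl⟩ := hw w hw'
      rcases mem_cwires_sim hlZ h with h | ⟨t', ht', q, hq, e⟩
      · exact h (hz p hp)
      · rw [htabs, List.mem_append] at ht'
        rcases ht' with ht' | ht' <;> obtain ⟨a, _, rfl⟩ := List.mem_map.1 ht'
        · exact disj_gtab (.inl (by simp)) p hp q hq e
        · exact disj_gtab (.inr (.inl hx)) p hp q hq e
  -- Fetching becomes an average over random tables, the tables of the other freeloaders are
  -- omitted, and the remaining tables are traded for the oracle.
  rw [map_reduction_pirate, ← hTd, ← hlP, List.append_assoc, List.append_assoc,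
    ← List.flatMap_append, run_append, expect_fetches (f := f) (Z := tabZone N) _ _ _ hTab hd _ _
      (evals_solo hc hn hN i u) fun t ht p hp => h0 t ht p hp.le, hTF,
    tavg_middle (X := X.map fun x => gtab .out N L x.1 x.2)
      (Y := Y.map fun x => gtab .out N L x.1 x.2), ← htabs,
    tavg_sim hv hlZ (fun t ht => hTab t (hsub.subset ht)) (hd.sublist hsub)
      fun t ht => h0 t (hsub.subset ht)]
  · rw [List.map_append, hlP, hlF, label_toStep, label_toStep, solo, List.append_assoc,
      expRun_gates, List.getD_eq_getElem _ _ hi]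
  · intro t ht
    obtain ⟨x, hx, rfl⟩ := List.mem_map.1 ht
    exact hinv x (hX x hx)
  · intro t ht
    obtain ⟨x, hx, rfl⟩ := List.mem_map.1 ht
    exact hinv x (hY x hx)
  · intro t ht t' ht'
    obtain ⟨x, hx, rfl⟩ := List.mem_map.1 ht
    obtain ⟨a, _, rfl⟩ := List.mem_map.1 ht'
    exact disj_gtab (.inr (.inl (hX x hx)))
  · intro w' hw'
    obtain ⟨w, hw, rfl⟩ := mem_cwires_map.1 hw'
    obtain ⟨g, hg, hw⟩ := mem_cwires.1 hw
    refine notMem_tabZone ?_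
    have : (evw N w).pos = w.pos := by unfold evw; split_ifs <;> rfl
    rw [pirateWire_pos, this]
    exact hev g hg w hw
  · intro p hp
    exact notMem_tabZone (by rw [pirateWire_pos]; exact hp.trans hL)
  · exact notMem_tabZone (by rw [pirateWire_pos]; exact (Nat.zero_le L).trans_lt hL)
  · intro t ht p hp g hg e
    exact tgt_sim hlZ hg (e ▸ (hTab t ht).2 p hp.le)

theorem lift_free_getD (A : Adversary (Gate Wire)) (i : ℕ) :
    A.lift.free.getD i [] = (A.free.getD i []).map .gate :=
  List.getD_map A.free [] (List.map OGate.gate)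

theorem map_gate_toStep {W : Type} (φ : Wire → W) (c : Circuit) :
    (c.map OGate.gate).map (OGate.toStep φ) = (c.map (Gate.map φ)).map Step.gate := by
  simp only [List.map_map]
  rfl

/-- The reduction guesses a bit `c`, and succeeds with it like the original adversary. -/
theorem solo_reduction
    (hc : ∀ x, prob (prepEval prog ev key (bits x)) {s | decide (Sum.inr outBit ∈ s) = f x} = 1)
    (hn : 1 ≤ n) (hN : n ≤ N) (hL : L < N) (hp : Low N A.pirate) (hf : ∀ l ∈ A.free, Low N l)
    (hev : ∀ g ∈ ev, ∀ w ∈ g.wires, w.pos < N) {i : ℕ} (hi : i < A.free.length) (y : Bool)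
    (x : Fin L → Bool) :
    solo f prog key n (reduction ev N L A).lift i y (bits x) =
      𝔼 c : Bool, solo f prog key n A i (xor y c) (bits (Fin.snoc (α := fun _ => Bool) x c)) := by
  have hsp : ∀ w ∈ cwires (sources prog n ++
      (reduction ev N L A).pirate.map (Gate.map (pirateWire n))),
      (∃ i, w.1 = .source i) ∨ w.1 = .pirate := fun w hw => by
    rw [cwires_append, List.mem_append] at hw
    rcases hw with hw | hw
    · exact .inl (mem_cwires_sources hw)
    · obtain ⟨w, _, rfl⟩ := mem_cwires_map.1 hw
      exact pirateWire_mem n w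
  have hne : ∀ w : Wire, ((.free i, w) : GWire) ∉ cwires (sources prog n ++
      (reduction ev N L A).pirate.map (Gate.map (pirateWire n))) := fun w hw => by
    rcases hsp _ hw with ⟨a, h⟩ | h <;> simp at h
  rw [solo, lift_free_getD, map_gate_toStep, Adversary.lift, map_gate_toStep, ← List.map_append,
    ← List.map_append, ← List.append_nil (List.map _ _), expRun_gates, expRun, run_append,
    map_reduction_free ev N L hi, expect_guess]
  · refine Finset.expect_congr rfl fun b _ => ?_
    rw [← expect_simulation hc hn hN hL hp hf hev hi, run_append _ (List.flatMap _ _),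
      ← soloInit_snoc, run_comm (c := sources prog n ++ _)]
    intro w hw hw'
    cases b <;> simp [cwires, Gate.wires] at hw
    exact hne _ (hw ▸ hw')
  · have h1 : ((.free i, ⟨.work, N, 0⟩) : GWire) ∉ soloInit n i key (bits x) := fun h => by
      rcases Finset.mem_union.1 h with h | h
      · obtain ⟨a, _, h⟩ := Finset.mem_biUnion.1 h
        obtain ⟨p, _, h⟩ := Finset.mem_image.1 h
        simp at h
      · obtain ⟨p, _, h⟩ := Finset.mem_image.1 h
        simp at h
    have h2 := has_ket (soloInit n i key (bits x)) (.free i, ⟨.work, N, 0⟩)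
    rw [decide_eq_false h1] at h2
    exact h2.run (tgt_ne_of_notMem (hne _))
  · simp
  · simp [outBit]
  · intro h
    -- The guess sits in work register `N`, while the registers used by the gates of the freeloader
    -- are numbered below `N`.
    have hl : ∀ st ∈ label (freeWire i) (gtab .out N L i) (ixFree (A.free.drop (i + 1))) A.free[i],
        st.toStep.Within L ({((.free i, ⟨.work, N, 0⟩) : GWire)}ᶜ) := fun st hst => by
      have := List.mem_map_of_mem (f := TStep.toStep) hst
      rw [label_toStep] at this
      refine within_toStep (freeWire_injective i) (fun g hg w hw => ?_) ?_ (fun p _ => ?_) _ this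
      · intro e
        have h1 := (hf _ (List.getElem_mem hi) g hg w hw).1
        unfold freeWire at e
        split_ifs at e with h2
        · simp at e
        · simp at e
          rw [e] at h1
          exact h1.false
      · simp [freeWire]
      · simp [freeWire]
    rcases mem_cwires_sim hl h with h | ⟨t, ht, p, _, e⟩
    · exact h rfl
    · rw [label_tabs] at ht
      obtain ⟨a, _, rfl⟩ := List.mem_map.1 ht
      simp [gtab] at e

end Simulation

/-! ## Averages -/

/-- A coordinate of a uniform tuple is uniform. This makes independent challenges as good as a
common one, as each term involves a single coordinate. -/
theorem expect_pi {m : ℕ} {α : Type} [Fintype α] [Nonempty α] (i : Fin m) (F : α → ℝ) :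
    𝔼 b : Fin m → α, F (b i) = 𝔼 a, F a := by
  rw [Fintype.expect_equiv (Equiv.funSplitAt i α) (fun b => F (b i)) (fun p => F p.1)
    fun _ => rfl, ← Finset.univ_product_univ, Finset.expect_product]
  simp only [Fintype.expect_const]

theorem sampleExpect_congr {c : Circuit} {v w : Content → ℝ} (h : ∀ u ∈ sampleSupport c, v u = w u) :
    sampleExpect c v = sampleExpect c w :=
  Finset.sum_congr rfl fun s hs => congrArg (_ * ·) (h _ ⟨s, hs, rfl⟩)

theorem sampleExpect_add (c : Circuit) (v w : Content → ℝ) :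
    sampleExpect c (fun u => v u + w u) = sampleExpect c v + sampleExpect c w := by
  simp only [sampleExpect, expect, Finsupp.sum, mul_add, Finset.sum_add_distrib]

theorem sampleExpect_mul (c : Circuit) (a : ℝ) (v : Content → ℝ) :
    sampleExpect c (fun u => a * v u) = a * sampleExpect c v := by
  simp only [sampleExpect, expect, Finsupp.sum, Finset.mul_sum]
  exact Finset.sum_congr rfl fun s _ => by ring

theorem sampleExpect_one (c : Circuit) : sampleExpect c (fun _ => 1) = 1 := by
  rw [sampleExpect, sampleState, run_expect _ _ fun _ _ _ => rfl, expect_ket]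

/-! ## Comparing the games -/

section Games
variable {L : ℕ} {f : (Fin L → Bool) → Bool} {prog : Circuit} {key : Content} {n m : ℕ}

theorem playGame_eq_sum (A : Adversary OGate) (chal : Fin m → Content) (target : Fin m → Bool) :
    playGame prog key n m (oracle f) chal target A =
      ∑ i : Fin m, solo f prog key n A i (target i) (chal i) := by
  rw [playGame, score_eq_sum, expRun_sum]
  exact Finset.sum_congr rfl fun i _ => expRun_game prog key n A chal i _

theorem playGame_lift {R R' : Type} [Fintype R] [Fintype R'] (resp : Bool → R → Content)
    (resp' : Bool → R' → Content) (A : Adversary (Gate Wire)) (chal : Fin m → Content)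
    (target : Fin m → Bool) :
    playGame prog key n m resp chal target A.lift = playGame prog key n m resp' chal target A.lift := by
  have h : gameSteps prog n m A.lift = (sources prog n ++ A.pirate.map (Gate.map (pirateWire n)) ++
      (List.range m).flatMap fun i => (A.free.getD i []).map (Gate.map (freeWire i))).map .gate := by
    rw [gameSteps, sources_map_gate]
    simp only [lift_free_getD, map_gate_toStep, List.map_append, List.map_flatMap]
    rw [Adversary.lift, map_gate_toStep]
  rw [playGame, playGame, h, ← List.append_nil (List.map _ _), expRun_gates, expRun_gates]
  rfl

/-- The number of missing freeloaders. -/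
def missing (m : ℕ) (A : Adversary OGate) : ℕ :=
  (Finset.univ.filter fun i : Fin m => A.free.length ≤ i).card

theorem expect_real (A : Adversary OGate) :
    (𝔼 b : Fin m → Bool, 𝔼 r : Fin m → Fin L → Bool, playGame prog key n m (oracle f)
      (fun i => oracle f (b i) (r i)) b A) =
      ∑ i : Fin m, 𝔼 x : Fin L → Bool, 𝔼 c : Bool,
        solo f prog key n A i (xor (f x) c) (bits (Fin.snoc (α := fun _ => Bool) x c)) := by
  simp only [playGame_eq_sum, Finset.expect_sum_comm]
  refine Finset.sum_congr rfl fun i _ => ?_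
  calc _ = 𝔼 a : Bool, 𝔼 x : Fin L → Bool, solo f prog key n A i a (oracle f a x) := by
        rw [← expect_pi i fun a => 𝔼 x : Fin L → Bool, solo f prog key n A i a (oracle f a x)]
        refine Finset.expect_congr rfl fun b _ => ?_
        exact expect_pi i fun x => solo f prog key n A i (b i) (oracle f (b i) x)
    _ = _ := by
        -- For fixed `x` the message `a` and the last ciphertext bit `c` determine each other by `a
        -- = f x ⊕ c`, so uniform messages mean uniform `c`.
        rw [Finset.expect_comm]
        refine Finset.expect_congr rfl fun x _ => ?_
        simp only [Fintype.expect_eq_sum_div_card, Fintype.sum_bool, oracle]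
        cases f x <;> simp [add_comm]

/-- Term by term, the two games agree exactly for freeloaders in the list. A missing one answers
`0`, which is right with probability `1 / 2` on the left and with probability `Pr[f(x) = 0]` on the
right. -/
theorem real_eq_sim {ev : Circuit} {N : ℕ} {A : Adversary OGate}
    (hc : ∀ x, prob (prepEval prog ev key (bits x)) {s | decide (Sum.inr outBit ∈ s) = f x} = 1)
    (hn : 1 ≤ n) (hN : n ≤ N) (hL : L < N) (hp : Low N A.pirate) (hf : ∀ l ∈ A.free, Low N l)
    (hev : ∀ g ∈ ev, ∀ w ∈ g.wires, w.pos < N) :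
    (𝔼 b : Fin m → Bool, 𝔼 r : Fin m → Fin L → Bool, playGame prog key n m (oracle f)
      (fun i => oracle f (b i) (r i)) b A) =
    (𝔼 x : Fin L → Bool, playGame prog key n m (fun (_ : Bool) (_ : Unit) => ∅)
      (fun _ => bits x) (fun _ => f x) (reduction ev N L A).lift) +
      missing m A * (1 / 2 + -1 * 𝔼 x : Fin L → Bool, if f x = false then (1 : ℝ) else 0) := by
  have hfree : (reduction ev N L A).lift.free.length = A.free.length := by
    have : ∀ l, (simFree N L l).length = l.length := fun l => by
      induction l with
      | nil => rfl
      | cons o l ih => simp [simFree, ih]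
    simp [Adversary.lift, reduction, this]
  have h1 : (missing m A : ℝ) * (1 / 2 + -1 * 𝔼 x : Fin L → Bool, if f x = false then (1 : ℝ) else 0) =
      ∑ i : Fin m, if A.free.length ≤ i then
        (1 / 2 + -1 * 𝔼 x : Fin L → Bool, if f x = false then (1 : ℝ) else 0) else 0 := by
    rw [← Finset.sum_filter, Finset.sum_const, nsmul_eq_mul, missing]
  rw [expect_real, h1]
  -- The reduction makes no queries, so the trivial oracle may be replaced by that of the scheme to
  -- express both games by `solo`.
  simp only [playGame_lift (fun (_ : Bool) (_ : Unit) => ∅) (oracle f), playGame_eq_sum,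
    Finset.expect_sum_comm]
  rw [← Finset.sum_add_distrib]
  refine Finset.sum_congr rfl fun i _ => ?_
  split_ifs with hi
  · simp only [solo_missing prog key n hi, solo_missing prog key n (hfree.trans_le hi)]
    have : ∀ x : Fin L → Bool, (𝔼 c : Bool, if (f x ^^ c) = false then (1 : ℝ) else 0) = 1 / 2 :=
      fun x => by
        simp only [Fintype.expect_eq_sum_div_card, Fintype.sum_bool]
        cases f x <;> simp
    simp only [this, Fintype.expect_const]
    ring
  · rw [add_zero]
    exact Finset.expect_congr rfl fun x _ =>
      (solo_reduction hc hn hN hL hp hf hev (not_le.1 hi) (f x) x).symm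

end Games

theorem missing_le (m : ℕ) (A : Adversary OGate) : missing m A ≤ m :=
  (Finset.card_filter_le _ _).trans_eq (by simp)

/-- The reduction loses at most the imbalance of the function, for every missing freeloader. -/
theorem qcpaGame_le {B : BBF} (Q : QCP B) {n k κ N : ℕ} {A : Adversary OGate}
    (hn : 1 ≤ n) (hN : n ≤ N) (hL : B.len.eval κ < N) (hp : Low N A.pirate)
    (hf : ∀ l ∈ A.free, Low N l) (hev : ∀ g ∈ Q.eval κ, ∀ w ∈ g.wires, w.pos < N) :
    (oneUDcpa Q).qcpaGame n k κ A ≤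
      Q.weakGame n k κ (reduction (Q.eval κ) N (B.len.eval κ) A) + ((n + k : ℕ) : ℝ) *
        |(sampleExpect (B.sample κ) fun f =>
            𝔼 x : Fin (B.len.eval κ) → Bool, if B.fn κ f x = false then (1 : ℝ) else 0) -
          (sampleExpect (B.sample κ) fun f =>
            𝔼 x : Fin (B.len.eval κ) → Bool, if B.fn κ f x = true then (1 : ℝ) else 0)| := by
  set M : ℝ := (missing (n + k) A : ℝ) with hM
  set p₀ := sampleExpect (B.sample κ) fun f =>
    𝔼 x : Fin (B.len.eval κ) → Bool, if B.fn κ f x = false then (1 : ℝ) else 0 with hp₀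
  set p₁ := sampleExpect (B.sample κ) fun f =>
    𝔼 x : Fin (B.len.eval κ) → Bool, if B.fn κ f x = true then (1 : ℝ) else 0 with hp₁
  have h₁ : p₀ + p₁ = 1 := by
    rw [hp₀, hp₁, ← sampleExpect_add]
    refine Eq.trans (congrArg _ (funext fun u => ?_)) (sampleExpect_one (B.sample κ))
    rw [← Finset.expect_add_distrib]
    refine Eq.trans (Finset.expect_congr rfl fun x _ => ?_) (Fintype.expect_const (1 : ℝ))
    cases B.fn κ u x <;> simp
  have h₂ : (oneUDcpa Q).qcpaGame n k κ A =
      Q.weakGame n k κ (reduction (Q.eval κ) N (B.len.eval κ) A) + M * (1 / 2 + -1 * p₀) := by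
    have hh : sampleExpect (B.sample κ) (fun _ => 1 / 2) = 1 / 2 := by
      have := sampleExpect_mul (B.sample κ) (1 / 2) fun _ => 1
      rwa [sampleExpect_one, mul_one] at this
    nth_rw 1 [← hh]
    rw [hp₀, ← sampleExpect_mul, ← sampleExpect_add, ← sampleExpect_mul, QCP.weakGame,
      ← sampleExpect_add]
    -- The equality holds key by key, for keys in the support of the sampling, where correctness is
    -- guaranteed.
    exact sampleExpect_congr fun u hu => real_eq_sim (Q.correct κ u hu) hn hN hL hp hf hev
  rw [h₂, add_le_add_iff_left]
  have h₃ : M ≤ ((n + k : ℕ) : ℝ) := Nat.cast_le.2 (missing_le _ _)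
  -- As `p₀ + p₁ = 1`, the left side is half of `p₁ - p₀`.
  have h₄ : 1 / 2 + -1 * p₀ ≤ |p₀ - p₁| := by
    have := neg_abs_le (p₀ - p₁)
    have := abs_nonneg (p₀ - p₁)
    linarith
  calc M * (1 / 2 + -1 * p₀) ≤ M * |p₀ - p₁| := by gcongr
    _ ≤ _ := by gcongr

end CopyProt

end

/-! ### The asymptotic statement -/

theorem mainTheorem1 (B : CopyProt.BBF) (Q : CopyProt.QCP B) (n k : ℕ → ℕ)
    (hn : CopyProt.PolyBounded n) (hk : CopyProt.PolyBounded k) (hpos : ∀ κ, 1 ≤ n κ)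
    (hQ : Q.WeakSecure n k) :
    (CopyProt.oneUDcpa Q).QCPASecure n k := by
  open CopyProt in
  intro A hA
  obtain ⟨pn, hpn⟩ := hn
  obtain ⟨pk, hpk⟩ := hk
  -- The shift has to be at least the number of programs and larger than the input length. The
  -- polynomial `pn` stands in for `n`, which need not be computable.
  obtain ⟨ν, hν, hle⟩ := hQ _ (reduction_uniform B.len (B.len + pn + 1) hA Q.eval_qpt)
  -- The error is the advantage against the copy protection scheme plus a polynomial bound on `n +
  -- k` times the negligible imbalance.
  refine ⟨_, hν.add ((B.balanced.polynomial_mul ((pn + pk).map (Nat.castRingHom ℝ))).trans_abs_le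
    (g := fun κ => ((n κ + k κ : ℕ) : ℝ) * |(sampleExpect (B.sample κ) fun f =>
        𝔼 x : Fin (B.len.eval κ) → Bool, if B.fn κ f x = false then (1 : ℝ) else 0) -
      (sampleExpect (B.sample κ) fun f =>
        𝔼 x : Fin (B.len.eval κ) → Bool, if B.fn κ f x = true then (1 : ℝ) else 0)|)
    fun κ => ?_), fun κ => ?_⟩
  · rw [abs_mul, abs_mul]
    refine mul_le_mul_of_nonneg_right ?_ (abs_nonneg _)
    have h : Polynomial.eval (κ : ℝ) ((pn + pk).map (Nat.castRingHom ℝ)) =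
        (((pn + pk).eval κ : ℕ) : ℝ) := by
      simp [Polynomial.eval_natCast_map]
    rw [h, Nat.abs_cast, Nat.abs_cast, Polynomial.eval_add]
    exact Nat.cast_le.2 (Nat.add_le_add (hpn κ) (hpk κ))
  · have hA₁ : ((A κ).pirate.flatMap OGate.code).length ≤ ((A κ).code OGate.code).length := by
      simp only [Adversary.code, listCode, List.length_append]
      omega
    have hA₂ : ∀ l ∈ (A κ).free, (l.flatMap OGate.code).length ≤
        ((A κ).code OGate.code).length := fun l hl => by
      have := length_le_flatMap (f := listCode OGate.code) hl
      simp only [Adversary.code, listCode, List.length_append] at this ⊢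
      omega
    have hP : (B.len + pn + 1).eval κ = B.len.eval κ + pn.eval κ + 1 := by simp
    have h := qcpaGame_le Q (k := k κ) (κ := κ)
      (N := shiftNo (Q.eval κ) (A κ) ((B.len + pn + 1).eval κ)) (hpos κ)
      (by have := hpn κ; simp only [shiftNo, hP]; omega)
      (by simp only [shiftNo, hP]; omega)
      (low_of_length (hA₁.trans (by simp only [shiftNo]; omega)))
      (fun l hl => low_of_length ((hA₂ l hl).trans (by simp only [shiftNo]; omega)))
      (fun g hg w hw => by
        have h₁ := g.lt_length_code hw
        have h₂ := length_le_flatMap (f := Gate.code) hg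
        simp only [shiftNo, listCode, List.length_append]
        omega)
    have := hle κ
    simp only [Pi.add_apply]
    linarith
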